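/- Consider the single-machine problem $1\,|\,r_j,d_j,p_j=1,\ \lambda+\{\ell_1,\dots,\ell_K\}\,|\,\mathrm{cost}(\text{calibrations})$. An instance consists of $n\ge 1$ unit-time jobs with integral release dates $r_j$ and deadlines $d_j$, of $K\ge 1$ calibration types with integral lengths $\ell_k\ge 0$ and integral costs $f_k\ge 0$, and of an integral activation time $\lambda\ge 0$. A schedule consists of an integral starting time $s_j$ for each job $j$ and of a finite list of calibrations, each with an integral starting time $t$ and a type $k$. A calibration $(t,k)$ activates the machine during $[t,t+\lambda)$, when no job can be processed, and keeps it calibrated during $[t+\lambda,t+\lambda+\ell_k)$. Calibrations may be started at any time, even while the machine is calibrated. The schedule is feasible if the intervals $[s_j,s_j+1)$ are pairwise disjoint and, for each job $j$, $[s_j,s_j+1)$ is contained in $[r_j,d_j)$, is disjoint from the activation interval of every calibration, and is contained in the calibrated interval of some calibration. The cost of a schedule is the sum of the costs of its calibrations. Then there are a program for a unit-cost random access machine on integers (with addition, subtraction, comparison and indirect addressing) and a constant $C$ such that on every instance the program halts after at most $C\,n^{16}K^2$ steps, and outputs a feasible schedule of minimum cost together with its cost, or reports that there is no feasible schedule.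 The same holds if calibrations may only be started at times $t\ge\min_j r_j$. In short, the problem is solvable in time $O(n^{16}K^2)$. -/

import Mathlib

namespace Calibration

/-! ## The scheduling problem -/

/-- Unit-time jobs `j : Fin n` with integral release dates and deadlines, calibration types
`k : Fin K` with integral lengths and costs, and the common activation time `act` (the `λ` of
`1 | r_j, d_j, p_j = 1, λ + {ℓ_1, …, ℓ_K} | cost(calibrations)`). -/
structure Instance where
  n : ℕ
  K : ℕ
  act : ℕ
  release : Fin n → ℤ
  deadline : Fin n → ℤ
  len : Fin K → ℕ
  cost : Fin K → ℕ

/-- A calibration of type `kind` started at time `start`: the machine is being activated during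
`[start, start + act)` and calibrated during `[start + act, start + act + len kind)`. -/
structure Cal (I : Instance) where
  start : ℤ
  kind : Fin I.K

/-- Job `j` is processed during `[jobStart j, jobStart j + 1)`. -/
structure Schedule (I : Instance) where
  cals : List (Cal I)
  jobStart : Fin I.n → ℤ

/-- The total calibration cost. -/
def Schedule.totalCost {I : Instance} (S : Schedule I) : ℕ :=
  (S.cals.map fun c => I.cost c.kind).sum

/-- When calibrations may be started: at any time whatsoever, or only from the earliest release
date on. -/
inductive StartRule where
  | anyTime
  | fromFirstRelease

def StartRule.Allows (ρ : StartRule) (I : Instance) (t : ℤ) : Prop :=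
  match ρ with
  | .anyTime => True
  | .fromFirstRelease => ∃ j, I.release j ≤ t

/-- Feasibility of a schedule on the single machine. The machine may be recalibrated at any time,
also while it is calibrated. -/
structure Schedule.Feasible (ρ : StartRule) {I : Instance} (S : Schedule I) : Prop where
  /-- every job is processed between its release date and its deadline -/
  window : ∀ j, I.release j ≤ S.jobStart j ∧ S.jobStart j + 1 ≤ I.deadline j
  /-- the machine processes at most one (unit-time) job at a time -/
  disjoint : ∀ i j, i ≠ j →
    S.jobStart i + 1 ≤ S.jobStart j ∨ S.jobStart j + 1 ≤ S.jobStart i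
  /-- the machine is calibrated whenever it processes a job -/
  calibrated : ∀ j, ∃ c ∈ S.cals,
    c.start + I.act ≤ S.jobStart j ∧ S.jobStart j + 1 ≤ c.start + I.act + I.len c.kind
  /-- the machine processes no job during an activation `[start, start + act)` -/
  activation : ∀ j, ∀ c ∈ S.cals,
    S.jobStart j + 1 ≤ c.start ∨ c.start + I.act ≤ S.jobStart j
  /-- every calibration is started at a permitted time -/
  starts : ∀ c ∈ S.cals, ρ.Allows I c.start

/-- A feasible schedule of minimum total calibration cost. -/
def Schedule.Optimal (ρ : StartRule) {I : Instance} (S : Schedule I) : Prop :=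
  S.Feasible ρ ∧ ∀ S' : Schedule I, S'.Feasible ρ → S.totalCost ≤ S'.totalCost

/-! ## The machine model

A unit-cost random access machine on integers, programmed with structured commands. The only
arithmetic operations are addition and subtraction. A program is a fixed finite
command, hence mentions only finitely many registers, arrays and constants. -/

/-- A memory: integer registers, and integer arrays with integer addresses. -/
structure State where
  reg : ℕ → ℤ
  arr : ℕ → ℤ → ℤ

inductive Expr where
  | const (c : ℤ)
  | reg (x : ℕ)
  | read (a : ℕ) (addr : Expr)
  | add (e₁ e₂ : Expr)
  | sub (e₁ e₂ : Expr)

def Expr.eval (s : State) : Expr → ℤ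
  | const c => c
  | reg x => s.reg x
  | read a e => s.arr a (e.eval s)
  | add e₁ e₂ => e₁.eval s + e₂.eval s
  | sub e₁ e₂ => e₁.eval s - e₂.eval s

/-- One step for every constant, register access, array access, addition and subtraction. -/
def Expr.steps : Expr → ℕ
  | const _ => 1
  | reg _ => 1
  | read _ e => e.steps + 1
  | add e₁ e₂ => e₁.steps + e₂.steps + 1
  | sub e₁ e₂ => e₁.steps + e₂.steps + 1

inductive Cmd where
  | skip
  | assign (x : ℕ) (e : Expr)
  | write (a : ℕ) (addr e : Expr)
  | seq (p q : Cmd)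
  | ifLe (e₁ e₂ : Expr) (p q : Cmd)
  | whileLe (e₁ e₂ : Expr) (p : Cmd)

def State.setReg (s : State) (x : ℕ) (v : ℤ) : State :=
  { s with reg := Function.update s.reg x v }

def State.setArr (s : State) (a : ℕ) (i v : ℤ) : State :=
  { s with arr := Function.update s.arr a (Function.update (s.arr a) i v) }

/-- `Exec p s T s'`: the command `p`, started in memory `s`, halts after exactly `T` steps in
memory `s'`. Assignments, writes and tests take one step besides the evaluation of their
expressions. -/
inductive Exec : Cmd → State → ℕ → State → Prop where
  | skip (s : State) : Exec .skip s 1 s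
  | assign (x : ℕ) (e : Expr) (s : State) :
      Exec (.assign x e) s (e.steps + 1) (s.setReg x (e.eval s))
  | write (a : ℕ) (addr e : Expr) (s : State) :
      Exec (.write a addr e) s (addr.steps + e.steps + 1) (s.setArr a (addr.eval s) (e.eval s))
  | seq {p q : Cmd} {s₁ s₂ s₃ : State} {T₁ T₂ : ℕ} :
      Exec p s₁ T₁ s₂ → Exec q s₂ T₂ s₃ → Exec (.seq p q) s₁ (T₁ + T₂) s₃
  | ifTrue {e₁ e₂ : Expr} {p q : Cmd} {s s' : State} {T : ℕ} :
      e₁.eval s ≤ e₂.eval s → Exec p s T s' →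
      Exec (.ifLe e₁ e₂ p q) s (e₁.steps + e₂.steps + 1 + T) s'
  | ifFalse {e₁ e₂ : Expr} {p q : Cmd} {s s' : State} {T : ℕ} :
      ¬ e₁.eval s ≤ e₂.eval s → Exec q s T s' →
      Exec (.ifLe e₁ e₂ p q) s (e₁.steps + e₂.steps + 1 + T) s'
  | whileDone {e₁ e₂ : Expr} {p : Cmd} {s : State} :
      ¬ e₁.eval s ≤ e₂.eval s → Exec (.whileLe e₁ e₂ p) s (e₁.steps + e₂.steps + 1) s
  | whileStep {e₁ e₂ : Expr} {p : Cmd} {s s' s'' : State} {T T' : ℕ} :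
      e₁.eval s ≤ e₂.eval s → Exec p s T s' → Exec (.whileLe e₁ e₂ p) s' T' s'' →
      Exec (.whileLe e₁ e₂ p) s (e₁.steps + e₂.steps + 1 + T + T') s''

/-! ## Input and output -/

/-- The array holding `v 0, …, v (m - 1)` at addresses `0, …, m - 1`, and `0` elsewhere. -/
def arrayOf {m : ℕ} (v : Fin m → ℤ) (i : ℤ) : ℤ :=
  if h : 0 ≤ i ∧ i < m then v ⟨i.toNat, by omega⟩ else 0

/-- The input: `n`, `K` and the activation time in registers `0, 1, 2`; release dates, deadlines,
calibration lengths and calibration costs in arrays `0, 1, 2, 3`; everything else is `0`. -/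
def Instance.input (I : Instance) : State where
  reg x := match x with
    | 0 => I.n
    | 1 => I.K
    | 2 => I.act
    | _ => 0
  arr a := match a with
    | 0 => arrayOf I.release
    | 1 => arrayOf I.deadline
    | 2 => arrayOf fun k => (I.len k : ℤ)
    | 3 => arrayOf fun k => (I.cost k : ℤ)
    | _ => fun _ => 0

/-- The memory `s` presents the schedule `S` as output: register `0` is `1`, register `1` holds the
total cost, register `2` the number of calibrations, array `0` the starting times of the jobs,
arrays `1` and `2` the starting times and the types of the calibrations. -/
structure State.Presents (s : State) {I : Instance} (S : Schedule I) : Prop where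
  flag : s.reg 0 = 1
  cost : s.reg 1 = S.totalCost
  count : s.reg 2 = S.cals.length
  jobs : ∀ j : Fin I.n, s.arr 0 (j : ℕ) = S.jobStart j
  calStarts : ∀ i : Fin S.cals.length, s.arr 1 (i : ℕ) = (S.cals.get i).start
  calKinds : ∀ i : Fin S.cals.length, s.arr 2 (i : ℕ) = ((S.cals.get i).kind : ℕ)

/-- The final memory `s` answers the instance `I`: it presents an optimal schedule, or, if there is
no feasible schedule, register `0` is `0`. -/
def State.Answers (s : State) (ρ : StartRule) (I : Instance) : Prop :=
  (∃ S : Schedule I, S.Optimal ρ ∧ s.Presents S) ∨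
    ((¬ ∃ S : Schedule I, S.Feasible ρ) ∧ s.reg 0 = 0)

end Calibration

set_option linter.unusedSimpArgs false

namespace Calibration

/-! ## Normal form of a schedule -/

/-! The argument has three layers: a structure theorem for optimal schedules, a dynamic program over
polynomially many slots, and a verified implementation with a step count.

Structure. Assign to each job one calibration covering it and forget the types. What remains is a
pair of start times `(c j, t j)` per job, and each group of jobs sharing a calibration is charged,
at its last job, the cheapest type that is long enough. This charge is monotone in `t j - c j`, so
three moves never increase the cost: pushing a calibration right together with everything it
touches, moving a single job left, and swapping two jobs that are out of deadline order
(`NormalForm.exists_shift_right`, `NormalForm.shift_left`, `NormalForm.swap`). A pair on which no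
move makes progress has `c j = d i - a - b * lam` and `t j = r i + a` or `t j = c j + lam + a` with
`a, b ≤ n`, and a job never waits for a job of later deadline once it is released
(`NormalForm.exists_canonical`). There are O(n^3) values of `c` and, for each of them, O(n^2) values
of `t`, hence O(n^5) slots `(c, t)`.

Dynamic program. Number the jobs by deadline. An entry `(k, p, q)` concerns those of the first `k`
jobs that are released after slot `p` and not after slot `q`, placed between these slots. If its
last job has index `k` and takes slot `m`, earliest-deadline order puts the jobs released by time `t
m` before `m`, and the others cannot start before their later release; the problem splits at `m`.
The calibration cost splits with it, because a calibration is paid at the unique place where two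
consecutive slots have different calibrations (`SlotData.pathCost_split`). `SlotData.table_sound`
and `SlotData.table_le` are the two halves of correctness. `Schedule.Feasible.exists_normalForm` and
`NormalForm.feasible` connect slots with genuine schedules, and a value `top` exceeding every finite
optimum encodes infeasibility.

Running time. The table has n · O(n^5)^2 entries, each computed by a scan over O(n^5) slots, giving
O(n^16). The types enter only in the preparation, through one pass over them per job and one per
slot, so O(n^5 K) there. Programs are treated by a total-correctness predicate `Ends` with explicit
step bounds, whose loop rule is `Ends.forLt`. -/

/-- Every job `j` is processed at time `t j`, and the latest calibration started before is started
at time `c j`. The calibration types are left open. -/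
structure NormalForm {n : ℕ} (r d : Fin n → ℤ) (lam : ℤ) (A : ℤ → Prop) (c t : Fin n → ℤ) :
    Prop where
  release : ∀ j, r j ≤ t j
  deadline : ∀ j, t j < d j
  active : ∀ j, c j + lam ≤ t j
  allowed : ∀ j, A (c j)
  chain : ∀ i j, t i < t j → c i = c j ∨ t i < c j
  inj : Function.Injective t

/-- Job `j` is the last one of its calibration. -/
def IsLast {n : ℕ} (c t : Fin n → ℤ) (j : Fin n) : Prop := ∀ i, t j < t i → c i ≠ c j

open Classical in
/-- The cost, where `F x` is the cost of a calibration that is used for a job starting `x` time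
units after the start of the calibration. -/
noncomputable def normalCost {n : ℕ} (F : ℤ → ℤ) (c t : Fin n → ℤ) : ℤ :=
  ∑ j, if IsLast c t j then F (t j - c j) else 0

/-- The common reason why the moves below are free: the cost can only drop if no job newly becomes
the last one of its calibration and no job moves away from its calibration start. -/
theorem normalCost_le {n : ℕ} {F : ℤ → ℤ} (hF : Monotone F) (hF0 : ∀ x, 0 ≤ F x)
    {c t c' t' : Fin n → ℤ} (hl : ∀ j, IsLast c' t' j → IsLast c t j)
    (hd : ∀ j, t' j - c' j ≤ t j - c j) : normalCost F c' t' ≤ normalCost F c t := by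
  classical
  unfold normalCost
  refine Finset.sum_le_sum fun j _ => ?_
  by_cases h' : IsLast c' t' j
  · rw [if_pos h', if_pos (hl j h')]; exact hF (hd j)
  · rw [if_neg h']; split_ifs
    · exact hF0 _
    · exact le_rfl

theorem normalCost_comp_perm {n : ℕ} (F : ℤ → ℤ) (c t : Fin n → ℤ) (e : Equiv.Perm (Fin n)) :
    normalCost F (c ∘ e) (t ∘ e) = normalCost F c t := by
  classical
  unfold normalCost
  rw [← Equiv.sum_comp e (fun j => if IsLast c t j then F (t j - c j) else 0)]
  refine Finset.sum_congr rfl fun j _ => ?_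
  have : IsLast (c ∘ e) (t ∘ e) j ↔ IsLast c t (e j) := by
    constructor
    · intro h i hi
      have := h (e.symm i)
      simp only [Function.comp, Equiv.apply_symm_apply] at this
      exact this hi
    · intro h i hi
      exact h (e i) hi
  simp only [this, Function.comp]

/-- The instants reached from the start `c₀` of a calibration by following activations and jobs
without a gap. -/
inductive Pushed {n : ℕ} (lam : ℤ) (c t : Fin n → ℤ) (c₀ : ℤ) : ℤ → Prop where
  | base : Pushed lam c t c₀ c₀
  | cal (i : Fin n) : Pushed lam c t c₀ (c i) → Pushed lam c t c₀ (c i + lam)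
  | job (i : Fin n) : Pushed lam c t c₀ (t i) → Pushed lam c t c₀ (t i + 1)

/-! ### Cost-preserving moves and canonical schedules -/

section Shift

variable {n : ℕ} {r d : Fin n → ℤ} {lam : ℤ} {A : ℤ → Prop} {c t : Fin n → ℤ}

/-- An instant is pushed because something tight ends there, and a job starting at it either belongs
to the same calibration or, when its own calibration starts right there, has `c j = t j`. So a moved
job always takes its calibration along, and `t j - c j` does not grow. -/
theorem Pushed.of_job (h : NormalForm r d lam A c t) (hlam : 0 ≤ lam) {i₀ : Fin n} {z : ℤ}
    (hz : Pushed lam c t (c i₀) z) : ∀ j, t j = z → Pushed lam c t (c i₀) (c j) := by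
  induction hz with
  | base =>
    intro j hj
    have h1 := h.active i₀
    rcases lt_trichotomy (t i₀) (t j) with h2 | h2 | h2
    · omega
    · rw [← h.inj h2]; exact .base
    · rcases h.chain j i₀ h2 with h3 | h3
      · rw [h3]; exact .base
      · omega
  | cal i hi ih =>
    intro j hj
    have h1 := h.active i
    have h4 := h.active j
    rcases lt_trichotomy (t i) (t j) with h2 | h2 | h2
    · omega
    · rw [← h.inj h2]; exact hi
    · rcases h.chain j i h2 with h3 | h3
      · rw [h3]; exact hi
      · omega
  | job i hi ih =>
    intro j hj
    have h4 := h.active j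
    rcases h.chain i j (by omega) with h3 | h3
    · rw [← h3]; exact ih i rfl
    · have : c j = t i + 1 := by omega
      rw [this]; exact .job i hi

/-- Each step of the chain adds 1 or `lam`, and each step to a larger instant uses a job or a
calibration start not counted before, since its time lies strictly below the new instant. This
bounds the numbers of both kinds of steps by `n`. -/
theorem Pushed.exists_eq (hlam : 0 ≤ lam) {c₀ z : ℤ} (hz : Pushed lam c t c₀ z) :
    ∃ a b : ℕ, z = c₀ + a + b * lam ∧ a ≤ (Finset.univ.filter fun i => t i < z).card ∧
      b ≤ (Finset.univ.filter fun i => c i < z).card := by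
  induction hz with
  | base => exact ⟨0, 0, by simp⟩
  | cal i hi ih =>
    obtain ⟨a, b, h1, h2, h3⟩ := ih
    rcases hlam.eq_or_lt with h0 | h0
    -- For `lam = 0` the step does not move the instant, so `b` must stay as it is: the calibration
    -- start is not strictly earlier.
    · exact ⟨a, b, by rw [← h0] at h1 ⊢; simpa using h1, by simpa [← h0] using h2,
        by simpa [← h0] using h3⟩
    · refine ⟨a, b + 1, by push_cast; linarith, h2.trans (Finset.card_le_card ?_), ?_⟩
      · intro x; simp only [Finset.mem_filter, Finset.mem_univ, true_and]; omega
      · refine Nat.lt_of_le_of_lt h3 (Finset.card_lt_card ?_)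
        refine (Finset.ssubset_iff_of_subset ?_).2 ⟨i, ?_, ?_⟩
        · intro x; simp only [Finset.mem_filter, Finset.mem_univ, true_and]; omega
        · simp [h0]
        · simp
  | job i hi ih =>
    obtain ⟨a, b, h1, h2, h3⟩ := ih
    refine ⟨a + 1, b, by push_cast; linarith, ?_, h3.trans (Finset.card_le_card ?_)⟩
    · refine Nat.lt_of_le_of_lt h2 (Finset.card_lt_card ?_)
      refine (Finset.ssubset_iff_of_subset ?_).2 ⟨i, ?_, ?_⟩
      · intro x; simp only [Finset.mem_filter, Finset.mem_univ, true_and]; omega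
      · simp
      · simp
    · intro x; simp only [Finset.mem_filter, Finset.mem_univ, true_and]; omega

/-- Move every calibration and job that starts at a pushed instant by one unit. Being closed under
tight contact, the pushed set cannot collide with what stays, so only deadlines could object. Order
and grouping survive, and by `Pushed.of_job` no calibration needs to become longer. -/
theorem NormalForm.exists_shift_right (h : NormalForm r d lam A c t) (hlam : 0 ≤ lam)
    (hA : ∀ x y, x ≤ y → A x → A y) {F : ℤ → ℤ} (hF : Monotone F) (hF0 : ∀ x, 0 ≤ F x)
    (i₀ : Fin n) (hslack : ∀ j, Pushed lam c t (c i₀) (t j) → t j + 1 < d j) :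
    ∃ c' t', NormalForm r d lam A c' t' ∧ normalCost F c' t' ≤ normalCost F c t ∧
      ∑ j, c j < ∑ j, c' j := by
  classical
  set R := Pushed lam c t (c i₀) with hR
  have hchain : ∀ i j, t i < t j →
      (t i + if R (t i) then 1 else 0) < (t j + if R (t j) then 1 else 0) := by
    intro i j hij
    by_cases h1 : R (t i) <;> by_cases h2 : R (t j) <;> simp only [h1, h2, if_true, if_false]
    · omega
    · have : t j ≠ t i + 1 := fun h3 => h2 (h3 ▸ Pushed.job i h1)
      omega
    · omega
    · omega
  refine ⟨fun j => c j + if R (c j) then 1 else 0, fun j => t j + if R (t j) then 1 else 0,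
    ⟨?_, ?_, ?_, ?_, ?_, ?_⟩, ?_, ?_⟩
  · intro j; have := h.release j; split_ifs <;> omega
  · intro j
    by_cases h1 : R (t j)
    · simpa [h1] using hslack j h1
    · simpa [h1] using h.deadline j
  · intro j
    have h3 := h.active j
    by_cases h1 : R (c j) <;> by_cases h2 : R (t j) <;> simp only [h1, h2, if_true, if_false]
    · omega
    · have : t j ≠ c j + lam := fun h4 => h2 (h4 ▸ Pushed.cal j h1)
      omega
    · omega
    · omega
  · intro j; refine hA _ _ ?_ (h.allowed j); split_ifs <;> omega
  · intro i j hij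
    have hij' : t i < t j := by
      rcases lt_trichotomy (t i) (t j) with h2 | h2 | h2
      · exact h2
      · rw [h.inj h2] at hij; exact absurd hij (lt_irrefl _)
      · exact absurd (hchain j i h2) (not_lt.2 hij.le)
    rcases h.chain i j hij' with h3 | h3
    · left; simp only [h3]
    · right
      by_cases h1 : R (t i) <;> by_cases h2 : R (c j) <;> simp only [h1, h2, if_true, if_false]
      · omega
      · have : c j ≠ t i + 1 := fun h4 => h2 (h4 ▸ Pushed.job i h1)
        omega
      · omega
      · omega
  · intro i j hij
    rcases lt_trichotomy (t i) (t j) with h2 | h2 | h2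
    · exact absurd hij (hchain i j h2).ne
    · exact h.inj h2
    · exact absurd hij (hchain j i h2).ne'
  · refine normalCost_le hF hF0 ?_ ?_
    · intro j hj i hi hc
      refine hj i (hchain j i hi) ?_
      simp only [hc]
    · intro j
      have h1 : R (t j) → R (c j) := fun h1 => Pushed.of_job h hlam h1 j rfl
      by_cases h2 : R (t j)
      · simp [h2, h1 h2]
      · simp only [h2, if_false]; split_ifs <;> omega
  · refine Finset.sum_lt_sum (fun j _ => by split_ifs <;> omega) ⟨i₀, Finset.mem_univ _, ?_⟩
    have : R (c i₀) := Pushed.base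
    simp [this]

/-- The three inequations list everything that could block the move: the release date, the end of
the activation, and a job occupying the preceding time unit. -/
theorem NormalForm.shift_left (h : NormalForm r d lam A c t) {F : ℤ → ℤ} (hF : Monotone F)
    (hF0 : ∀ x, 0 ≤ F x) (j : Fin n) (h1 : t j ≠ r j) (h2 : t j ≠ c j + lam)
    (h3 : ∀ i, t i ≠ t j - 1) :
    NormalForm r d lam A c (Function.update t j (t j - 1)) ∧
      normalCost F c (Function.update t j (t j - 1)) ≤ normalCost F c t := by
  have hr := h.release j
  have ha := h.active j
  have key : ∀ x y, t x < t y →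
      Function.update t j (t j - 1) x < Function.update t j (t j - 1) y := by
    intro x y hxy
    have := h3 x
    simp only [Function.update_apply]
    split_ifs with hx hy hy
    · subst hx hy; omega
    · subst hx; omega
    · subst hy; omega
    · exact hxy
  have key' : ∀ x y, Function.update t j (t j - 1) x < Function.update t j (t j - 1) y →
      t x < t y := by
    intro x y hxy
    rcases lt_trichotomy (t x) (t y) with h4 | h4 | h4
    · exact h4
    · rw [h.inj h4] at hxy; exact absurd hxy (lt_irrefl _)
    · exact absurd (key y x h4) (not_lt.2 hxy.le)
  have hle : ∀ x, Function.update t j (t j - 1) x ≤ t x := by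
    intro x; simp only [Function.update_apply]; split_ifs with hx
    · subst hx; omega
    · exact le_rfl
  refine ⟨⟨?_, ?_, ?_, h.allowed, ?_, ?_⟩, normalCost_le hF hF0 ?_ ?_⟩
  · intro x; simp only [Function.update_apply]; split_ifs with hx
    · subst hx; omega
    · exact h.release x
  · intro x; exact (hle x).trans_lt (h.deadline x)
  · intro x; simp only [Function.update_apply]; split_ifs with hx
    · subst hx; omega
    · exact h.active x
  · intro x y hxy
    rcases h.chain x y (key' x y hxy) with h4 | h4
    · exact .inl h4
    · exact .inr ((hle x).trans_lt h4)
  · intro x y hxy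
    rcases lt_trichotomy (t x) (t y) with h4 | h4 | h4
    · exact absurd hxy (key x y h4).ne
    · exact h.inj h4
    · exact absurd hxy (key y x h4).ne'
  · intro x hx y hy; exact hx y (key x y hy)
  · intro x; have := hle x; omega

/-- Job `j` moves later but only to `t i < d i ≤ d j`; job `i` moves earlier but not before its
release. The set of occupied slots is unchanged, so the cost is too. -/
theorem NormalForm.swap (h : NormalForm r d lam A c t) (hd : Monotone d) {i j : Fin n}
    (hij : i < j) (h1 : r i ≤ t j) (h2 : t j < t i) :
    NormalForm r d lam A (c ∘ Equiv.swap i j) (t ∘ Equiv.swap i j) := by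
  have hdi := h.deadline i
  have hdd := hd hij.le
  have hrj := h.release j
  refine ⟨?_, ?_, fun x => h.active _, fun x => h.allowed _, fun x y => h.chain _ _,
    h.inj.comp (Equiv.injective _)⟩
  · intro x
    simp only [Function.comp, Equiv.swap_apply_def]
    split_ifs with hx hy
    · subst hx; exact h1
    · subst hy; omega
    · exact h.release x
  · intro x
    simp only [Function.comp, Equiv.swap_apply_def]
    split_ifs with hx hy
    · subst hx; omega
    · subst hy; omega
    · exact h.deadline x

/-- Every schedule in normal form can be replaced by one that uses only polynomially many time
points and that processes the jobs in earliest-deadline order. -/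
theorem NormalForm.exists_canonical (h : NormalForm r d lam A c t) (hlam : 0 ≤ lam)
    (hd : Monotone d) (hA : ∀ x y, x ≤ y → A x → A y) {F : ℤ → ℤ} (hF : Monotone F)
    (hF0 : ∀ x, 0 ≤ F x) :
    ∃ c' t', NormalForm r d lam A c' t' ∧ normalCost F c' t' ≤ normalCost F c t ∧
      (∀ j, ∃ i, ∃ a ≤ n, ∃ b ≤ n, c' j = d i - (a : ℕ) - (b : ℕ) * lam) ∧
      (∀ j, (∃ i, ∃ a ≤ n, t' j = r i + (a : ℕ)) ∨ ∃ a ≤ n, t' j = c' j + lam + (a : ℕ)) ∧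
      (∀ i j, i < j → r i ≤ t' j → t' i < t' j) := by
  let X : Type := {x : (Fin n → ℤ) × (Fin n → ℤ) //
    NormalForm r d lam A x.1 x.2 ∧ normalCost F x.1 x.2 ≤ normalCost F c t}
  -- Lexicographic potential: maximise `∑ c`, then minimise `∑ t`, then maximise `∑ j * t j`. Right
  -- shifts improve the first component even though they may spoil the second; left shifts leave `c`
  -- alone; swaps only permute `c` and `t`. The subtracted bounds keep the differences nonnegative,
  -- so `toNat` loses nothing.
  let μ₁ : X → ℕ := fun x => (∑ j, d j - ∑ j, x.1.1 j).toNat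
  let μ₂ : X → ℕ := fun x => (∑ j, x.1.2 j - ∑ j, r j).toNat
  let μ₃ : X → ℕ := fun x => (∑ j : Fin n, ((j : ℕ) : ℤ) * d j - ∑ j : Fin n, ((j : ℕ) : ℤ) * x.1.2 j).toNat
  let μ : X → ℕ ×ₗ ℕ ×ₗ ℕ := fun x => toLex (μ₁ x, toLex (μ₂ x, μ₃ x))
  obtain ⟨m, -, hm⟩ := WellFounded.has_min (InvImage.wf μ wellFounded_lt) Set.univ
    ⟨⟨(c, t), h, le_rfl⟩, trivial⟩
  obtain ⟨⟨c', t'⟩, hN, hcost⟩ := m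
  have hmin : ∀ x : X, ¬ μ x < μ ⟨(c', t'), hN, hcost⟩ := fun x => hm x trivial
  dsimp only at hN hcost
  have hdc : ∀ {c' t'}, NormalForm r d lam A c' t' → ∑ j, c' j ≤ ∑ j, d j := fun hN =>
    Finset.sum_le_sum fun j _ => by have := hN.active j; have := hN.deadline j; omega
  have hrt : ∀ {c' t'}, NormalForm r d lam A c' t' → ∑ j, r j ≤ ∑ j, t' j := fun hN =>
    Finset.sum_le_sum fun j _ => hN.release j
  have hjt : ∀ {c' t'}, NormalForm r d lam A c' t' →
      ∑ j : Fin n, ((j : ℕ) : ℤ) * t' j ≤ ∑ j : Fin n, ((j : ℕ) : ℤ) * d j := fun hN =>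
    Finset.sum_le_sum fun j _ => mul_le_mul_of_nonneg_left (hN.deadline j).le (by positivity)
  refine ⟨c', t', hN, hcost, ?_, ?_, ?_⟩
  · intro j
    by_contra hno
    -- A pushed job without slack ends exactly at its deadline, and its end is again a pushed
    -- instant; this expresses a deadline as `c' j + a + b * lam`.
    have hslack : ∀ i, Pushed lam c' t' (c' j) (t' i) → t' i + 1 < d i := by
      intro i hi
      by_contra hlt
      have hdi := hN.deadline i
      obtain ⟨a, b, h1, h2, h3⟩ := Pushed.exists_eq hlam (Pushed.job i hi)
      refine hno ⟨i, a, ?_, b, ?_, ?_⟩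
      · exact h2.trans ((Finset.card_le_univ _).trans (by simp))
      · exact h3.trans ((Finset.card_le_univ _).trans (by simp))
      · have : d i = t' i + 1 := by omega
        rw [this, h1]; ring
    obtain ⟨c'', t'', hN', hc', hlt⟩ := hN.exists_shift_right hlam hA hF hF0 j hslack
    refine hmin ⟨(c'', t''), hN', hc'.trans hcost⟩ ?_
    rw [Prod.Lex.toLex_lt_toLex]
    left
    have := hdc hN'
    simp only [μ₁]
    omega
  · intro j
    -- Induction on the number of earlier jobs: follow the contiguous block of jobs to the left
    -- until it meets a release date or the end of an activation; every job passed adds 1 to the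
    -- offset.
    have step : ∀ k : ℕ, ∀ j, (Finset.univ.filter fun i => t' i < t' j).card ≤ k →
        (∃ i, ∃ a ≤ k, t' j = r i + (a : ℕ)) ∨ ∃ a ≤ k, t' j = c' j + lam + (a : ℕ) := by
      intro k
      induction k with
      | zero =>
        intro j hj
        by_contra hno
        push Not at hno
        have h1 : t' j ≠ r j := fun h1 => hno.1 j 0 le_rfl (by simpa using h1)
        have h2 : t' j ≠ c' j + lam := fun h2 => hno.2 0 le_rfl (by simpa using h2)
        have h3 : ∀ i, t' i ≠ t' j - 1 := by
          intro i hi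
          have : i ∈ (Finset.univ.filter fun i => t' i < t' j) := by simp [hi]
          rw [Finset.card_eq_zero.1 (Nat.le_zero.1 hj)] at this
          simp at this
        obtain ⟨hN', hc'⟩ := hN.shift_left hF hF0 j h1 h2 h3
        refine hmin ⟨(c', Function.update t' j (t' j - 1)), hN', hc'.trans hcost⟩ ?_
        rw [Prod.Lex.toLex_lt_toLex]
        refine .inr ⟨rfl, ?_⟩
        rw [Prod.Lex.toLex_lt_toLex]
        left
        have := hrt hN'
        have e : ∑ i, Function.update t' j (t' j - 1) i < ∑ i, t' i := by
          refine Finset.sum_lt_sum (fun i _ => ?_) ⟨j, Finset.mem_univ _, by simp⟩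
          simp only [Function.update_apply]; split_ifs with hx
          · subst hx; omega
          · exact le_rfl
        exact (Int.toNat_lt_toNat (sub_pos.2 (this.trans_lt e))).2 (sub_lt_sub_right e _)
      | succ k ih =>
        intro j hj
        by_contra hno
        push Not at hno
        have h1 : t' j ≠ r j := fun h1 => hno.1 j 0 (Nat.zero_le _) (by simpa using h1)
        have h2 : t' j ≠ c' j + lam := fun h2 => hno.2 0 (Nat.zero_le _) (by simpa using h2)
        have h3 : ∀ i, t' i ≠ t' j - 1 := by
          intro i hi
          have hlt : (Finset.univ.filter fun x => t' x < t' i).card <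
              (Finset.univ.filter fun x => t' x < t' j).card := by
            refine Finset.card_lt_card ((Finset.ssubset_iff_of_subset ?_).2 ⟨i, ?_, ?_⟩)
            · intro x; simp only [Finset.mem_filter, Finset.mem_univ, true_and]; omega
            · simp [hi]
            · simp
          -- If `c' j` lay after `t' i = t' j - 1`, then `t' j = c' j` and `lam = 0`, which is the
          -- tight case excluded by `h2`.
          have hcc : c' i = c' j := by
            have := hN.active j
            rcases hN.chain i j (by omega) with h4 | h4
            · exact h4
            · omega
          rcases ih i (by omega) with ⟨x, a, ha, e⟩ | ⟨a, ha, e⟩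
          · exact hno.1 x (a + 1) (by omega) (by push_cast; omega)
          · exact hno.2 (a + 1) (by omega) (by push_cast; omega)
        obtain ⟨hN', hc'⟩ := hN.shift_left hF hF0 j h1 h2 h3
        refine hmin ⟨(c', Function.update t' j (t' j - 1)), hN', hc'.trans hcost⟩ ?_
        rw [Prod.Lex.toLex_lt_toLex]
        refine .inr ⟨rfl, ?_⟩
        rw [Prod.Lex.toLex_lt_toLex]
        left
        have := hrt hN'
        have e : ∑ i, Function.update t' j (t' j - 1) i < ∑ i, t' i := by
          refine Finset.sum_lt_sum (fun i _ => ?_) ⟨j, Finset.mem_univ _, by simp⟩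
          simp only [Function.update_apply]; split_ifs with hx
          · subst hx; omega
          · exact le_rfl
        exact (Int.toNat_lt_toNat (sub_pos.2 (this.trans_lt e))).2 (sub_lt_sub_right e _)
    exact step n j ((Finset.card_le_univ _).trans (by simp))
  · intro i j hij hr
    by_contra hlt
    have hne : t' i ≠ t' j := fun e => hij.ne (hN.inj e)
    have hN' := hN.swap hd hij hr (by omega)
    have hc' : normalCost F (c' ∘ Equiv.swap i j) (t' ∘ Equiv.swap i j) ≤ normalCost F c t := by
      rw [normalCost_comp_perm]; exact hcost
    refine hmin ⟨(c' ∘ Equiv.swap i j, t' ∘ Equiv.swap i j), hN', hc'⟩ ?_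
    rw [Prod.Lex.toLex_lt_toLex]
    refine .inr ⟨?_, ?_⟩
    · exact congrArg (fun z => (∑ j, d j - z).toNat) (Equiv.sum_comp (Equiv.swap i j) c')
    · rw [Prod.Lex.toLex_lt_toLex]
      refine .inr ⟨?_, ?_⟩
      · exact congrArg (fun z => (z - ∑ j, r j).toNat) (Equiv.sum_comp (Equiv.swap i j) t')
      · have := hjt hN'
        -- Only the terms at `i` and `j` change, and the gain is `(j - i) * (t' i - t' j) > 0`.
        have e : ∑ x : Fin n, ((x : ℕ) : ℤ) * t' x <
            ∑ x : Fin n, ((x : ℕ) : ℤ) * (t' ∘ Equiv.swap i j) x := by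
          rw [← sub_pos, ← Finset.sum_sub_distrib]
          have e2 : ∑ x : Fin n, (((x : ℕ) : ℤ) * (t' ∘ Equiv.swap i j) x - ((x : ℕ) : ℤ) * t' x)
              = ∑ x ∈ {i, j}, (((x : ℕ) : ℤ) * (t' ∘ Equiv.swap i j) x - ((x : ℕ) : ℤ) * t' x) := by
            symm
            refine Finset.sum_subset (Finset.subset_univ _) fun x _ hx => ?_
            simp only [Finset.mem_insert, Finset.mem_singleton, not_or] at hx
            rw [Function.comp_apply, Equiv.swap_apply_of_ne_of_ne hx.1 hx.2, sub_self]
          rw [e2, Finset.sum_pair hij.ne]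
          simp only [Function.comp_apply, Equiv.swap_apply_left, Equiv.swap_apply_right]
          have h5 : (0 : ℤ) < ((j : ℕ) : ℤ) - ((i : ℕ) : ℤ) := by
            have : (i : ℕ) < (j : ℕ) := hij
            omega
          have h6 : 0 < t' i - t' j := by omega
          nlinarith [mul_pos h5 h6]
        exact (Int.toNat_lt_toNat (sub_pos.2 (e.trans_le this))).2 (sub_lt_sub_left e _)

end Shift

/-! ## The dynamic program -/

open Classical in
/-- The least value below `top` of an admissible index below `m`, with the first such index. -/
noncomputable def scan (ok : ℕ → Prop) (val : ℕ → ℤ) (top : ℤ) : ℕ → ℤ × ℕ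
  | 0 => (top, 0)
  | m + 1 => if ok m ∧ val m < (scan ok val top m).1 then (val m, m) else scan ok val top m

/-! ### Properties of the minimum scan -/

section Scan

variable {ok : ℕ → Prop} {val : ℕ → ℤ} {top : ℤ}

theorem scan_le_top (N : ℕ) : (scan ok val top N).1 ≤ top := by
  induction N with
  | zero => exact le_rfl
  | succ m ih => rw [scan]; split_ifs with h
                 · exact h.2.le.trans ih
                 · exact ih

theorem scan_le {N m : ℕ} (hm : m < N) (h : ok m) : (scan ok val top N).1 ≤ val m := by
  induction N with
  | zero => omega
  | succ N ih =>
    rw [scan]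
    rcases Nat.lt_succ_iff_lt_or_eq.1 hm with h1 | rfl
    · split_ifs with h2
      · exact h2.2.le.trans (ih h1)
      · exact ih h1
    · split_ifs with h2
      · exact le_rfl
      · by_contra h3
        exact h2 ⟨h, not_le.1 h3⟩

theorem scan_spec {N : ℕ} (h : (scan ok val top N).1 < top) :
    (scan ok val top N).2 < N ∧ ok (scan ok val top N).2 ∧
      val (scan ok val top N).2 = (scan ok val top N).1 := by
  induction N with
  | zero => exact absurd h (lt_irrefl _)
  | succ m ih =>
    rw [scan] at h ⊢
    split_ifs at h ⊢ with h2
    · exact ⟨Nat.lt_succ_self _, h2.1, rfl⟩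
    · exact ⟨(ih h).1.trans (Nat.lt_succ_self _), (ih h).2⟩

theorem scan_nonneg (h0 : 0 ≤ top) (hv : ∀ m, 0 ≤ val m) (N : ℕ) :
    0 ≤ (scan ok val top N).1 := by
  induction N with
  | zero => exact h0
  | succ m ih => rw [scan]; split_ifs with h
                 · exact hv m
                 · exact ih

end Scan

/-- The data of the dynamic program: `size` slots, the slot `p` being at time `t p` in a calibration
started at time `c p`; the cost `G p` of a calibration started at `c p` whose last slot is `p`;
a value `top` exceeding all costs; release dates and deadlines. -/
structure SlotData where
  size : ℕ
  c : ℕ → ℤ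
  t : ℕ → ℤ
  G : ℕ → ℤ
  top : ℤ
  r : ℕ → ℤ
  d : ℕ → ℤ

namespace SlotData

variable (D : SlotData)

/-- Slot `p` can be used before slot `q`. -/
def Before (p q : ℕ) : Prop := D.t p < D.t q ∧ (D.c p = D.c q ∨ D.t p < D.c q)

open Classical in
/-- The minimum cost of processing those of the first `k` jobs that are released after slot `p` and
not after slot `q`, between these slots, and the slot chosen for job `k - 1`. -/
noncomputable def table : ℕ → ℕ → ℕ → ℤ × ℕ
  | 0, p, q => (if D.t p < D.t q then
      (if D.c p = D.c q then 0 else if D.t p < D.c q then D.G p else D.top) else D.top, 0)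
  | k + 1, p, q => if D.t p < D.r k ∧ D.r k ≤ D.t q then
      scan (fun m => D.r k ≤ D.t m ∧ D.t m < D.d k)
        (fun m => (table k p m).1 + (table k m q).1) D.top D.size
      else ((table k p q).1, 0)

open Classical in
/-- The slot of job `i` in the solution belonging to a table entry. -/
noncomputable def place (i : ℕ) : ℕ → ℕ → ℕ → ℕ
  | 0, _, _ => 0
  | k + 1, p, q => if D.t p < D.r k ∧ D.r k ≤ D.t q then
      if i = k then (D.table (k + 1) p q).2
      else if D.r i ≤ D.t (D.table (k + 1) p q).2 then place i k p (D.table (k + 1) p q).2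
      else place i k (D.table (k + 1) p q).2 q
      else place i k p q

/-- The jobs belonging to a table entry. -/
def jobs (k p q : ℕ) : Finset ℕ :=
  (Finset.range k).filter fun i => D.t p < D.r i ∧ D.r i ≤ D.t q

/-- Slot `x` is the last one of its calibration, among the slots of the jobs in `J` and `q`. -/
def LastIn (J : Finset ℕ) (σ : ℕ → ℕ) (q x : ℕ) : Prop :=
  D.c x ≠ D.c q ∧ ∀ i ∈ J, D.t x < D.t (σ i) → D.c (σ i) ≠ D.c x

open Classical in
/-- The cost of the calibrations of `p` and the slots of `J`, except for the calibration of `q`. -/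
noncomputable def pathCost (p : ℕ) (J : Finset ℕ) (σ : ℕ → ℕ) (q : ℕ) : ℤ :=
  (if D.LastIn J σ q p then D.G p else 0) + ∑ i ∈ J, if D.LastIn J σ q (σ i) then D.G (σ i) else 0

/-- The properties of the data needed for the dynamic program to be correct. -/
structure Good : Prop where
  top_pos : 0 < D.top
  G_nonneg : ∀ p, 0 ≤ D.G p
  c_le : ∀ p < D.size, D.c p ≤ D.t p

/-! ### Additivity of the cost along a chain of slots -/

variable {D}

theorem Before.trans (hD : D.Good) {p q x : ℕ} (hq : q < D.size) (h1 : D.Before p q)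
    (h2 : D.Before q x) : D.Before p x := by
  have := hD.c_le q hq
  obtain ⟨h1, h1'⟩ := h1
  obtain ⟨h2, h2'⟩ := h2
  refine ⟨h1.trans h2, ?_⟩
  omega

theorem table_nonneg (hD : D.Good) : ∀ k p q, 0 ≤ (D.table k p q).1 := by
  intro k
  induction k with
  | zero =>
    intro p q
    have := hD.top_pos
    have := hD.G_nonneg p
    rw [table]; dsimp only; split_ifs <;> omega
  | succ k ih =>
    intro p q
    rw [table]; split_ifs
    · exact scan_nonneg hD.top_pos.le (fun m => add_nonneg (ih _ _) (ih _ _)) _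
    · exact ih p q

theorem pathCost_congr {p q : ℕ} {J : Finset ℕ} {σ τ : ℕ → ℕ} (h : ∀ i ∈ J, σ i = τ i) :
    D.pathCost p J σ q = D.pathCost p J τ q := by
  classical
  have hl : ∀ x, D.LastIn J σ q x ↔ D.LastIn J τ q x := by
    intro x
    unfold LastIn
    refine and_congr_right fun _ => forall₂_congr fun i hi => ?_
    rw [h i hi]
  unfold pathCost
  simp only [hl]
  congr 1
  refine Finset.sum_congr rfl fun i hi => ?_
  rw [h i hi]

/-- The slot `σ k` serves as right end of the left part and left end of the right part. A
calibration abandoned before `σ k` starts earlier than that of `σ k`, and later slots use either the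
latter or one started after `σ k`; so whether a slot is the last of its calibration is decided
within its own part. -/
theorem pathCost_split (hD : D.Good) {p q k : ℕ} {J₁ J₂ : Finset ℕ} {σ : ℕ → ℕ}
    (hp : p < D.size) (hpm : D.Before p (σ k)) (hmq : D.Before (σ k) q)
    (h₁ : ∀ i ∈ J₁, D.Before p (σ i) ∧ D.Before (σ i) (σ k))
    (h₂ : ∀ i ∈ J₂, D.Before (σ k) (σ i) ∧ D.Before (σ i) q)
    (hs : ∀ i, σ i < D.size) (hk : k ∉ J₁ ∪ J₂) (hdisj : Disjoint J₁ J₂) :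
    D.pathCost p (insert k (J₁ ∪ J₂)) σ q
      = D.pathCost p J₁ σ (σ k) + D.pathCost (σ k) J₂ σ q := by
  classical
  have hc := hD.c_le
  have e₁ : ∀ x < D.size, D.Before x (σ k) →
      (D.LastIn (insert k (J₁ ∪ J₂)) σ q x ↔ D.LastIn J₁ σ (σ k) x) := by
    intro x hx hxk
    have hcx := hc x hx
    unfold LastIn
    constructor
    · rintro ⟨h3, h4⟩
      refine ⟨fun h => h4 k (by simp) hxk.1 h.symm, fun i hi => h4 i (by simp [hi])⟩
    · rintro ⟨h3, h4⟩
      have aux : ∀ y, D.Before (σ k) y → D.c y ≠ D.c x := by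
        intro y hy
        have := hxk.1
        obtain ⟨h5, h6 | h6⟩ := hxk
        · exact absurd h6 h3
        · obtain ⟨h7, h8 | h8⟩ := hy <;> omega
      refine ⟨(aux q hmq).symm, ?_⟩
      intro i hi hlt
      rcases Finset.mem_insert.1 hi with rfl | hi
      · exact h3.symm
      · rcases Finset.mem_union.1 hi with hi | hi
        · exact h4 i hi hlt
        · exact aux _ (h₂ i hi).1
  have e₂ : ∀ x, D.t (σ k) ≤ D.t x →
      (D.LastIn (insert k (J₁ ∪ J₂)) σ q x ↔ D.LastIn J₂ σ q x) := by
    intro x hx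
    unfold LastIn
    refine and_congr_right fun _ => ⟨fun h i hi => h i (by simp [hi]), fun h i hi hlt => ?_⟩
    rcases Finset.mem_insert.1 hi with rfl | hi
    · omega
    · rcases Finset.mem_union.1 hi with hi | hi
      · have := (h₁ i hi).2.1; omega
      · exact h i hi hlt
  unfold pathCost
  rw [Finset.sum_insert hk, Finset.sum_union hdisj]
  have s₁ : (∑ i ∈ J₁, if D.LastIn (insert k (J₁ ∪ J₂)) σ q (σ i) then D.G (σ i) else 0)
      = ∑ i ∈ J₁, if D.LastIn J₁ σ (σ k) (σ i) then D.G (σ i) else 0 :=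
    Finset.sum_congr rfl fun i hi => by simp only [e₁ (σ i) (hs i) (h₁ i hi).2]
  have s₂ : (∑ i ∈ J₂, if D.LastIn (insert k (J₁ ∪ J₂)) σ q (σ i) then D.G (σ i) else 0)
      = ∑ i ∈ J₂, if D.LastIn J₂ σ q (σ i) then D.G (σ i) else 0 :=
    Finset.sum_congr rfl fun i hi => by simp only [e₂ (σ i) (h₂ i hi).1.1.le]
  rw [s₁, s₂]
  simp only [e₁ p hp hpm, e₂ (σ k) le_rfl]
  ring

theorem pathCost_empty {p q : ℕ} {σ : ℕ → ℕ} :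
    D.pathCost p ∅ σ q = if D.c p = D.c q then 0 else D.G p := by
  classical
  by_cases h : D.c p = D.c q <;> simp [pathCost, LastIn, h]

theorem jobs_zero (p q : ℕ) : D.jobs 0 p q = ∅ := by simp [jobs]

theorem jobs_succ_of_not {k p q : ℕ} (h : ¬ (D.t p < D.r k ∧ D.r k ≤ D.t q)) :
    D.jobs (k + 1) p q = D.jobs k p q := by
  rw [jobs, Finset.range_add_one, Finset.filter_insert, if_neg h, jobs]

/-- Release dates alone decide on which side of slot `m` a job falls, which makes the two
subproblems entries of the same table. -/
theorem jobs_succ {k p q m : ℕ} (h : D.t p < D.r k ∧ D.r k ≤ D.t q) (h1 : D.t p ≤ D.t m)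
    (h2 : D.t m ≤ D.t q) :
    D.jobs (k + 1) p q = insert k (D.jobs k p m ∪ D.jobs k m q) := by
  rw [jobs, Finset.range_add_one, Finset.filter_insert, if_pos h]
  congr 1
  ext i
  simp only [jobs, Finset.mem_filter, Finset.mem_union, Finset.mem_range]
  omega

theorem not_mem_jobs (k p m q : ℕ) : k ∉ D.jobs k p m ∪ D.jobs k m q := by
  simp [jobs]

theorem disjoint_jobs (k p m q : ℕ) : Disjoint (D.jobs k p m) (D.jobs k m q) := by
  rw [Finset.disjoint_left]
  intro i
  simp only [jobs, Finset.mem_filter]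
  omega

/-! ### Correctness of the table -/

/-- `σ` processes the jobs in `J` in slots between `p` and `q`. -/
structure Solves (p : ℕ) (J : Finset ℕ) (σ : ℕ → ℕ) (q : ℕ) : Prop where
  before : D.Before p q
  size : ∀ i ∈ J, σ i < D.size
  left : ∀ i ∈ J, D.Before p (σ i)
  right : ∀ i ∈ J, D.Before (σ i) q
  release : ∀ i ∈ J, D.r i ≤ D.t (σ i)
  deadline : ∀ i ∈ J, D.t (σ i) < D.d i
  chain : ∀ i ∈ J, ∀ j ∈ J, i ≠ j → D.Before (σ i) (σ j) ∨ D.Before (σ j) (σ i)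

theorem Solves.congr {p q : ℕ} {J : Finset ℕ} {σ τ : ℕ → ℕ} (hs : D.Solves p J σ q)
    (h : ∀ i ∈ J, σ i = τ i) : D.Solves p J τ q where
  before := hs.before
  size i hi := h i hi ▸ hs.size i hi
  left i hi := h i hi ▸ hs.left i hi
  right i hi := h i hi ▸ hs.right i hi
  release i hi := h i hi ▸ hs.release i hi
  deadline i hi := h i hi ▸ hs.deadline i hi
  chain i hi j hj hij := h i hi ▸ h j hj ▸ hs.chain i hi j hj hij

theorem Solves.glue (hD : D.Good) {p q k : ℕ} {J₁ J₂ : Finset ℕ} {σ : ℕ → ℕ}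
    (hm : σ k < D.size) (hr : D.r k ≤ D.t (σ k)) (hd : D.t (σ k) < D.d k)
    (h₁ : D.Solves p J₁ σ (σ k)) (h₂ : D.Solves (σ k) J₂ σ q) :
    D.Solves p (insert k (J₁ ∪ J₂)) σ q := by
  have hpq := h₁.before.trans hD hm h₂.before
  have hcases : ∀ i ∈ insert k (J₁ ∪ J₂), i = k ∨ i ∈ J₁ ∨ i ∈ J₂ := by
    intro i hi; simpa using hi
  refine ⟨hpq, ?_, ?_, ?_, ?_, ?_, ?_⟩
  · intro i hi
    rcases hcases i hi with rfl | hi | hi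
    exacts [hm, h₁.size i hi, h₂.size i hi]
  · intro i hi
    rcases hcases i hi with rfl | hi | hi
    exacts [h₁.before, h₁.left i hi, h₁.before.trans hD hm (h₂.left i hi)]
  · intro i hi
    rcases hcases i hi with rfl | hi | hi
    exacts [h₂.before, (h₁.right i hi).trans hD hm h₂.before, h₂.right i hi]
  · intro i hi
    rcases hcases i hi with rfl | hi | hi
    exacts [hr, h₁.release i hi, h₂.release i hi]
  · intro i hi
    rcases hcases i hi with rfl | hi | hi
    exacts [hd, h₁.deadline i hi, h₂.deadline i hi]
  · intro i hi j hj hij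
    rcases hcases i hi with rfl | hi' | hi' <;> rcases hcases j hj with rfl | hj' | hj'
    · exact absurd rfl hij
    · exact .inr (h₁.right j hj')
    · exact .inl (h₂.left j hj')
    · exact .inl (h₁.right i hi')
    · exact h₁.chain i hi' j hj' hij
    · exact .inl ((h₁.right i hi').trans hD hm (h₂.left j hj'))
    · exact .inr (h₂.left i hi')
    · exact .inr ((h₁.right j hj').trans hD hm (h₂.left i hi'))
    · exact h₂.chain i hi' j hj' hij

/-- A table entry below `top` belongs to a solution of at most that cost. -/
theorem table_sound (hD : D.Good) : ∀ k p q, p < D.size → q < D.size →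
    (D.table k p q).1 < D.top →
      D.Solves p (D.jobs k p q) (fun i => D.place i k p q) q ∧
      D.pathCost p (D.jobs k p q) (fun i => D.place i k p q) q ≤ (D.table k p q).1 := by
  intro k
  induction k with
  | zero =>
    intro p q hp hq h
    rw [jobs_zero, pathCost_empty]
    rw [table] at h ⊢
    dsimp only at h ⊢
    -- All branches of the bottom level in which `q` cannot follow `p` carry the value `top`, so a
    -- smaller value certifies the order.
    have hb : D.Before p q := by
      unfold Before
      by_contra hno
      push Not at hno
      split_ifs at h with h1 h2 h3
      · exact (hno h1).1 h2
      · exact absurd h3 (not_lt.2 (hno h1).2)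
      · exact lt_irrefl _ h
      · exact lt_irrefl _ h
    refine ⟨⟨hb, by simp, by simp, by simp, by simp, by simp, by simp⟩, ?_⟩
    rw [if_pos hb.1]
    by_cases hc : D.c p = D.c q
    · rw [if_pos hc, if_pos hc]
    · rw [if_neg hc, if_neg hc, if_pos (hb.2.resolve_left hc)]
  | succ k ih =>
    intro p q hp hq h
    by_cases hk : D.t p < D.r k ∧ D.r k ≤ D.t q
    · set m := (D.table (k + 1) p q).2 with hm
      have htab : D.table (k + 1) p q = scan (fun m => D.r k ≤ D.t m ∧ D.t m < D.d k)
        (fun m => (D.table k p m).1 + (D.table k m q).1) D.top D.size := by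
        rw [table, if_pos hk]
      obtain ⟨hmP, ⟨hr, hd⟩, hv⟩ := scan_spec (htab ▸ h)
      rw [← htab, ← hm] at hmP hr hd hv
      -- Both summands are nonnegative, so a sum below `top` forces each of them below `top`. This
      -- is also what makes `m` lie between `p` and `q`, a condition the scan never tests.
      have n1 := table_nonneg hD k p m
      have n2 := table_nonneg hD k m q
      obtain ⟨s₁, c₁⟩ := ih p m hp hmP (by omega)
      obtain ⟨s₂, c₂⟩ := ih m q hmP hq (by omega)
      set σ : ℕ → ℕ := fun i => D.place i (k + 1) p q with hσ
      have hσk : σ k = m := by simp only [hσ]; rw [place, if_pos hk, if_pos rfl]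
      have g₁ : ∀ i ∈ D.jobs k p m, D.place i k p m = σ i := by
        intro i hi
        simp only [jobs, Finset.mem_filter, Finset.mem_range] at hi
        simp only [hσ]
        rw [place, if_pos hk, if_neg (by omega), if_pos hi.2.2]
      have g₂ : ∀ i ∈ D.jobs k m q, D.place i k m q = σ i := by
        intro i hi
        simp only [jobs, Finset.mem_filter, Finset.mem_range] at hi
        simp only [hσ]
        rw [place, if_pos hk, if_neg (by omega), if_neg (by rw [← hm]; omega)]
      rw [pathCost_congr g₁] at c₁
      rw [pathCost_congr g₂] at c₂
      replace s₁ := s₁.congr g₁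
      replace s₂ := s₂.congr g₂
      have hJ := jobs_succ hk s₁.before.1.le s₂.before.1.le
      have hglue := Solves.glue hD (p := p) (q := q) (k := k) (σ := σ) (by rw [hσk]; exact hmP)
        (by rw [hσk]; exact hr) (by rw [hσk]; exact hd) (by rw [hσk]; exact s₁)
        (by rw [hσk]; exact s₂)
      rw [hJ]
      refine ⟨hglue, ?_⟩
      -- `pathCost_split` wants every value of the assignment to be a slot; `σ` is known to be in
      -- range only on the relevant jobs, so it is replaced by the constant `m` elsewhere.
      obtain ⟨τ, hτ⟩ : ∃ τ : ℕ → ℕ, τ = fun i =>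
        if i ∈ insert k (D.jobs k p m ∪ D.jobs k m q) then σ i else m := ⟨_, rfl⟩
      have hcg : ∀ i ∈ insert k (D.jobs k p m ∪ D.jobs k m q), σ i = τ i := by
        intro i hi; rw [hτ]; simp only; rw [if_pos hi]
      have hτk : τ k = m := by simp only [hτ]; rw [if_pos (Finset.mem_insert_self _ _), hσk]
      have i₁ : ∀ i ∈ D.jobs k p m, σ i = τ i := fun i hi => hcg i (by simp [hi])
      have i₂ : ∀ i ∈ D.jobs k m q, σ i = τ i := fun i hi => hcg i (by simp [hi])
      rw [pathCost_congr hcg, pathCost_split hD hp]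
      · rw [hτk, ← pathCost_congr i₁, ← pathCost_congr i₂]; omega
      · rw [hτk]; exact s₁.before
      · rw [hτk]; exact s₂.before
      · intro i hi; rw [hτk, ← i₁ i hi]; exact ⟨s₁.left i hi, s₁.right i hi⟩
      · intro i hi; rw [hτk, ← i₂ i hi]; exact ⟨s₂.left i hi, s₂.right i hi⟩
      · intro i; simp only [hτ]; split_ifs with hi
        · exact hglue.size i hi
        · exact hmP
      · exact not_mem_jobs k p m q
      · exact disjoint_jobs k p m q
    · have hσ : (fun i => D.place i (k + 1) p q) = fun i => D.place i k p q := by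
        funext i; rw [place, if_neg hk]
      have ht : (D.table (k + 1) p q).1 = (D.table k p q).1 := by rw [table, if_neg hk]
      rw [hσ, jobs_succ_of_not hk, ht]
      exact ih p q hp hq (ht ▸ h)

/-- A table entry is at most the cost of any solution that processes its jobs in
earliest-deadline order. -/
theorem table_le (hD : D.Good) {n : ℕ} {σ : ℕ → ℕ} (hs : ∀ i, σ i < D.size)
    (hr : ∀ i < n, D.r i ≤ D.t (σ i)) (hd : ∀ i < n, D.t (σ i) < D.d i)
    (hchain : ∀ i < n, ∀ j < n, i ≠ j → D.Before (σ i) (σ j) ∨ D.Before (σ j) (σ i))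
    (hedf : ∀ i j, i < j → j < n → D.r i ≤ D.t (σ j) → D.t (σ i) < D.t (σ j)) :
    ∀ k ≤ n, ∀ p q, p < D.size → q < D.size → D.Before p q →
      (∀ i ∈ D.jobs k p q, D.Before p (σ i) ∧ D.Before (σ i) q) →
      (D.table k p q).1 ≤ D.pathCost p (D.jobs k p q) σ q := by
  intro k
  induction k with
  | zero =>
    intro _ p q hp hq hb _
    rw [jobs_zero, pathCost_empty, table]
    dsimp only
    rw [if_pos hb.1]
    by_cases hc : D.c p = D.c q
    · rw [if_pos hc, if_pos hc]
    · rw [if_neg hc, if_neg hc, if_pos (hb.2.resolve_left hc)]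
  | succ k ih =>
    intro hkn p q hp hq hb hJ
    by_cases hk : D.t p < D.r k ∧ D.r k ≤ D.t q
    · have hkk : k < n := hkn
      have hkJ : k ∈ D.jobs (k + 1) p q := by simp [jobs, hk]
      obtain ⟨b1, b2⟩ := hJ k hkJ
      have hJs := jobs_succ hk b1.1.le b2.1.le
      -- Earliest-deadline order is needed exactly here: a job of smaller index released by the
      -- start of job `k` must precede it. The right side `l₂` follows from release dates alone.
      have l₁ : ∀ i ∈ D.jobs k p (σ k), D.Before p (σ i) ∧ D.Before (σ i) (σ k) := by
        intro i hi
        refine ⟨(hJ i (by rw [hJs]; simp [hi])).1, ?_⟩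
        simp only [jobs, Finset.mem_filter, Finset.mem_range] at hi
        have := hedf i k hi.1 hkk hi.2.2
        rcases hchain i (by omega) k hkk (by omega) with h | h
        · exact h
        · exact absurd h.1 (by omega)
      have l₂ : ∀ i ∈ D.jobs k (σ k) q, D.Before (σ k) (σ i) ∧ D.Before (σ i) q := by
        intro i hi
        refine ⟨?_, (hJ i (by rw [hJs]; simp [hi])).2⟩
        simp only [jobs, Finset.mem_filter, Finset.mem_range] at hi
        have := hr i (by omega)
        rcases hchain i (by omega) k hkk (by omega) with h | h
        · exact absurd h.1 (by omega)
        · exact h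
      rw [table, if_pos hk, hJs, pathCost_split hD hp b1 b2 l₁ l₂ hs (not_mem_jobs k p _ q)
        (disjoint_jobs k p _ q)]
      refine (scan_le (hs k) ⟨hr k hkk, hd k hkk⟩).trans ?_
      exact add_le_add (ih hkk.le p (σ k) hp (hs k) b1 l₁) (ih hkk.le (σ k) q (hs k) hq b2 l₂)
    · have ht : (D.table (k + 1) p q).1 = (D.table k p q).1 := by rw [table, if_neg hk]
      rw [jobs_succ_of_not hk] at hJ ⊢
      rw [ht]
      exact ih (by omega) p q hp hq hb hJ

end SlotData

/-! ## Schedules and normal forms -/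

namespace Instance

variable (I : Instance)

/-- The cheapest type of a calibration that is long enough for a job starting `x` time units after
the start of the calibration, with its cost (`top` if there is none). -/
noncomputable def bestKind (top x : ℤ) : ℤ × ℕ :=
  scan (fun k => ∀ h : k < I.K, x + 1 ≤ I.act + I.len ⟨k, h⟩)
    (fun k => if h : k < I.K then (I.cost ⟨k, h⟩ : ℤ) else 0) top I.K

variable {I} {top : ℤ}

theorem bestKind_le {x : ℤ} (k : Fin I.K) (h : x + 1 ≤ I.act + I.len k) :
    (I.bestKind top x).1 ≤ I.cost k := by
  refine (scan_le k.2 fun _ => h).trans ?_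
  simp

theorem bestKind_le_top (x : ℤ) : (I.bestKind top x).1 ≤ top := scan_le_top _

theorem bestKind_nonneg (htop : 0 ≤ top) (x : ℤ) : 0 ≤ (I.bestKind top x).1 := by
  refine scan_nonneg htop (fun m => ?_) _
  split_ifs <;> simp

theorem bestKind_spec {x : ℤ} (h : (I.bestKind top x).1 < top) :
    ∃ hk : (I.bestKind top x).2 < I.K,
      x + 1 ≤ I.act + I.len ⟨_, hk⟩ ∧ (I.cost ⟨_, hk⟩ : ℤ) = (I.bestKind top x).1 := by
  obtain ⟨h1, h2, h3⟩ := scan_spec h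
  refine ⟨h1, h2 h1, ?_⟩
  unfold bestKind
  rw [← h3, dif_pos h1]

/-- A type long enough for the larger distance also serves the smaller one, so the minimum ranges
over more types. -/
theorem bestKind_mono : Monotone fun x => (I.bestKind top x).1 := by
  intro x y hxy
  dsimp only
  by_cases h : (I.bestKind top y).1 < top
  · obtain ⟨hk, h1, h2⟩ := bestKind_spec h
    rw [← h2]
    exact bestKind_le _ (by omega)
  · exact (bestKind_le_top x).trans (not_lt.1 h)

end Instance

theorem StartRule.Allows.mono {ρ : StartRule} {I : Instance} {x y : ℤ} (hxy : x ≤ y)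
    (h : ρ.Allows I x) : ρ.Allows I y := by
  cases ρ with
  | anyTime => trivial
  | fromFirstRelease => obtain ⟨j, hj⟩ := h; exact ⟨j, hj.trans hxy⟩

/-- The total cost of all types, for every job. -/
def Instance.costBound (I : Instance) : ℤ := I.n * ∑ k, (I.cost k : ℤ)

/-- Give each job the covering calibration that ends last, ties broken by the later start. If the
calibration of a later job has started by the time an earlier job runs, it covers that job, since no
job runs during an activation; conversely the calibration of the earlier job ends no sooner and
covers the later job. Maximality both ways makes the starts equal. The second cost bound keeps the
table entry below `top` even if the given schedule is wasteful. -/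
theorem Schedule.Feasible.exists_normalForm {ρ : StartRule} {I : Instance} {S : Schedule I}
    (hS : S.Feasible ρ) (top : ℤ) (htop : 0 ≤ top) :
    ∃ c t, NormalForm I.release I.deadline I.act (ρ.Allows I) c t ∧
      normalCost (fun x => (I.bestKind top x).1) c t ≤ S.totalCost ∧
      normalCost (fun x => (I.bestKind top x).1) c t ≤ I.costBound := by
  classical
  let key : Fin S.cals.length → ℤ ×ₗ ℤ := fun x =>
    toLex ((S.cals.get x).start + I.len (S.cals.get x).kind, (S.cals.get x).start)
  let cov : Fin I.n → Fin S.cals.length → Prop := fun j x =>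
    (S.cals.get x).start + I.act ≤ S.jobStart j ∧
      S.jobStart j + 1 ≤ (S.cals.get x).start + I.act + I.len (S.cals.get x).kind
  have hex : ∀ j, ∃ x, cov j x ∧ ∀ y, cov j y → key y ≤ key x := by
    intro j
    obtain ⟨c, hc, h1, h2⟩ := hS.calibrated j
    obtain ⟨i, rfl⟩ := List.mem_iff_get.1 hc
    obtain ⟨x, hx, hmax⟩ := Finset.exists_max_image (Finset.univ.filter (cov j)) key
      ⟨i, by simpa [cov] using ⟨h1, h2⟩⟩
    exact ⟨x, (Finset.mem_filter.1 hx).2, fun y hy => hmax y (by simp [hy])⟩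
  choose g hg hmax using hex
  have hkey : ∀ x y, key x ≤ key y ↔
      (S.cals.get x).start + I.len (S.cals.get x).kind <
        (S.cals.get y).start + I.len (S.cals.get y).kind ∨
      (S.cals.get x).start + I.len (S.cals.get x).kind =
        (S.cals.get y).start + I.len (S.cals.get y).kind ∧
        (S.cals.get x).start ≤ (S.cals.get y).start := by
    intro x y
    simp only [key, Prod.Lex.toLex_le_toLex]
  have hN : NormalForm I.release I.deadline I.act (ρ.Allows I)
      (fun j => (S.cals.get (g j)).start) S.jobStart := by
    refine ⟨fun j => (hS.window j).1, fun j => by have := (hS.window j).2; omega,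
      fun j => (hg j).1, fun j => hS.starts _ (List.get_mem _ _), ?_, ?_⟩
    · intro i j hij
      by_contra hno
      push Not at hno
      obtain ⟨hne, hle⟩ := hno
      have hi := hg i
      have hj := hg j
      have mi := hmax i (g j)
      have mj := hmax j (g i)
      rw [hkey] at mi mj
      have ai := hS.activation i _ (List.get_mem S.cals (g j))
      simp only [cov] at hi hj mi mj
      omega
    · intro i j hij
      by_contra hne
      have := hS.disjoint i j hne
      omega
  have hF0 := fun x => Instance.bestKind_nonneg (I := I) htop x
  have hFle : ∀ j, (I.bestKind top (S.jobStart j - (S.cals.get (g j)).start)).1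
      ≤ I.cost (S.cals.get (g j)).kind := by
    intro j
    have := (hg j).2
    exact Instance.bestKind_le _ (by omega)
  refine ⟨_, _, hN, ?_, ?_⟩
  · unfold normalCost
    rw [← Finset.sum_filter]
    refine (Finset.sum_le_sum fun j _ => hFle j).trans ?_
    -- Two last jobs of one calibration would have distinct starts, and the earlier one would not be
    -- last; so every calibration of the schedule is charged at most once.
    have hinj : Set.InjOn g (Finset.univ.filter
        (IsLast (fun j => (S.cals.get (g j)).start) S.jobStart) : Finset (Fin I.n)) := by
      intro i hi j hj hij
      simp only [Finset.coe_filter, Finset.mem_univ, true_and, Set.mem_ofPred_eq] at hi hj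
      rcases lt_trichotomy (S.jobStart i) (S.jobStart j) with h | h | h
      · exact absurd (by simp only [hij]) (hi j h)
      · exact hN.inj h
      · exact absurd (by simp only [hij]) (hj i h)
    rw [← Finset.sum_image (f := fun x => (I.cost (S.cals.get x).kind : ℤ)) hinj]
    refine (Finset.sum_le_univ_sum_of_nonneg fun x => Int.natCast_nonneg _).trans ?_
    rw [Schedule.totalCost, ← Fin.sum_univ_fun_getElem]
    push_cast
    exact le_rfl
  · unfold normalCost
    have hb : ∀ j ∈ (Finset.univ : Finset (Fin I.n)),
        (if IsLast (fun j => (S.cals.get (g j)).start) S.jobStart j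
          then (I.bestKind top (S.jobStart j - (S.cals.get (g j)).start)).1 else 0)
        ≤ ∑ k, (I.cost k : ℤ) := by
      intro j _
      have h1 : (I.cost (S.cals.get (g j)).kind : ℤ) ≤ ∑ k, (I.cost k : ℤ) :=
        Finset.single_le_sum (f := fun k => (I.cost k : ℤ)) (fun _ _ => Int.natCast_nonneg _)
          (Finset.mem_univ _)
      have h2 := hFle j
      have h3 := hF0 (S.jobStart j - (S.cals.get (g j)).start)
      split_ifs <;> omega
    refine (Finset.sum_le_card_nsmul _ _ _ hb).trans ?_
    simp [Instance.costBound]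

open Classical in
/-- The schedule that processes the `e i`-th job at time `t i` and starts a calibration of type
`kind i` at time `c i` if the `i`-th slot is the last one of its calibration. -/
noncomputable def scheduleOf (I : Instance) (e : Equiv.Perm (Fin I.n)) (c t : Fin I.n → ℤ)
    (kind : Fin I.n → Fin I.K) : Schedule I where
  cals := ((List.finRange I.n).filter fun i => decide (IsLast c t i)).map fun i => ⟨c i, kind i⟩
  jobStart j := t (e.symm j)

/-- A type chosen for the last job of a calibration covers all its earlier jobs. Activations disturb
nobody: jobs not before `t x` start after the activation of `c x`, and the chain condition settles
the jobs before `t x`. -/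
theorem NormalForm.feasible {ρ : StartRule} {I : Instance} {e : Equiv.Perm (Fin I.n)}
    {c t : Fin I.n → ℤ} {kind : Fin I.n → Fin I.K}
    (h : NormalForm (I.release ∘ e) (I.deadline ∘ e) I.act (ρ.Allows I) c t)
    (hk : ∀ i, IsLast c t i → t i - c i + 1 ≤ I.act + I.len (kind i)) :
    (scheduleOf I e c t kind).Feasible ρ := by
  classical
  refine ⟨?_, ?_, ?_, ?_, ?_⟩
  · intro j
    have h1 := h.release (e.symm j)
    have h2 := h.deadline (e.symm j)
    simp only [Function.comp, Equiv.apply_symm_apply] at h1 h2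
    exact ⟨h1, h2⟩
  · intro i j hij
    have : t (e.symm i) ≠ t (e.symm j) := fun h' => hij (e.symm.injective (h.inj h'))
    change t (e.symm i) + 1 ≤ t (e.symm j) ∨ t (e.symm j) + 1 ≤ t (e.symm i)
    omega
  · intro j
    obtain ⟨x, hx, hmax⟩ := Finset.exists_max_image
      (Finset.univ.filter fun x => c x = c (e.symm j)) t ⟨e.symm j, by simp⟩
    simp only [Finset.mem_filter, Finset.mem_univ, true_and] at hx hmax
    have hl : IsLast c t x := by
      intro y hy hc
      exact absurd (hmax y (hc.trans hx)) (not_le.2 hy)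
    refine ⟨⟨c x, kind x⟩, ?_, ?_⟩
    · simp only [scheduleOf, List.mem_map, List.mem_filter, List.mem_finRange, true_and,
        decide_eq_true_eq]
      exact ⟨x, hl, rfl⟩
    · have h1 := hk x hl
      have h2 := hmax (e.symm j) rfl
      have h3 := h.active (e.symm j)
      change c x + I.act ≤ t (e.symm j) ∧ t (e.symm j) + 1 ≤ c x + I.act + I.len (kind x)
      omega
  · intro j k hc
    simp only [scheduleOf, List.mem_map, List.mem_filter, List.mem_finRange, true_and,
      decide_eq_true_eq] at hc ⊢
    obtain ⟨x, -, rfl⟩ := hc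
    dsimp only
    have h3 := h.active (e.symm j)
    have h4 := h.active x
    rcases lt_trichotomy (t x) (t (e.symm j)) with h5 | h5 | h5
    · omega
    · omega
    · have := h.chain _ _ h5; omega
  · intro k hc
    simp only [scheduleOf, List.mem_map, List.mem_filter, List.mem_finRange, true_and,
      decide_eq_true_eq] at hc
    obtain ⟨x, -, rfl⟩ := hc
    exact h.allowed x

theorem scheduleOf_totalCost {I : Instance} {e : Equiv.Perm (Fin I.n)}
    {c t : Fin I.n → ℤ} {kind : Fin I.n → Fin I.K} {F : ℤ → ℤ}
    (hk : ∀ i, IsLast c t i → (I.cost (kind i) : ℤ) = F (t i - c i)) :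
    ((scheduleOf I e c t kind).totalCost : ℤ) = normalCost F c t := by
  classical
  have h1 : (scheduleOf I e c t kind).totalCost
      = ∑ i ∈ Finset.univ.filter (IsLast c t), I.cost (kind i) := by
    rw [Schedule.totalCost, scheduleOf, List.map_map, ← List.sum_toFinset]
    · refine Finset.sum_congr ?_ fun i _ => rfl
      ext i; simp
    · exact (List.nodup_finRange _).filter _
  rw [h1, normalCost, ← Finset.sum_filter]
  push_cast
  refine Finset.sum_congr rfl fun i hi => hk i (Finset.mem_filter.1 hi).2

/-! ## The dynamic program for an instance -/

/-- The data of the dynamic program are those of the instance, where `e` sorts the jobs by their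
deadlines; slots `0` and `1` are sentinels before and after everything. -/
structure SlotData.Models (D : SlotData) (ρ : StartRule) (I : Instance)
    (e : Equiv.Perm (Fin I.n)) : Prop where
  costBound_lt : I.costBound < D.top
  G : ∀ p, D.G p = if p < 2 then 0 else (I.bestKind D.top (D.t p - D.c p)).1
  r : ∀ k : Fin I.n, D.r k = I.release (e k)
  d : ∀ k : Fin I.n, D.d k = I.deadline (e k)
  mono : Monotone (I.deadline ∘ e)
  size : 2 ≤ D.size
  first : D.c 0 = D.t 0
  last : D.c 1 = D.t 1
  first_lt_c : ∀ p, 2 ≤ p → p < D.size → D.t 0 < D.c p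
  t_lt_last : ∀ p, 2 ≤ p → p < D.size → D.t p < D.t 1
  first_lt_r : ∀ k : Fin I.n, D.t 0 < I.release k
  r_le_last : ∀ k : Fin I.n, I.release k ≤ D.t 1
  active : ∀ p, 2 ≤ p → p < D.size → D.c p + I.act ≤ D.t p
  allowed : ∀ p, 2 ≤ p → p < D.size → ρ.Allows I (D.c p)
  complete : ∀ c t, ρ.Allows I c → c + I.act ≤ t →
    (∃ i, ∃ a ≤ I.n, ∃ b ≤ I.n, c = I.deadline i - (a : ℕ) - (b : ℕ) * (I.act : ℤ)) →
    ((∃ i, ∃ a ≤ I.n, t = I.release i + (a : ℕ)) ∨ ∃ a ≤ I.n, t = c + I.act + (a : ℕ)) →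
    ∃ p, 2 ≤ p ∧ p < D.size ∧ D.c p = c ∧ D.t p = t

namespace SlotData.Models

variable {D : SlotData} {ρ : StartRule} {I : Instance} {e : Equiv.Perm (Fin I.n)}

theorem top_pos (h : D.Models ρ I e) : 0 < D.top := by
  refine lt_of_le_of_lt ?_ h.costBound_lt
  unfold Instance.costBound
  positivity

theorem good (h : D.Models ρ I e) : D.Good where
  top_pos := h.top_pos
  G_nonneg p := by
    rw [h.G]; split_ifs
    · exact le_rfl
    · exact Instance.bestKind_nonneg h.top_pos.le _
  c_le p hp := by
    rcases Nat.lt_or_ge p 2 with h2 | h2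
    · interval_cases p
      exacts [h.first.le, h.last.le]
    · have := h.active p h2 hp; omega

theorem jobs_eq (h : D.Models ρ I e) : D.jobs I.n 0 1 = Finset.range I.n := by
  refine Finset.filter_true_of_mem fun i hi => ?_
  have hr := h.r ⟨i, Finset.mem_range.1 hi⟩
  simp only at hr
  rw [hr]
  exact ⟨h.first_lt_r _, h.r_le_last _⟩

/-- The sentinels are neutral: slot `0` costs nothing, and slot `1` starts its own calibration
strictly after every real slot, so every real calibration is paid in full. -/
theorem pathCost_eq (h : D.Models ρ I e) {σ : ℕ → ℕ}
    (hσ : ∀ i < I.n, 2 ≤ σ i ∧ σ i < D.size) :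
    D.pathCost 0 (D.jobs I.n 0 1) σ 1 =
      normalCost (fun x => (I.bestKind D.top x).1) (fun i : Fin I.n => D.c (σ i))
        (fun i => D.t (σ i)) := by
  classical
  have hG0 : D.G 0 = 0 := by rw [h.G, if_pos two_pos]
  rw [h.jobs_eq, pathCost, hG0, ite_self, zero_add, normalCost, Finset.sum_range]
  refine Finset.sum_congr rfl fun i _ => ?_
  obtain ⟨h1, h2⟩ := hσ i i.2
  have hiff : D.LastIn (Finset.range I.n) σ 1 (σ i) ↔
      IsLast (fun i : Fin I.n => D.c (σ i)) (fun i => D.t (σ i)) i := by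
    have a1 := h.good.c_le _ h2
    have a2 := h.t_lt_last _ h1 h2
    have a3 := h.last
    constructor
    · intro hl j hj
      exact hl.2 j (by simp) hj
    · intro hl
      exact ⟨by omega, fun j hj hlt => hl ⟨j, Finset.mem_range.1 hj⟩ hlt⟩
  rw [h.G, if_neg (show ¬ σ i < 2 by omega)]
  by_cases hl : IsLast (fun i : Fin I.n => D.c (σ i)) (fun i => D.t (σ i)) i
  · rw [if_pos hl, if_pos (hiff.2 hl)]
  · rw [if_neg hl, if_neg (fun h => hl (hiff.1 h))]

/-- The table bounds the cost of every feasible schedule from below. -/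
theorem table_le_totalCost (h : D.Models ρ I e) (hn : 1 ≤ I.n) {S : Schedule I}
    (hS : S.Feasible ρ) :
    (D.table I.n 0 1).1 ≤ S.totalCost ∧ (D.table I.n 0 1).1 ≤ I.costBound := by
  obtain ⟨c₀, t₀, hN₀, hc₁, hc₂⟩ := hS.exists_normalForm D.top h.top_pos.le
  have hN : NormalForm (I.release ∘ e) (I.deadline ∘ e) I.act (ρ.Allows I) (c₀ ∘ e) (t₀ ∘ e) :=
    ⟨fun j => hN₀.release _, fun j => hN₀.deadline _, fun j => hN₀.active _,
      fun j => hN₀.allowed _, fun i j => hN₀.chain _ _, hN₀.inj.comp e.injective⟩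
  rw [← normalCost_comp_perm _ c₀ t₀ e] at hc₁ hc₂
  obtain ⟨c, t, hN', hle, hcc, htt, hedf⟩ := hN.exists_canonical (by positivity) h.mono
    (fun x y hxy hx => StartRule.Allows.mono hxy hx) (Instance.bestKind_mono (top := D.top))
    (Instance.bestKind_nonneg h.top_pos.le)
  have hex : ∀ j, ∃ p, 2 ≤ p ∧ p < D.size ∧ D.c p = c j ∧ D.t p = t j := by
    intro j
    refine h.complete _ _ (hN'.allowed j) (hN'.active j) ?_ ?_
    · obtain ⟨i, hi⟩ := hcc j; exact ⟨e i, hi⟩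
    · exact (htt j).imp (fun ⟨i, hi⟩ => ⟨e i, hi⟩) id
  choose f hf1 hf2 hf3 hf4 using hex
  -- The default `0` is a valid slot number, which is all that is asked of `σ` beyond the jobs.
  let σ : ℕ → ℕ := fun i => if hi : i < I.n then f ⟨i, hi⟩ else 0
  have hσ : ∀ i : Fin I.n, σ i = f i := fun i => by simp [σ]
  have hsize := h.size
  have hlast := h.last
  have hfirst := h.first
  have hσ' : ∀ i < I.n, 2 ≤ σ i ∧ σ i < D.size := by
    intro i hi
    rw [hσ ⟨i, hi⟩]; exact ⟨hf1 _, hf2 _⟩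
  have hb0 : ∀ i < I.n, D.Before 0 (σ i) ∧ D.Before (σ i) 1 := by
    intro i hi
    obtain ⟨h1, h2⟩ := hσ' i hi
    have h3 := h.first_lt_c _ h1 h2
    have h4 := h.t_lt_last _ h1 h2
    have h5 := h.good.c_le _ h2
    exact ⟨⟨by omega, by omega⟩, ⟨by omega, by omega⟩⟩
  have key : (D.table I.n 0 1).1 ≤ D.pathCost 0 (D.jobs I.n 0 1) σ 1 := by
    refine table_le h.good (σ := σ) ?_ ?_ ?_ ?_ ?_ I.n le_rfl 0 1 (by omega) (by omega) ?_ ?_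
    · intro i
      by_cases hi : i < I.n
      · exact (hσ' i hi).2
      · simp only [σ, dif_neg hi]; omega
    · intro i hi
      rw [h.r ⟨i, hi⟩, hσ ⟨i, hi⟩, hf4]
      exact hN'.release _
    · intro i hi
      rw [h.d ⟨i, hi⟩, hσ ⟨i, hi⟩, hf4]
      exact hN'.deadline _
    · intro i hi j hj hij
      unfold Before
      rw [hσ ⟨i, hi⟩, hσ ⟨j, hj⟩, hf4, hf4, hf3, hf3]
      rcases lt_trichotomy (t ⟨i, hi⟩) (t ⟨j, hj⟩) with h1 | h1 | h1
      · exact .inl ⟨h1, hN'.chain _ _ h1⟩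
      · exact absurd (Fin.mk.inj_iff.1 (hN'.inj h1)) hij
      · exact .inr ⟨h1, hN'.chain _ _ h1⟩
    · intro i j hij hj
      rw [h.r ⟨i, hij.trans hj⟩, hσ ⟨i, hij.trans hj⟩, hσ ⟨j, hj⟩, hf4, hf4]
      exact hedf ⟨i, hij.trans hj⟩ ⟨j, hj⟩ hij
    · have a1 := h.first_lt_r ⟨0, hn⟩
      have a2 := h.r_le_last ⟨0, hn⟩
      exact ⟨by omega, by omega⟩
    · intro i hi
      rw [h.jobs_eq] at hi
      exact hb0 i (Finset.mem_range.1 hi)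
  rw [h.pathCost_eq hσ'] at key
  have e1 : (fun i : Fin I.n => D.c (σ i)) = c := by funext i; rw [hσ, hf3]
  have e2 : (fun i : Fin I.n => D.t (σ i)) = t := by funext i; rw [hσ, hf4]
  rw [e1, e2] at key
  exact ⟨key.trans (hle.trans hc₁), key.trans (hle.trans hc₂)⟩

/-- The schedule read off the table. -/
noncomputable def schedule (D : SlotData) (I : Instance) (hK : 0 < I.K)
    (e : Equiv.Perm (Fin I.n)) : Schedule I :=
  scheduleOf I e (fun i => D.c (D.place i I.n 0 1)) (fun i => D.t (D.place i I.n 0 1))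
    fun i => if h : (I.bestKind D.top (D.t (D.place i I.n 0 1) - D.c (D.place i I.n 0 1))).2 < I.K
      then ⟨_, h⟩ else ⟨0, hK⟩

theorem place_mem (h : D.Models ρ I e) (hlt : (D.table I.n 0 1).1 < D.top) (i : ℕ)
    (hi : i < I.n) : 2 ≤ D.place i I.n 0 1 ∧ D.place i I.n 0 1 < D.size := by
  have hsize := h.size
  obtain ⟨hs, -⟩ := table_sound h.good I.n 0 1 (by omega) (by omega) hlt
  rw [h.jobs_eq] at hs
  have hi := Finset.mem_range.2 hi
  refine ⟨?_, hs.size i hi⟩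
  have h1 := (hs.left i hi).1
  have h2 := (hs.right i hi).1
  by_contra hno
  have : D.place i I.n 0 1 = 0 ∨ D.place i I.n 0 1 = 1 := by omega
  rcases this with h3 | h3
  · rw [h3] at h1; exact lt_irrefl _ h1
  · rw [h3] at h2; exact lt_irrefl _ h2

/-- The charge of a last slot is one nonnegative summand of a total below `top`, hence itself below
`top`; so a sufficiently long type exists and the default type in `schedule` is never used there. -/
theorem bestKind_lt_top (h : D.Models ρ I e) (hlt : (D.table I.n 0 1).1 < D.top) {i : Fin I.n}
    (hi : IsLast (fun i : Fin I.n => D.c (D.place i I.n 0 1))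
      (fun i => D.t (D.place i I.n 0 1)) i) :
    (I.bestKind D.top (D.t (D.place i I.n 0 1) - D.c (D.place i I.n 0 1))).1 < D.top := by
  classical
  have hsize := h.size
  obtain ⟨-, hc⟩ := table_sound h.good I.n 0 1 (by omega) (by omega) hlt
  rw [h.pathCost_eq (h.place_mem hlt)] at hc
  refine lt_of_le_of_lt ?_ hlt
  refine le_trans ?_ hc
  unfold normalCost
  refine le_trans ?_ (Finset.single_le_sum (fun j _ => ?_) (Finset.mem_univ i))
  · rw [if_pos hi]
  · split_ifs
    · exact Instance.bestKind_nonneg h.top_pos.le _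
    · exact le_rfl

theorem optimal (h : D.Models ρ I e) (hn : 1 ≤ I.n) (hK : 0 < I.K)
    (hlt : (D.table I.n 0 1).1 < D.top) : (schedule D I hK e).Optimal ρ := by
  have hsize := h.size
  obtain ⟨hs, hc⟩ := table_sound h.good I.n 0 1 (by omega) (by omega) hlt
  rw [h.pathCost_eq (h.place_mem hlt)] at hc
  rw [h.jobs_eq] at hs
  have hm : ∀ i : Fin I.n, (i : ℕ) ∈ Finset.range I.n := fun i => by simp
  constructor
  · refine NormalForm.feasible ⟨?_, ?_, ?_, ?_, ?_, ?_⟩ ?_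
    · intro i
      have := hs.release i (hm i)
      rwa [h.r] at this
    · intro i
      have := hs.deadline i (hm i)
      rwa [h.d] at this
    · intro i
      obtain ⟨h1, h2⟩ := h.place_mem hlt i i.2
      exact h.active _ h1 h2
    · intro i
      obtain ⟨h1, h2⟩ := h.place_mem hlt i i.2
      exact h.allowed _ h1 h2
    · intro i j hij
      have hne : (i : ℕ) ≠ j := fun h => by rw [h] at hij; exact lt_irrefl _ hij
      rcases hs.chain i (hm i) j (hm j) hne with h1 | h1
      · exact h1.2
      · exact absurd h1.1 (not_lt.2 hij.le)
    · intro i j hij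
      by_contra hne
      rcases hs.chain i (hm i) j (hm j) (fun h => hne (Fin.ext h)) with h1 | h1
      · exact h1.1.ne hij
      · exact h1.1.ne' hij
    · intro i hi
      obtain ⟨hk, h1, -⟩ := Instance.bestKind_spec (h.bestKind_lt_top hlt hi)
      rw [dif_pos hk]
      exact h1
  · intro S' hS'
    have h1 := (h.table_le_totalCost hn hS').1
    have h2 := scheduleOf_totalCost (I := I) (e := e)
      (c := fun i => D.c (D.place i I.n 0 1)) (t := fun i => D.t (D.place i I.n 0 1))
      (kind := fun i => if h : (I.bestKind D.top
          (D.t (D.place i I.n 0 1) - D.c (D.place i I.n 0 1))).2 < I.K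
        then ⟨_, h⟩ else ⟨0, hK⟩) (F := fun x => (I.bestKind D.top x).1) (by
        intro i hi
        obtain ⟨hk, -, h2⟩ := Instance.bestKind_spec (h.bestKind_lt_top hlt hi)
        rw [dif_pos hk]
        exact h2)
    have h3 : ((schedule D I hK e).totalCost : ℤ) ≤ S'.totalCost := by
      rw [schedule, h2]; exact hc.trans h1
    exact_mod_cast h3

/-- A feasible schedule would push the entry down to `costBound`, which is smaller than `top`. -/
theorem infeasible (h : D.Models ρ I e) (hn : 1 ≤ I.n) (hle : D.top ≤ (D.table I.n 0 1).1) :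
    ¬ ∃ S : Schedule I, S.Feasible ρ := by
  rintro ⟨S, hS⟩
  have h1 := (h.table_le_totalCost hn hS).2
  have h2 := h.costBound_lt
  omega

end SlotData.Models

/-! ## Reasoning about programs -/

@[simp] theorem State.setReg_reg (s : State) (x : ℕ) (v : ℤ) (y : ℕ) :
    (s.setReg x v).reg y = if y = x then v else s.reg y := by
  simp [State.setReg, Function.update_apply]

@[simp] theorem State.setReg_arr (s : State) (x : ℕ) (v : ℤ) : (s.setReg x v).arr = s.arr := rfl

@[simp] theorem State.setArr_reg (s : State) (a : ℕ) (i v : ℤ) : (s.setArr a i v).reg = s.reg := rfl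

@[simp] theorem State.setArr_arr (s : State) (a : ℕ) (i v : ℤ) (b : ℕ) :
    (s.setArr a i v).arr b = if b = a then Function.update (s.arr a) i v else s.arr b := by
  simp [State.setArr, Function.update_apply]

namespace Cmd

/-- The registers a command may change. -/
def regs : Cmd → List ℕ
  | skip => []
  | assign x _ => [x]
  | write _ _ _ => []
  | seq p q => p.regs ++ q.regs
  | ifLe _ _ p q => p.regs ++ q.regs
  | whileLe _ _ p => p.regs

/-- The arrays a command may change. -/
def arrs : Cmd → List ℕ
  | skip => []
  | assign _ _ => []
  | write a _ _ => [a]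
  | seq p q => p.arrs ++ q.arrs
  | ifLe _ _ p q => p.arrs ++ q.arrs
  | whileLe _ _ p => p.arrs

/-- A command without loops. -/
def straight : Cmd → Bool
  | skip => true
  | assign _ _ => true
  | write _ _ _ => true
  | seq p q => p.straight && q.straight
  | ifLe _ _ p q => p.straight && q.straight
  | whileLe _ _ _ => false

/-- The effect of a command without loops. -/
def run : Cmd → State → State
  | skip, s => s
  | assign x e, s => s.setReg x (e.eval s)
  | write a i e, s => s.setArr a (i.eval s) (e.eval s)
  | seq p q, s => q.run (p.run s)
  | ifLe e₁ e₂ p q, s => if e₁.eval s ≤ e₂.eval s then p.run s else q.run s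
  | whileLe _ _ _, s => s

/-- A bound for the number of steps of a command without loops. -/
def time : Cmd → ℕ
  | skip => 1
  | assign _ e => e.steps + 1
  | write _ i e => i.steps + e.steps + 1
  | seq p q => p.time + q.time
  | ifLe e₁ e₂ p q => e₁.steps + e₂.steps + 1 + (p.time + q.time)
  | whileLe _ _ _ => 0

/-- Execute the body for `x = 0, …, b - 1`, where `b` is a register. -/
def forLt (x b : ℕ) (p : Cmd) : Cmd :=
  seq (assign x (.const 0)) (whileLe (.add (.reg x) (.const 1)) (.reg b)
    (seq p (assign x (.add (.reg x) (.const 1)))))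

end Cmd

infixr:60 " ;; " => Cmd.seq

/-- The memories `s` and `s'` agree except on what `p` may change. -/
structure Frame (p : Cmd) (s s' : State) : Prop where
  reg : ∀ x, p.regs.contains x = false → s'.reg x = s.reg x
  arr : ∀ a, p.arrs.contains a = false → s'.arr a = s.arr a

/-- The written registers and arrays are over-approximated syntactically by computable lists. Later
frame conditions for concrete programs are therefore closed by `rfl`. -/
theorem Exec.frame {p : Cmd} {s s' : State} {T : ℕ} (h : Exec p s T s') : Frame p s s' := by
  induction h with
  | skip s => exact ⟨fun _ _ => rfl, fun _ _ => rfl⟩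
  | assign x e s =>
    refine ⟨fun y hy => ?_, fun _ _ => rfl⟩
    simp [Cmd.regs] at hy
    simp [hy]
  | write a i e s =>
    refine ⟨fun _ _ => rfl, fun b hb => ?_⟩
    simp [Cmd.arrs] at hb
    simp [hb]
  | seq _ _ ih₁ ih₂ =>
    refine ⟨fun x hx => ?_, fun a ha => ?_⟩
    · simp only [Cmd.regs, List.contains_append, Bool.or_eq_false_iff] at hx
      rw [ih₂.reg x hx.2, ih₁.reg x hx.1]
    · simp only [Cmd.arrs, List.contains_append, Bool.or_eq_false_iff] at ha
      rw [ih₂.arr a ha.2, ih₁.arr a ha.1]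
  | ifTrue _ _ ih =>
    refine ⟨fun x hx => ?_, fun a ha => ?_⟩
    · simp only [Cmd.regs, List.contains_append, Bool.or_eq_false_iff] at hx
      exact ih.reg x hx.1
    · simp only [Cmd.arrs, List.contains_append, Bool.or_eq_false_iff] at ha
      exact ih.arr a ha.1
  | ifFalse _ _ ih =>
    refine ⟨fun x hx => ?_, fun a ha => ?_⟩
    · simp only [Cmd.regs, List.contains_append, Bool.or_eq_false_iff] at hx
      exact ih.reg x hx.2
    · simp only [Cmd.arrs, List.contains_append, Bool.or_eq_false_iff] at ha
      exact ih.arr a ha.2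
  | whileDone _ => exact ⟨fun _ _ => rfl, fun _ _ => rfl⟩
  | whileStep _ _ _ ih₁ ih₂ =>
    exact ⟨fun x hx => (ih₂.reg x hx).trans (ih₁.reg x hx),
      fun a ha => (ih₂.arr a ha).trans (ih₁.arr a ha)⟩

theorem Exec.run {p : Cmd} (hp : p.straight = true) (s : State) :
    ∃ T ≤ p.time, Exec p s T (p.run s) := by
  induction p generalizing s with
  | skip => exact ⟨1, le_rfl, .skip s⟩
  | assign x e => exact ⟨_, le_rfl, .assign x e s⟩
  | write a i e => exact ⟨_, le_rfl, .write a i e s⟩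
  | seq p q ihp ihq =>
    simp only [Cmd.straight, Bool.and_eq_true] at hp
    obtain ⟨T₁, h₁, e₁⟩ := ihp hp.1 s
    obtain ⟨T₂, h₂, e₂⟩ := ihq hp.2 (p.run s)
    exact ⟨_, add_le_add h₁ h₂, .seq e₁ e₂⟩
  | ifLe e₁ e₂ p q ihp ihq =>
    simp only [Cmd.straight, Bool.and_eq_true] at hp
    rw [Cmd.run, Cmd.time]
    split_ifs with h
    · obtain ⟨T, hT, e⟩ := ihp hp.1 s
      exact ⟨_, by omega, .ifTrue h e⟩
    · obtain ⟨T, hT, e⟩ := ihq hp.2 s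
      exact ⟨_, by omega, .ifFalse h e⟩
  | whileLe e₁ e₂ p => simp [Cmd.straight] at hp

theorem Frame.run {p : Cmd} (hp : p.straight = true) (s : State) : Frame p s (p.run s) := by
  obtain ⟨_, _, h⟩ := Exec.run hp s
  exact h.frame

/-! ### Total correctness with step bounds -/

/-- Started in `s`, the command `p` halts after at most `B` steps in a memory satisfying `Q`. -/
def Ends (p : Cmd) (s : State) (B : ℕ) (Q : State → Prop) : Prop :=
  ∃ T s', Exec p s T s' ∧ T ≤ B ∧ Q s'

namespace Ends

variable {p q : Cmd} {s : State} {B B₁ B₂ : ℕ} {Q Q' : State → Prop}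

theorem mono (h : Ends p s B₁ Q) (hB : B₁ ≤ B₂) : Ends p s B₂ Q := by
  obtain ⟨T, s', h1, h2, h3⟩ := h
  exact ⟨T, s', h1, h2.trans hB, h3⟩

theorem imp (h : Ends p s B Q) (hQ : ∀ s', Frame p s s' → Q s' → Q' s') : Ends p s B Q' := by
  obtain ⟨T, s', h1, h2, h3⟩ := h
  exact ⟨T, s', h1, h2, hQ s' h1.frame h3⟩

theorem seq (h : Ends p s B₁ fun s' => Ends q s' B₂ Q) : Ends (p ;; q) s (B₁ + B₂) Q := by
  obtain ⟨T, s', h1, h2, T', s'', h3, h4, h5⟩ := h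
  exact ⟨_, s'', .seq h1 h3, add_le_add h2 h4, h5⟩

theorem straight (hp : p.straight = true) (hQ : Q (p.run s)) : Ends p s p.time Q := by
  obtain ⟨T, hT, h⟩ := Exec.run hp s
  exact ⟨T, _, h, hT, hQ⟩

theorem ifLe {e₁ e₂ : Expr} (h₁ : e₁.eval s ≤ e₂.eval s → Ends p s B₁ Q)
    (h₂ : ¬ e₁.eval s ≤ e₂.eval s → Ends q s B₂ Q) :
    Ends (.ifLe e₁ e₂ p q) s (e₁.steps + e₂.steps + 1 + (B₁ + B₂)) Q := by
  by_cases h : e₁.eval s ≤ e₂.eval s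
  · obtain ⟨T, s', h1, h2, h3⟩ := h₁ h
    exact ⟨_, s', .ifTrue h h1, by omega, h3⟩
  · obtain ⟨T, s', h1, h2, h3⟩ := h₂ h
    exact ⟨_, s', .ifFalse h h1, by omega, h3⟩

/-- The invariant is required after the increment of the counter, hence the `setReg` in `hstep`. The
body must leave counter and bound alone, stated as Boolean equations so that concrete loops
discharge them by computation. -/
theorem forLt {x b : ℕ} (N : ℕ) (Inv : ℕ → State → Prop) (hb : s.reg b = N)
    (hbp : (b :: x :: []).all (fun y => !p.regs.contains y) = true)
    (hbx : (b == x) = false)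
    (h₀ : Inv 0 (s.setReg x 0))
    (hstep : ∀ i < N, ∀ s', Frame (.forLt x b p) s s' → s'.reg x = i → s'.reg b = N → Inv i s' →
      Ends p s' B fun s'' => Inv (i + 1) (s''.setReg x (i + 1)))
    (hQ : ∀ s', Frame (.forLt x b p) s s' → Inv N s' → Q s') :
    Ends (.forLt x b p) s (N * (B + 10) + 10) Q := by
  simp only [List.all_cons, List.all_nil, Bool.and_true, Bool.and_eq_true,
    Bool.not_eq_true'] at hbp
  obtain ⟨hbp, hxp⟩ := hbp
  have h0x : ∀ s' : State, Frame (.forLt x b p) s s' → s'.reg b = N := by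
    intro s' hs'
    rw [hs'.reg b, hb]
    simp only [Cmd.forLt, Cmd.regs, List.cons_append, List.nil_append, List.contains_cons,
      List.contains_append, List.contains_nil, Bool.or_false, hbp, hbx]
  have hF0 : Frame (.forLt x b p) s (s.setReg x 0) := by
    refine ⟨fun y hy => ?_, fun _ _ => rfl⟩
    simp only [Cmd.forLt, Cmd.regs, List.cons_append, List.nil_append, List.contains_cons,
      Bool.or_eq_false_iff, beq_eq_false_iff_ne] at hy
    simp [hy.1]
  have hcond : ∀ s' : State, ∀ i : ℕ, s'.reg x = i → s'.reg b = N →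
      ((Expr.add (.reg x) (.const 1)).eval s' ≤ (Expr.reg b).eval s' ↔ i < N) := by
    intro s' i h1 h2
    simp only [Expr.eval, h1, h2]
    omega
  -- Besides the body, a round takes 5 steps for the test and 4 for the increment; 6 covers the
  -- final failing test.
  suffices H : ∀ j i, i + j = N → ∀ s', Frame (.forLt x b p) s s' → s'.reg x = i → Inv i s' →
      ∃ T s'', Exec (.whileLe (.add (.reg x) (.const 1)) (.reg b)
        (p ;; .assign x (.add (.reg x) (.const 1)))) s' T s'' ∧ T ≤ j * (B + 10) + 6 ∧
        Inv N s'' ∧ Frame (.forLt x b p) s s'' by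
    obtain ⟨T, s', h1, h2, h3, h4⟩ := H N 0 (by omega) _ hF0 (by simp) h₀
    refine ⟨_, s', .seq (.assign _ _ _) h1, ?_, hQ s' h4 h3⟩
    simp only [Expr.steps]; omega
  intro j
  induction j with
  | zero =>
    intro i hi s' hF hx hI
    refine ⟨_, s', .whileDone ?_, ?_, by rwa [← show i = N by omega], hF⟩
    · rw [hcond s' i hx (h0x s' hF)]; omega
    · simp [Expr.steps]
  | succ j ih =>
    intro i hi s' hF hx hI
    obtain ⟨T₁, s₁, e₁, t₁, I₁⟩ := hstep i (by omega) s' hF hx (h0x s' hF) hI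
    have hx₁ : s₁.reg x = i := by rw [e₁.frame.reg x hxp, hx]
    have hex := Exec.assign x (.add (.reg x) (.const 1)) s₁
    simp only [Expr.eval, hx₁] at hex
    have hbody := Exec.seq e₁ hex
    have hF₁ : Frame (.forLt x b p) s (s₁.setReg x (i + 1)) := by
      have hf := hbody.frame
      refine ⟨fun y hy => ?_, fun a ha => ?_⟩
      · rw [hf.reg y, hF.reg y hy]
        simp only [Cmd.forLt, Cmd.regs, List.cons_append, List.nil_append, List.contains_cons,
          Bool.or_eq_false_iff] at hy
        exact hy.2
      · rw [hf.arr a, hF.arr a ha]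
        simpa [Cmd.forLt, Cmd.arrs] using ha
    obtain ⟨T₂, s₂, e₂, t₂, I₂, F₂⟩ := ih (i + 1) (by omega) _ hF₁ (by simp) I₁
    refine ⟨_, s₂, .whileStep ?_ hbody e₂, ?_, I₂, F₂⟩
    · rw [hcond s' i hx (h0x s' hF)]; omega
    · simp only [Expr.steps]
      rw [Nat.succ_mul]
      omega

end Ends

open Calibration.Cmd Calibration.Expr

/-! ## Filling the table

Registers: `0` number of jobs, `3` top value, `33` number of slots, `34` its square. Arrays:
`4` position of a job in the order of deadlines, `5` and `6` release dates and deadlines in this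
order, `10` and `11` the slots, `12` and `13` cost and type of the cheapest calibration that is long
enough for a slot, `14` multiples of the number of slots, `15` and `16` the table. -/

/-- The memory holds the data of the dynamic program. -/
structure Ready (D : SlotData) (I : Instance) (e : Equiv.Perm (Fin I.n)) (s : State) : Prop where
  n : s.reg 0 = I.n
  top : s.reg 3 = D.top
  size : s.reg 33 = D.size
  sq : s.reg 34 = (D.size : ℤ) * D.size
  pos : ∀ j : Fin I.n, s.arr 4 (j : ℕ) = (e.symm j : ℕ)
  r : ∀ k < I.n, s.arr 5 k = D.r k
  d : ∀ k < I.n, s.arr 6 k = D.d k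
  c : ∀ p < D.size, s.arr 10 p = D.c p
  t : ∀ p < D.size, s.arr 11 p = D.t p
  G : ∀ p < D.size, s.arr 12 p = D.G p
  kind : ∀ p, 2 ≤ p → p < D.size → s.arr 13 p = (I.bestKind D.top (D.t p - D.c p)).2
  row : ∀ p < D.size, s.arr 14 p = (p : ℤ) * D.size

theorem Ready.frame {D : SlotData} {I : Instance} {e : Equiv.Perm (Fin I.n)} {p : Cmd}
    {s s' : State} (h : Ready D I e s) (hF : Frame p s s')
    (hr : [0, 3, 33, 34].all (fun x => !p.regs.contains x) = true)
    (ha : [4, 5, 6, 10, 11, 12, 13, 14].all (fun x => !p.arrs.contains x) = true) :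
    Ready D I e s' := by
  simp only [List.all_cons, List.all_nil, Bool.and_true, Bool.and_eq_true,
    Bool.not_eq_true'] at hr ha
  obtain ⟨r1, r2, r3, r4⟩ := hr
  obtain ⟨a1, a2, a3, a4, a5, a6, a7, a8⟩ := ha
  constructor
  · rw [hF.reg _ r1]; exact h.n
  · rw [hF.reg _ r2]; exact h.top
  · rw [hF.reg _ r3]; exact h.size
  · rw [hF.reg _ r4]; exact h.sq
  · rw [hF.arr _ a1]; exact h.pos
  · rw [hF.arr _ a2]; exact h.r
  · rw [hF.arr _ a3]; exact h.d
  · rw [hF.arr _ a4]; exact h.c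
  · rw [hF.arr _ a5]; exact h.t
  · rw [hF.arr _ a6]; exact h.G
  · rw [hF.arr _ a7]; exact h.kind
  · rw [hF.arr _ a8]; exact h.row

namespace SlotData

variable (D : SlotData)

/-- The address of a table entry. -/
def addr (k p q : ℕ) : ℕ := k * (D.size * D.size) + p * D.size + q

/-- The table entries with addresses below `X` are stored in the arrays `V` (values) and `A`
(slots). -/
def Stored (V A : ℤ → ℤ) (X : ℕ) : Prop :=
  ∀ k p q, p < D.size → q < D.size → D.addr k p q < X →
    V (D.addr k p q) = (D.table k p q).1 ∧ (1 ≤ k → A (D.addr k p q) = (D.table k p q).2)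

variable {D}

theorem addr_inj {k p q k' p' q' : ℕ} (hp : p < D.size) (hq : q < D.size) (hp' : p' < D.size)
    (hq' : q' < D.size) (h : D.addr k p q = D.addr k' p' q') : k = k' ∧ p = p' ∧ q = q' := by
  have key : ∀ {a b x y N : ℕ}, x < N → y < N → a * N + x = b * N + y → a = b ∧ x = y := by
    intro a b x y N hx hy h
    have hN : 0 < N := by omega
    have h1 : (a * N + x) / N = a := by
      rw [Nat.add_comm, Nat.add_mul_div_right _ _ hN, Nat.div_eq_of_lt hx, Nat.zero_add]
    have h2 : (b * N + y) / N = b := by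
      rw [Nat.add_comm, Nat.add_mul_div_right _ _ hN, Nat.div_eq_of_lt hy, Nat.zero_add]
    have h3 : a = b := by rw [← h1, h, h2]
    subst h3
    exact ⟨rfl, by omega⟩
  -- Horner form: `q` and `p` are digits to base `D.size`, recovered one after the other.
  have h' : (k * D.size + p) * D.size + q = (k' * D.size + p') * D.size + q' := by
    unfold addr at h; nlinarith [h]
  obtain ⟨h1, h2⟩ := key hq hq' h'
  obtain ⟨h3, h4⟩ := key hp hp' h1
  exact ⟨h3, h4, h2⟩

/-- The table is filled in the order of addresses, so one pointer describes what is known;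
injectivity of addresses identifies the new entry. -/
theorem Stored.push {V A A' : ℤ → ℤ} {k p q : ℕ} (h : D.Stored V A (D.addr k p q))
    (hp : p < D.size) (hq : q < D.size) {v : ℤ} (hv : v = (D.table k p q).1)
    (hA' : ∀ i : ℤ, i ≠ D.addr k p q → A' i = A i)
    (hA : 1 ≤ k → A' (D.addr k p q) = (D.table k p q).2) :
    D.Stored (Function.update V (D.addr k p q) v) A' (D.addr k p q + 1) := by
  intro k' p' q' hp' hq' hlt
  rcases Nat.lt_succ_iff_lt_or_eq.1 hlt with h1 | h1
  · have hne : ((D.addr k' p' q' : ℕ) : ℤ) ≠ (D.addr k p q : ℕ) := by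
      exact_mod_cast h1.ne
    rw [Function.update_of_ne hne, hA' _ hne]
    exact h k' p' q' hp' hq' h1
  · obtain ⟨rfl, rfl, rfl⟩ := addr_inj hp' hq' hp hq h1
    rw [Function.update_self]
    exact ⟨hv, hA⟩

theorem addr_lt {k p q : ℕ} (hp : p < D.size) (hq : q < D.size) :
    D.addr k p q < (k + 1) * (D.size * D.size) := by
  unfold addr; nlinarith

end SlotData

/-- Test whether slot `10` can be used before slot `11`, and store the entry for no jobs. -/
def leafStep : Cmd :=
  .assign 22 (reg 3) ;;
  .ifLe (add (read 11 (reg 10)) (const 1)) (read 11 (reg 11))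
    (.ifLe (add (read 11 (reg 10)) (const 1)) (read 10 (reg 11))
      (.assign 22 (read 12 (reg 10))) .skip ;;
     -- Tested after the other case, so that equal calibrations override a cost already assigned, as
     -- in the definition of `table`.
     .ifLe (read 10 (reg 10)) (read 10 (reg 11))
      (.ifLe (read 10 (reg 11)) (read 10 (reg 10)) (.assign 22 (const 0)) .skip) .skip) .skip ;;
  .write 15 (reg 35) (reg 22) ;;
  .assign 35 (add (reg 35) (const 1))

/-- Fill the part of the table for no jobs. -/
def leafCmd : Cmd :=
  .assign 35 (const 0) ;; forLt 10 33 (forLt 11 33 leafStep)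

theorem leafCmd_ends {D : SlotData} {I : Instance} {e : Equiv.Perm (Fin I.n)} {s : State}
    (h : Ready D I e s) :
    Ends leafCmd s (D.size * (D.size * 100 + 100) + 100) fun s' =>
      Ready D I e s' ∧ s'.reg 35 = (D.size * D.size : ℕ) ∧
        D.Stored (s'.arr 15) (s'.arr 16) (D.size * D.size) := by
  refine Ends.mono (Ends.seq (Ends.straight rfl (Ends.forLt D.size (fun p s' =>
    s'.reg 35 = D.addr 0 p 0 ∧ D.Stored (s'.arr 15) (s'.arr 16) (D.addr 0 p 0))
    (by simpa [run] using h.size) rfl rfl (B := D.size * 70 + 10) ?_ ?_ ?_))) ?_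
  · simp [run, SlotData.addr, SlotData.Stored, Expr.eval]
  · intro p hp s₁ hF₁ hp₁ h33 ⟨hw, hst⟩
    have h₀ : Ready D I e (s.setReg 35 0) := h.frame (Frame.run (p := .assign 35 (const 0)) rfl s) rfl rfl
    have h₁ : Ready D I e s₁ := h₀.frame hF₁ rfl rfl
    refine Ends.mono (Ends.forLt D.size (fun q s' =>
      s'.reg 35 = D.addr 0 p q ∧ D.Stored (s'.arr 15) (s'.arr 16) (D.addr 0 p q)) h33 rfl rfl
      ?_ (B := 60) ?_ ?_) (by omega)
    · simpa using ⟨hw, hst⟩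
    · intro q hq s₂ hF₂ hq₂ h33' ⟨hw, hst⟩
      have h₂ : Ready D I e s₂ := h₁.frame hF₂ rfl rfl
      have hp₂ : s₂.reg 10 = p := by rw [hF₂.reg 10 rfl, hp₁]
      refine (Ends.straight rfl ?_).mono (by decide)
      have e1 := h₂.c p hp
      have e2 := h₂.t p hp
      have e3 := h₂.c q hq
      have e4 := h₂.t q hq
      have e5 := h₂.G p hp
      have e6 := h₂.top
      have hnext : D.addr 0 p (q + 1) = D.addr 0 p q + 1 := rfl
      rw [hnext]
      suffices H : ∀ v, v = (D.table 0 p q).1 →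
          (leafStep.run s₂).reg 35 = D.addr 0 p q + 1 ∧
          (leafStep.run s₂).arr 16 = s₂.arr 16 ∧
          (leafStep.run s₂).arr 15 = Function.update (s₂.arr 15) (D.addr 0 p q) v by
        obtain ⟨a1, a2, a3⟩ := H _ rfl
        refine ⟨by simp [a1], ?_⟩
        simp only [State.setReg_arr]
        rw [a2, a3]
        exact hst.push hp hq rfl (fun _ _ => rfl) (by simp)
      intro v hv
      rw [SlotData.table] at hv
      dsimp only at hv
      by_cases c1 : D.t p + 1 ≤ D.t q <;> by_cases c2 : D.t p + 1 ≤ D.c q <;>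
        by_cases c3 : D.c p ≤ D.c q <;> by_cases c4 : D.c q ≤ D.c p <;>
      simp only [leafStep, run, Expr.eval, State.setReg_reg, State.setReg_arr, State.setArr_reg,
        State.setArr_arr, hp₂, hq₂, hw, e1, e2, e3, e4, e5, e6, c1, c2, c3, c4,
        ↓reduceIte, Nat.reduceEqDiff, true_and] <;>
      (congr 1; rw [hv]; split_ifs <;> omega)
    · intro s₃ hF₃ ⟨hw, hst⟩
      have : D.addr 0 (p + 1) 0 = D.addr 0 p D.size := by simp [SlotData.addr, Nat.succ_mul]
      rw [this]
      simpa using ⟨hw, hst⟩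
  · intro s₁ hF₁ ⟨hw, hst⟩
    have h₀ : Ready D I e (s.setReg 35 0) := h.frame (Frame.run (p := .assign 35 (const 0)) rfl s) rfl rfl
    have : D.addr 0 D.size 0 = D.size * D.size := by simp [SlotData.addr]
    rw [this] at hw hst
    exact ⟨h₀.frame hF₁ rfl rfl, hw, hst⟩
  · have : Cmd.time (.assign 35 (const 0)) = 2 := rfl
    nlinarith

/-- Compare the value for choosing slot `13` for the job with the best value so far. -/
def scanStep : Cmd :=
  .ifLe (reg 24) (read 11 (reg 13))
    (.ifLe (add (read 11 (reg 13)) (const 1)) (reg 25)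
      (.assign 26 (add (read 15 (add (reg 37) (reg 13)))
        (read 15 (add (add (reg 36) (read 14 (reg 13))) (reg 11)))) ;;
       .ifLe (add (reg 26) (const 1)) (reg 22) (.assign 22 (reg 26) ;; .assign 23 (reg 13)) .skip)
      .skip) .skip

/-- Store the table entry for the slots `10` and `11`. -/
def entryCmd : Cmd :=
  (.assign 37 (add (reg 36) (read 14 (reg 10))) ;;
   -- The entry of the previous level is the correct value when the release date of the new job is
   -- outside the window; it is replaced by `top` before a scan.
   .assign 22 (read 15 (add (reg 37) (reg 11))) ;;
   .assign 23 (const 0)) ;;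
  .ifLe (add (read 11 (reg 10)) (const 1)) (reg 24)
    (.ifLe (reg 24) (read 11 (reg 11)) (.assign 22 (reg 3) ;; forLt 13 33 scanStep) .skip) .skip ;;
  (.write 15 (reg 35) (reg 22) ;; .write 16 (reg 35) (reg 23) ;;
   .assign 35 (add (reg 35) (const 1)))

/-- Fill the table for one more job, the job `12` in the order of deadlines. -/
def levelCmd : Cmd :=
  (.assign 24 (read 5 (reg 12)) ;; .assign 25 (read 6 (reg 12))) ;;
  forLt 10 33 (forLt 11 33 entryCmd) ;;
  .assign 36 (add (reg 36) (reg 34))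

def tableCmd : Cmd :=
  .assign 36 (const 0) ;; forLt 12 0 levelCmd

/-- The situation in which the entry for the first `k + 1` jobs and the slots `p` and `q` is
computed. -/
structure AtEntry (D : SlotData) (I : Instance) (e : Equiv.Perm (Fin I.n)) (k : ℕ) (s : State) :
    Prop where
  ready : Ready D I e s
  lt : k < I.n
  r : s.reg 24 = D.r k
  d : s.reg 25 = D.d k
  base : s.reg 36 = (k : ℤ) * ((D.size : ℤ) * D.size)

theorem AtEntry.frame {D : SlotData} {I : Instance} {e : Equiv.Perm (Fin I.n)} {k : ℕ} {p : Cmd}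
    {s s' : State} (h : AtEntry D I e k s) (hF : Frame p s s')
    (hr : [0, 3, 33, 34].all (fun x => !p.regs.contains x) = true)
    (ha : [4, 5, 6, 10, 11, 12, 13, 14].all (fun x => !p.arrs.contains x) = true)
    (h24 : p.regs.contains 24 = false) (h25 : p.regs.contains 25 = false)
    (h36 : p.regs.contains 36 = false) : AtEntry D I e k s' :=
  ⟨h.ready.frame hF hr ha, h.lt, (hF.reg _ h24).trans h.r, (hF.reg _ h25).trans h.d,
    (hF.reg _ h36).trans h.base⟩

theorem SlotData.Stored.read {D : SlotData} {V A : ℤ → ℤ} {X k p q : ℕ} (h : D.Stored V A X)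
    (hp : p < D.size) (hq : q < D.size) (hX : (k + 1) * (D.size * D.size) ≤ X) :
    V ((k : ℤ) * ((D.size : ℤ) * D.size) + (p : ℤ) * D.size + q) = (D.table k p q).1 := by
  have := (h k p q hp hq ((addr_lt hp hq).trans_le hX)).1
  rw [← this, addr]
  push_cast
  rfl

theorem SlotData.table_succ (D : SlotData) {k p q : ℕ} (h : D.t p < D.r k ∧ D.r k ≤ D.t q) :
    D.table (k + 1) p q = scan (fun m => D.r k ≤ D.t m ∧ D.t m < D.d k)
        (fun m => (D.table k p m).1 + (D.table k m q).1) D.top D.size := by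
  rw [table, if_pos h]

theorem SlotData.table_succ_of_not (D : SlotData) {k p q : ℕ}
    (h : ¬ (D.t p < D.r k ∧ D.r k ≤ D.t q)) :
    D.table (k + 1) p q = ((D.table k p q).1, 0) := by
  rw [table, if_neg h]

theorem scanLoop_ends {D : SlotData} {I : Instance} {e : Equiv.Perm (Fin I.n)} {s : State}
    {k p q X : ℕ} (h : AtEntry D I e k s) (hp : p < D.size) (hq : q < D.size)
    (h11 : s.reg 11 = q) (h37 : s.reg 37 = (k : ℤ) * ((D.size : ℤ) * D.size) + (p : ℤ) * D.size)
    (h22 : s.reg 22 = D.top) (h23 : s.reg 23 = 0)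
    (hst : D.Stored (s.arr 15) (s.arr 16) X) (hX : (k + 1) * (D.size * D.size) ≤ X) :
    Ends (forLt 13 33 scanStep) s (D.size * 70 + 10) fun s' =>
      s'.reg 22 = (scan (fun m => D.r k ≤ D.t m ∧ D.t m < D.d k)
        (fun m => (D.table k p m).1 + (D.table k m q).1) D.top D.size).1 ∧
      s'.reg 23 = (scan (fun m => D.r k ≤ D.t m ∧ D.t m < D.d k)
        (fun m => (D.table k p m).1 + (D.table k m q).1) D.top D.size).2 := by
  refine Ends.forLt D.size (fun m s' =>
    s'.reg 22 = (scan (fun m => D.r k ≤ D.t m ∧ D.t m < D.d k)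
        (fun m => (D.table k p m).1 + (D.table k m q).1) D.top m).1 ∧
      s'.reg 23 = (scan (fun m => D.r k ≤ D.t m ∧ D.t m < D.d k)
        (fun m => (D.table k p m).1 + (D.table k m q).1) D.top m).2) h.ready.size rfl rfl
    (B := 60) ?_ ?_ fun _ _ h => h
  · simp [scan, h22, h23]
  · intro m hm s₁ hF hm₁ h33 ⟨i22, i23⟩
    have h₁ := h.frame hF rfl rfl rfl rfl rfl
    refine (Ends.straight rfl ?_).mono (by decide)
    have e1 : s₁.reg 11 = q := (hF.reg 11 rfl).trans h11
    have e2 := (hF.reg 37 rfl).trans h37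
    have e3 := h₁.ready.t m hm
    have e4 := h₁.ready.row m hm
    have e5 := h₁.r
    have e6 := h₁.d
    have e7 := h₁.base
    have hst₁ : D.Stored (s₁.arr 15) (s₁.arr 16) X := by
      rw [hF.arr 15 rfl, hF.arr 16 rfl]; exact hst
    have e8 := hst₁.read hp hm hX
    have e9 := hst₁.read hm hq hX
    rw [scan]
    by_cases hc : (D.r k ≤ D.t m ∧ D.t m < D.d k) ∧ (D.table k p m).1 + (D.table k m q).1 <
      (scan (fun m => D.r k ≤ D.t m ∧ D.t m < D.d k)
        (fun m => (D.table k p m).1 + (D.table k m q).1) D.top m).1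
    · rw [if_pos hc]
      have c1 := hc.1.1
      have c2 := Int.add_one_le_iff.2 hc.1.2
      have c3 := Int.add_one_le_iff.2 hc.2
      simp only [scanStep, run, Expr.eval, State.setReg_reg, hm₁, e1, e2, e3, e4,
        e5, e6, e7, e8, e9, i22, i23, c1, c2, c3, ↓reduceIte, Nat.reduceEqDiff, and_self]
    · rw [if_neg hc]
      by_cases c1 : D.r k ≤ D.t m
      · by_cases c2 : D.t m + 1 ≤ D.d k
        · have c3 : ¬ (D.table k p m).1 + (D.table k m q).1 + 1 ≤
              (scan (fun m => D.r k ≤ D.t m ∧ D.t m < D.d k)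
                (fun m => (D.table k p m).1 + (D.table k m q).1) D.top m).1 :=
            fun c3 => hc ⟨⟨c1, c2⟩, c3⟩
          simp only [scanStep, run, Expr.eval, State.setReg_reg, hm₁, e1, e2, e3, e4,
          e5, e6, e7, e8, e9, i22, i23, c1, c2, c3, ↓reduceIte, Nat.reduceEqDiff, and_self]
        · simp only [scanStep, run, Expr.eval, State.setReg_reg, hm₁, e1, e2, e3, e4,
          e5, e6, e7, e8, e9, i22, i23, c1, c2, ↓reduceIte, Nat.reduceEqDiff, and_self]
      · simp only [scanStep, run, Expr.eval, State.setReg_reg, hm₁, e1, e2, e3, e4,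
          e5, e6, e7, e8, e9, i22, i23, c1, ↓reduceIte, Nat.reduceEqDiff, and_self]

/-- All entries of level `k` lie below the write pointer, which is already in level `k + 1`; hence
both summands of every candidate can be read. -/
theorem entryCmd_ends {D : SlotData} {I : Instance} {e : Equiv.Perm (Fin I.n)} {s : State}
    {k p q : ℕ} (h : AtEntry D I e k s) (hp : p < D.size) (hq : q < D.size)
    (h10 : s.reg 10 = p) (h11 : s.reg 11 = q) (h35 : s.reg 35 = D.addr (k + 1) p q)
    (hst : D.Stored (s.arr 15) (s.arr 16) (D.addr (k + 1) p q)) :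
    Ends entryCmd s (D.size * 70 + 100) fun s' => s'.reg 35 = D.addr (k + 1) p q + 1 ∧
      D.Stored (s'.arr 15) (s'.arr 16) (D.addr (k + 1) p q + 1) := by
  have hX : (k + 1) * (D.size * D.size) ≤ D.addr (k + 1) p q := by
    unfold SlotData.addr; omega
  have r1 := h.ready.row p hp
  have r2 := h.base
  have r3 := hst.read hp hq hX
  refine Ends.mono (Ends.seq (Ends.straight rfl (Ends.seq (B₁ := D.size * 70 + 60)
    (B₂ := 20) ?_))) ?_
  swap
  · have : Cmd.time (.assign 37 (add (reg 36) (read 14 (reg 10))) ;;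
      .assign 22 (read 15 (add (reg 37) (reg 11))) ;; .assign 23 (const 0)) ≤ 20 := by decide
    omega
  set s₁ := (.assign 37 (add (reg 36) (read 14 (reg 10))) ;;
      .assign 22 (read 15 (add (reg 37) (reg 11))) ;; .assign 23 (const 0) : Cmd).run s with hs₁
  have hF₁ : Frame _ s s₁ := Frame.run rfl s
  have h₁ := h.frame hF₁ rfl rfl rfl rfl rfl
  have e10 : s₁.reg 10 = p := (hF₁.reg 10 rfl).trans h10
  have e11 : s₁.reg 11 = q := (hF₁.reg 11 rfl).trans h11
  have e35 := (hF₁.reg 35 rfl).trans h35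
  have e37 : s₁.reg 37 = (k : ℤ) * ((D.size : ℤ) * D.size) + (p : ℤ) * D.size := by
    simp [hs₁, run, Expr.eval, h10, r1, r2]
  have e23 : s₁.reg 23 = 0 := by simp [hs₁, run, Expr.eval]
  have e22 : s₁.reg 22 = (D.table k p q).1 := by
    simp only [hs₁, run, Expr.eval, State.setReg_reg, State.setReg_arr, h10, h11, r1, r2, r3,
      ↓reduceIte, Nat.reduceEqDiff]
  have st₁ : D.Stored (s₁.arr 15) (s₁.arr 16) (D.addr (k + 1) p q) := by
    rw [hF₁.arr 15 rfl, hF₁.arr 16 rfl]; exact hst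
  have t1 := h₁.ready.t p hp
  have t2 := h₁.ready.t q hq
  have t3 := h₁.r
  suffices H : Ends (.ifLe (add (read 11 (reg 10)) (const 1)) (reg 24)
      (.ifLe (reg 24) (read 11 (reg 11)) (.assign 22 (reg 3) ;; forLt 13 33 scanStep) .skip) .skip)
      s₁ (D.size * 70 + 60) fun s' => s'.reg 22 = (D.table (k + 1) p q).1 ∧
        s'.reg 23 = (D.table (k + 1) p q).2 by
    refine H.imp fun s₂ hF₂ ⟨e22, e23⟩ => (Ends.straight rfl ?_).mono (by decide)
    have e35' := (hF₂.reg 35 rfl).trans e35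
    have st₂ : D.Stored (s₂.arr 15) (s₂.arr 16) (D.addr (k + 1) p q) := by
      rw [hF₂.arr 15 rfl, hF₂.arr 16 rfl]; exact st₁
    simp only [run, Expr.eval, State.setReg_reg, State.setReg_arr, State.setArr_arr,
      State.setArr_reg, e35', e22, e23, ↓reduceIte, Nat.reduceEqDiff, true_and]
    refine st₂.push hp hq rfl (fun i hi => Function.update_of_ne hi _ _)
      (fun _ => Function.update_self _ _ _)
  refine Ends.mono (Ends.ifLe (B₁ := D.size * 70 + 30) (B₂ := 1) (fun c1 => ?_) fun c1 => ?_)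
    (by simp only [Expr.steps]; omega)
  · refine Ends.mono (Ends.ifLe (B₁ := D.size * 70 + 12) (B₂ := 1) (fun c2 => ?_) fun c2 => ?_)
      (by simp only [Expr.steps]; omega)
    · simp only [Expr.eval, e10, e11, t1, t2, t3] at c1 c2
      refine Ends.mono (Ends.seq (B₁ := 2) (B₂ := D.size * 70 + 10)
        ((Ends.straight rfl ?_).mono (by decide))) (by omega)
      rw [D.table_succ ⟨by omega, c2⟩]
      have hF₂ : Frame _ s₁ ((Cmd.assign 22 (reg 3)).run s₁) := Frame.run rfl s₁
      refine scanLoop_ends (h₁.frame hF₂ rfl rfl rfl rfl rfl) hp hq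
        ((hF₂.reg 11 rfl).trans e11) ((hF₂.reg 37 rfl).trans e37) ?_
        ((hF₂.reg 23 rfl).trans e23) (X := D.addr (k + 1) p q) ?_ hX
      · simp [run, Expr.eval, h₁.ready.top]
      · exact st₁
    · simp only [Expr.eval, e10, e11, t1, t2, t3] at c1 c2
      refine (Ends.straight rfl ?_).mono (by decide)
      rw [D.table_succ_of_not (by omega)]
      exact ⟨e22, by simp [run, e23]⟩
  · simp only [Expr.eval, e10, t1, t3] at c1
    refine (Ends.straight rfl ?_).mono (by decide)
    rw [D.table_succ_of_not (by omega)]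
    exact ⟨e22, by simp [run, e23]⟩

theorem levelCmd_ends {D : SlotData} {I : Instance} {e : Equiv.Perm (Fin I.n)} {s : State}
    {k : ℕ} (h : Ready D I e s) (hk : k < I.n) (h12 : s.reg 12 = k)
    (h36 : s.reg 36 = (k : ℤ) * ((D.size : ℤ) * D.size)) (h35 : s.reg 35 = D.addr (k + 1) 0 0)
    (hst : D.Stored (s.arr 15) (s.arr 16) (D.addr (k + 1) 0 0)) :
    Ends levelCmd s (D.size * (D.size * (D.size * 70 + 110) + 10 + 10) + 30) fun s' =>
      s'.reg 36 = ((k + 1 : ℕ) : ℤ) * ((D.size : ℤ) * D.size) ∧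
      s'.reg 35 = D.addr (k + 2) 0 0 ∧
      D.Stored (s'.arr 15) (s'.arr 16) (D.addr (k + 2) 0 0) := by
  refine Ends.mono (Ends.seq (B₁ := 10) ((Ends.straight rfl (Ends.seq (B₂ := 4) (Ends.forLt D.size
    (fun p s' => s'.reg 35 = D.addr (k + 1) p 0 ∧
      D.Stored (s'.arr 15) (s'.arr 16) (D.addr (k + 1) p 0))
    (by simpa [run] using h.size) rfl rfl (B := D.size * (D.size * 70 + 110) + 10)
    ?_ ?_ ?_))).mono (by decide))) (by omega)
  · simpa [run] using ⟨h35, hst⟩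
  · intro p hp s₁ hF₁ hp₁ h33 ⟨hw, hst⟩
    have hF₀ : Frame _ s ((.assign 24 (read 5 (reg 12)) ;; .assign 25 (read 6 (reg 12)) : Cmd).run s)
      := Frame.run rfl s
    have h₀ : AtEntry D I e k ((.assign 24 (read 5 (reg 12)) ;;
        .assign 25 (read 6 (reg 12)) : Cmd).run s) :=
      ⟨h.frame hF₀ rfl rfl, hk, by simp [run, Expr.eval, h12, h.r k hk],
        by simp [run, Expr.eval, h12, h.d k hk], (hF₀.reg 36 rfl).trans h36⟩
    have h₁ := h₀.frame hF₁ rfl rfl rfl rfl rfl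
    refine Ends.forLt D.size (fun q s' => s'.reg 35 = D.addr (k + 1) p q ∧
      D.Stored (s'.arr 15) (s'.arr 16) (D.addr (k + 1) p q)) h33 rfl rfl
      (B := D.size * 70 + 100) ?_ ?_ ?_
    · simpa using ⟨hw, hst⟩
    · intro q hq s₂ hF₂ hq₂ h33' ⟨hw, hst⟩
      refine (entryCmd_ends (h₁.frame hF₂ rfl rfl rfl rfl rfl) hp hq
        ((hF₂.reg 10 rfl).trans hp₁) hq₂ hw hst).imp fun s₃ _ ⟨a1, a2⟩ => ?_
      simpa using ⟨a1, a2⟩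
    · intro s₃ hF₃ ⟨hw, hst⟩
      have : D.addr (k + 1) (p + 1) 0 = D.addr (k + 1) p D.size := by
        simp [SlotData.addr, Nat.succ_mul, Nat.add_assoc]
      rw [this]
      simpa using ⟨hw, hst⟩
  · intro s₁ hF₁ ⟨hw, hst⟩
    have : D.addr (k + 1) D.size 0 = D.addr (k + 2) 0 0 := by
      simp [SlotData.addr, Nat.succ_mul, Nat.add_assoc]
    rw [this] at hw hst
    refine (Ends.straight rfl ?_).mono (by decide)
    have a36 : s₁.reg 36 = (k : ℤ) * ((D.size : ℤ) * D.size) := (hF₁.reg 36 rfl).trans h36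
    have a34 : s₁.reg 34 = (D.size : ℤ) * D.size := (hF₁.reg 34 rfl).trans h.sq
    refine ⟨?_, by simpa [run] using hw, by simpa [run] using hst⟩
    simp [run, Expr.eval, a36, a34]; ring

/-- The whole table is computed. -/
theorem tableCmd_ends {D : SlotData} {I : Instance} {e : Equiv.Perm (Fin I.n)} {s : State}
    (h : Ready D I e s) (h35 : s.reg 35 = (D.size * D.size : ℕ))
    (hst : D.Stored (s.arr 15) (s.arr 16) (D.size * D.size)) :
    Ends tableCmd s (I.n * (D.size * (D.size * (D.size * 70 + 110) + 10 + 10) + 30 + 10) + 12) fun s' =>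
      Ready D I e s' ∧ s'.reg 36 = (I.n : ℤ) * ((D.size : ℤ) * D.size) ∧
      D.Stored (s'.arr 15) (s'.arr 16) ((I.n + 1) * (D.size * D.size)) := by
  have h₀ : Ready D I e ((Cmd.assign 36 (const 0)).run s) := h.frame (Frame.run rfl s) rfl rfl
  have haddr : ∀ k, D.addr k 0 0 = k * (D.size * D.size) := by simp [SlotData.addr]
  refine Ends.mono (Ends.seq (B₁ := 2) ((Ends.straight rfl (Ends.forLt I.n
    (fun k s' => s'.reg 36 = (k : ℤ) * ((D.size : ℤ) * D.size) ∧
      s'.reg 35 = D.addr (k + 1) 0 0 ∧ D.Stored (s'.arr 15) (s'.arr 16) (D.addr (k + 1) 0 0))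
    h₀.n rfl rfl (B := D.size * (D.size * (D.size * 70 + 110) + 10 + 10) + 30)
    ?_ ?_ ?_)).mono (by decide))) (by omega)
  · rw [haddr]
    simpa [run, Expr.eval] using ⟨h35, hst⟩
  · intro k hk s₁ hF₁ hk₁ hn₁ ⟨a1, a2, a3⟩
    have h₁ : Ready D I e s₁ := h₀.frame hF₁ rfl rfl
    refine (levelCmd_ends h₁ hk hk₁ a1 a2 a3).imp fun s₂ _ ⟨b1, b2, b3⟩ => ?_
    simpa using ⟨b1, b2, b3⟩
  · intro s₁ hF₁ ⟨a1, a2, a3⟩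
    exact ⟨h₀.frame hF₁ rfl rfl, a1, haddr _ ▸ a3⟩

/-! ## Reading off the schedule -/

/-- The default choice `0` is in range as well, so the walk may look up the recorded slot whatever
the value of the entry. -/
theorem SlotData.table_snd_lt (D : SlotData) (h : 0 < D.size) (k p q : ℕ) :
    (D.table k p q).2 < D.size := by
  cases k with
  | zero => exact h
  | succ k =>
    rw [SlotData.table]; split_ifs
    · have key : ∀ (ok : ℕ → Prop) (val : ℕ → ℤ) (top : ℤ) (N : ℕ), 0 < N →
          (scan ok val top N).2 < N := by
        intro ok val top N hN
        induction N with
        | zero => omega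
        | succ m ih =>
          rw [scan]; split_ifs
          · exact Nat.lt_succ_self m
          · rcases Nat.eq_zero_or_pos m with rfl | hm
            · exact Nat.one_pos
            · exact (ih hm).trans (Nat.lt_succ_self m)
      exact key _ _ _ _ h
    · exact h

/-- One step from the table entry of level `24` plus one and the slots `20` and `21` towards the
slot of job `10`. -/
def walkStep : Cmd :=
  .assign 23 (read 16 (add (add (reg 37) (read 14 (reg 20))) (reg 21))) ;;
  .ifLe (reg 10) (reg 24)
    (.ifLe (add (read 11 (reg 20)) (const 1)) (read 5 (reg 24))
      (.ifLe (read 5 (reg 24)) (read 11 (reg 21))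
        (.ifLe (reg 24) (reg 10) (.assign 22 (reg 23))
          (.ifLe (read 5 (reg 10)) (read 11 (reg 23)) (.assign 21 (reg 23)) (.assign 20 (reg 23))))
        .skip) .skip) .skip ;;
  .assign 37 (sub (reg 37) (reg 34)) ;;
  .assign 24 (sub (reg 24) (const 1))

def walkInit : Cmd :=
  .assign 20 (const 0) ;; .assign 21 (const 1) ;; .assign 37 (reg 36) ;;
  .assign 24 (sub (reg 0) (const 1))

/-- Store the slots of all jobs in array `17`. -/
def placeCmd : Cmd :=
  forLt 10 0 (walkInit ;; forLt 11 0 walkStep ;; .write 17 (reg 10) (reg 22))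

/-- The loop unrolls the recursion of `place` one level per round. As long as the level exceeds `i`,
the release date of job `i` stays in the current window, so the branch for `i = k` is certain to be
taken at its level; afterwards register `22` is never touched again. -/
theorem walk_ends {D : SlotData} {I : Instance} {e : Equiv.Perm (Fin I.n)} {s : State} {i : ℕ}
    (h : Ready D I e s) (hi : i < I.n) (hsize : 2 ≤ D.size)
    (h01 : ∀ k < I.n, D.t 0 < D.r k ∧ D.r k ≤ D.t 1)
    (hst : D.Stored (s.arr 15) (s.arr 16) ((I.n + 1) * (D.size * D.size)))
    (h10 : s.reg 10 = i) (h20 : s.reg 20 = 0) (h21 : s.reg 21 = 1)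
    (h37 : s.reg 37 = (I.n : ℤ) * ((D.size : ℤ) * D.size)) (h24 : s.reg 24 = I.n - 1) :
    Ends (forLt 11 0 walkStep) s (I.n * 90 + 10) fun s' => s'.reg 22 = D.place i I.n 0 1 := by
  refine Ends.forLt I.n (fun x s' => ∃ L : ℕ, L + x = I.n ∧ s'.reg 24 = (L : ℤ) - 1 ∧
    s'.reg 37 = (L : ℤ) * ((D.size : ℤ) * D.size) ∧
    (i < L → ∃ p q : ℕ, s'.reg 20 = p ∧ s'.reg 21 = q ∧ p < D.size ∧ q < D.size ∧
      D.t p < D.r i ∧ D.r i ≤ D.t q ∧ D.place i L p q = D.place i I.n 0 1) ∧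
    (L ≤ i → s'.reg 22 = D.place i I.n 0 1)) h.n rfl rfl (B := 80) ?_ ?_ ?_
  · refine ⟨I.n, rfl, by simp [h24], by simp [h37], fun _ => ⟨0, 1, by simp [h20], by simp [h21],
      by omega, by omega, (h01 i hi).1, (h01 i hi).2, rfl⟩, fun h => absurd hi (not_lt.2 h)⟩
  · rintro x hx s₁ hF hx₁ hn₁ ⟨L, hL, i24, i37, iw, id⟩
    obtain ⟨k, rfl⟩ : ∃ k, L = k + 1 := ⟨L - 1, by omega⟩
    have h₁ := h.frame hF rfl rfl
    have e10 : s₁.reg 10 = i := (hF.reg 10 rfl).trans h10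
    have st₁ : D.Stored (s₁.arr 15) (s₁.arr 16) ((I.n + 1) * (D.size * D.size)) := by
      rw [hF.arr 15 rfl, hF.arr 16 rfl]; exact hst
    have e34 := h₁.sq
    have e24 : s₁.reg 24 = (k : ℤ) := by rw [i24]; push_cast; ring
    have e37 : ((k + 1 : ℕ) : ℤ) * ((D.size : ℤ) * D.size) - (D.size : ℤ) * D.size =
      (k : ℤ) * ((D.size : ℤ) * D.size) := by push_cast; ring
    refine (Ends.straight rfl ?_).mono (by decide)
    refine ⟨k, by omega, ?_⟩
    by_cases c1 : i ≤ k
    · obtain ⟨p, q, e20, e21, hp, hq, htp, htq, hpl⟩ := iw (by omega)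
      have c1' : (i : ℤ) ≤ k := by exact_mod_cast c1
      have erow := h₁.row p hp
      have em : s₁.arr 16 (((k + 1 : ℕ) : ℤ) * ((D.size : ℤ) * D.size) + (p : ℤ) * D.size + q)
          = (D.table (k + 1) p q).2 := by
        have hlt : D.addr (k + 1) p q < (I.n + 1) * (D.size * D.size) :=
          (SlotData.addr_lt hp hq).trans_le (Nat.mul_le_mul_right _ (by omega))
        rw [← (st₁ (k + 1) p q hp hq hlt).2 (by omega), SlotData.addr]
        push_cast
        rfl
      have hm := D.table_snd_lt (by omega) (k + 1) p q
      set m := (D.table (k + 1) p q).2 with hmdef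
      have etp := h₁.t p hp
      have etq := h₁.t q hq
      have etm := h₁.t m hm
      have erk := h₁.r k (by omega)
      have eri := h₁.r i hi
      rw [SlotData.place] at hpl
      by_cases hik : i = k
      · subst hik
        have c2 : D.t p + 1 ≤ D.r i := htp
        rw [if_pos ⟨htp, htq⟩, if_pos rfl] at hpl
        simp only [walkStep, run, Expr.eval, State.setReg_reg, State.setReg_arr, e10, e20, e21,
          e24, i37, e37, e34, erow, em, etp, etq, etm, erk, eri, le_refl, c2, htq, ↓reduceIte,
          Nat.reduceEqDiff, true_and]
        exact ⟨fun h => absurd h (lt_irrefl _), fun _ => by rw [← hpl]⟩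
      · have c3 : ¬ (k : ℤ) ≤ i := by omega
        by_cases c4 : D.t p < D.r k ∧ D.r k ≤ D.t q
        · have c2 : D.t p + 1 ≤ D.r k := c4.1
          have c5 := c4.2
          rw [if_pos c4, if_neg hik] at hpl
          by_cases c6 : D.r i ≤ D.t m
          · rw [if_pos c6] at hpl
            simp only [walkStep, run, Expr.eval, State.setReg_reg, State.setReg_arr, e10, e20, e21,
              e24, i37, e37, e34, erow, em, etp, etq, etm, erk, eri, c1', c2, c3, c5, c6,
              ↓reduceIte, Nat.reduceEqDiff, true_and]
            exact ⟨fun _ => ⟨p, m, rfl, rfl, hp, hm, htp, c6, hpl⟩, fun h => by omega⟩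
          · rw [if_neg c6] at hpl
            simp only [walkStep, run, Expr.eval, State.setReg_reg, State.setReg_arr, e10, e20, e21,
              e24, i37, e37, e34, erow, em, etp, etq, etm, erk, eri, c1', c2, c3, c5, c6,
              ↓reduceIte, Nat.reduceEqDiff, true_and]
            exact ⟨fun _ => ⟨m, q, rfl, rfl, hm, hq, by omega, htq, hpl⟩, fun h => by omega⟩
        · rw [if_neg c4] at hpl
          by_cases c2 : D.t p + 1 ≤ D.r k
          · have c5 : ¬ D.r k ≤ D.t q := fun c5 => c4 ⟨c2, c5⟩
            simp only [walkStep, run, Expr.eval, State.setReg_reg, State.setReg_arr, e10, e20, e21,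
              e24, i37, e37, e34, erow, em, etp, etq, etm, erk, eri, c1', c2, c3, c5,
              ↓reduceIte, Nat.reduceEqDiff, true_and]
            exact ⟨fun _ => ⟨p, q, rfl, rfl, hp, hq, htp, htq, hpl⟩, fun h => by omega⟩
          · simp only [walkStep, run, Expr.eval, State.setReg_reg, State.setReg_arr, e10, e20, e21,
              e24, i37, e37, e34, erow, em, etp, etq, etm, erk, eri, c1', c2, c3,
              ↓reduceIte, Nat.reduceEqDiff, true_and]
            exact ⟨fun _ => ⟨p, q, rfl, rfl, hp, hq, htp, htq, hpl⟩, fun h => by omega⟩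
    · have c1' : ¬ (i : ℤ) ≤ k := by exact_mod_cast c1
      have e22 := id (by omega)
      simp only [walkStep, run, Expr.eval, State.setReg_reg, State.setReg_arr, e10,
        e24, i37, e37, e34, e22, c1', ↓reduceIte, Nat.reduceEqDiff, true_and]
      exact ⟨fun h => by omega, fun _ => trivial⟩
  · rintro s' hF ⟨L, hL, -, -, -, id⟩
    exact id (by omega)

theorem placeCmd_ends {D : SlotData} {I : Instance} {e : Equiv.Perm (Fin I.n)} {s : State}
    (h : Ready D I e s) (hsize : 2 ≤ D.size)
    (h01 : ∀ k < I.n, D.t 0 < D.r k ∧ D.r k ≤ D.t 1)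
    (hst : D.Stored (s.arr 15) (s.arr 16) ((I.n + 1) * (D.size * D.size)))
    (h36 : s.reg 36 = (I.n : ℤ) * ((D.size : ℤ) * D.size)) :
    Ends placeCmd s (I.n * (I.n * 90 + 10 + 30) + 10) fun s' =>
      Ready D I e s' ∧ ∀ i < I.n, s'.arr 17 (i : ℕ) = D.place i I.n 0 1 := by
  refine Ends.forLt I.n (fun x s' => ∀ i < x, s'.arr 17 (i : ℕ) = D.place i I.n 0 1) h.n rfl rfl
    (B := I.n * 90 + 10 + 20) (by simp) ?_ ?_
  · intro i hi s₁ hF₁ hi₁ hn₁ hI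
    have hF₂ : Frame _ s₁ (walkInit.run s₁) := Frame.run rfl s₁
    have h₁ := h.frame hF₁ rfl rfl
    have h₂ := h₁.frame hF₂ rfl rfl
    have e36 := (hF₁.reg 36 rfl).trans h36
    have e0 := h₁.n
    refine Ends.mono (Ends.seq ((Ends.straight rfl (Ends.seq (B₂ := 6)
      (walk_ends h₂ hi hsize h01 ?_ ((hF₂.reg 10 rfl).trans hi₁) ?_ ?_ ?_ ?_ |>.imp
        fun s₃ hF₃ e22 => ?_))).mono (B₂ := 10) (by decide))) (by omega)
    · rw [hF₂.arr 15 rfl, hF₂.arr 16 rfl, hF₁.arr 15 rfl, hF₁.arr 16 rfl]; exact hst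
    · simp [walkInit, run, Expr.eval]
    · simp [walkInit, run, Expr.eval]
    · simp [walkInit, run, Expr.eval, e36]
    · simp [walkInit, run, Expr.eval, e0]
    · refine (Ends.straight rfl ?_).mono (by decide)
      have e10 : s₃.reg 10 = i := by rw [hF₃.reg 10 rfl, hF₂.reg 10 rfl, hi₁]
      have e17 : s₃.arr 17 = s₁.arr 17 := by rw [hF₃.arr 17 rfl, hF₂.arr 17 rfl]
      intro j hj
      simp only [run, Expr.eval, State.setReg_arr, State.setArr_arr, e10, e22, e17, ↓reduceIte]
      rcases Nat.lt_succ_iff_lt_or_eq.1 hj with h1 | rfl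
      · rw [Function.update_of_ne (by exact_mod_cast h1.ne)]; exact hI j h1
      · rw [Function.update_self]
  · intro s' hF hI
    exact ⟨h.frame hF rfl rfl, hI⟩

/-! ### Output of the calibrations and of the answer -/

/-- Clear register `22` if the slot of job `11` is a later slot of the calibration of slot `20`. -/
def lastStep : Cmd :=
  .assign 21 (read 17 (reg 11)) ;;
  .ifLe (add (read 11 (reg 20)) (const 1)) (read 11 (reg 21))
    (.ifLe (read 10 (reg 20)) (read 10 (reg 21))
      (.ifLe (read 10 (reg 21)) (read 10 (reg 20)) (.assign 22 (const 0)) .skip) .skip) .skip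

def calPush : Cmd :=
  .ifLe (const 1) (reg 22)
    (.write 1 (reg 38) (read 10 (reg 20)) ;; .write 2 (reg 38) (read 13 (reg 20)) ;;
     .assign 39 (add (reg 39) (read 12 (reg 20))) ;; .assign 38 (add (reg 38) (const 1))) .skip

/-- Output the calibrations. -/
def calsCmd : Cmd :=
  (.assign 38 (const 0) ;; .assign 39 (const 0)) ;;
  forLt 10 0 ((.assign 20 (read 17 (reg 10)) ;; .assign 22 (const 1)) ;;
    forLt 11 0 lastStep ;; calPush)

theorem lastLoop_ends {D : SlotData} {I : Instance} {e : Equiv.Perm (Fin I.n)} {s : State}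
    {σ : ℕ → ℕ} {p : ℕ} (h : Ready D I e s) (hσ : ∀ j < I.n, σ j < D.size) (hp : p < D.size)
    (h17 : ∀ j < I.n, s.arr 17 j = σ j) (h20 : s.reg 20 = p) (h22 : s.reg 22 = 1) :
    Ends (forLt 11 0 lastStep) s (I.n * 50 + 10) fun s' =>
      (s'.reg 22 = 1 ∧ ∀ j < I.n, D.t p < D.t (σ j) → D.c (σ j) ≠ D.c p) ∨
      (s'.reg 22 = 0 ∧ ∃ j < I.n, D.t p < D.t (σ j) ∧ D.c (σ j) = D.c p) := by
  refine Ends.forLt I.n (fun x s' =>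
      (s'.reg 22 = 1 ∧ ∀ j < x, D.t p < D.t (σ j) → D.c (σ j) ≠ D.c p) ∨
      (s'.reg 22 = 0 ∧ ∃ j < x, D.t p < D.t (σ j) ∧ D.c (σ j) = D.c p)) h.n rfl rfl (B := 40)
    (by simp [h22]) ?_ fun _ _ h => h
  intro j hj s₁ hF hj₁ hn₁ hI
  have h₁ := h.frame hF rfl rfl
  have e20 := (hF.reg 20 rfl).trans h20
  have e17 : s₁.arr 17 j = σ j := by rw [hF.arr 17 rfl]; exact h17 j hj
  have etp := h₁.t p hp
  have ecp := h₁.c p hp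
  have etj := h₁.t _ (hσ j hj)
  have ecj := h₁.c _ (hσ j hj)
  refine (Ends.straight rfl ?_).mono (by decide)
  by_cases hc : D.t p < D.t (σ j) ∧ D.c (σ j) = D.c p
  · right
    have c1 : D.t p + 1 ≤ D.t (σ j) := hc.1
    refine ⟨?_, j, Nat.lt_succ_self j, hc⟩
    simp only [lastStep, run, Expr.eval, State.setReg_reg, State.setReg_arr, hj₁, e20, e17, etp,
      ecp, etj, ecj, c1, hc.2, le_refl, ↓reduceIte, Nat.reduceEqDiff]
  · have key : (lastStep.run s₁).reg 22 = s₁.reg 22 := by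
      by_cases c1 : D.t p + 1 ≤ D.t (σ j)
      · by_cases c2 : D.c p ≤ D.c (σ j)
        · have c3 : ¬ D.c (σ j) ≤ D.c p := fun c3 => hc ⟨c1, le_antisymm c3 c2⟩
          simp only [lastStep, run, Expr.eval, State.setReg_reg, State.setReg_arr, hj₁, e20, e17,
            etp, ecp, etj, ecj, c1, c2, c3, ↓reduceIte, Nat.reduceEqDiff]
        · simp only [lastStep, run, Expr.eval, State.setReg_reg, State.setReg_arr, hj₁, e20, e17,
            etp, ecp, etj, ecj, c1, c2, ↓reduceIte, Nat.reduceEqDiff]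
      · simp only [lastStep, run, Expr.eval, State.setReg_reg, State.setReg_arr, hj₁, e20, e17,
          etp, ecp, etj, ecj, c1, ↓reduceIte, Nat.reduceEqDiff]
    simp only [State.setReg_reg, key, Nat.reduceEqDiff, ↓reduceIte]
    rcases hI with ⟨h1, h2⟩ | ⟨h1, j', h2, h3⟩
    · refine .inl ⟨h1, fun x hx => ?_⟩
      rcases Nat.lt_succ_iff_lt_or_eq.1 hx with h4 | rfl
      · exact h2 x h4
      · exact fun h5 h6 => hc ⟨h5, h6⟩
    · exact .inr ⟨h1, j', h2.trans (Nat.lt_succ_self j), h3⟩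

/-- The arrays `V` and `A` hold the starting times and the types of the calibrations in a list. -/
def CalsStored {I : Instance} (V A : ℤ → ℤ) (L : List (Cal I)) : Prop :=
  ∀ x (h : x < L.length), V x = L[x].start ∧ A x = (L[x].kind : ℕ)

theorem CalsStored.push {I : Instance} {V A : ℤ → ℤ} {L : List (Cal I)} (h : CalsStored V A L)
    {c : Cal I} {m : ℤ} (hm : m = L.length) {v a : ℤ} (hv : v = c.start) (ha : a = (c.kind : ℕ)) :
    CalsStored (Function.update V m v) (Function.update A m a) (L ++ [c]) := by
  subst hm hv ha
  intro x hx
  rw [List.length_append, List.length_singleton] at hx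
  rcases Nat.lt_succ_iff_lt_or_eq.1 hx with h1 | rfl
  · rw [Function.update_of_ne (by exact_mod_cast h1.ne),
      Function.update_of_ne (by exact_mod_cast h1.ne), List.getElem_append_left h1]
    exact h x h1
  · simp

open Classical in
theorem calsCmd_ends {D : SlotData} {ρ : StartRule} {I : Instance} {e : Equiv.Perm (Fin I.n)}
    {s : State} (hM : D.Models ρ I e) (h : Ready D I e s) (hK : 0 < I.K)
    (hlt : (D.table I.n 0 1).1 < D.top)
    (h17 : ∀ i < I.n, s.arr 17 (i : ℕ) = D.place i I.n 0 1) :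
    Ends calsCmd s (I.n * (I.n * 50 + 10 + 50 + 10) + 20) fun s' =>
      Ready D I e s' ∧
      CalsStored (s'.arr 1) (s'.arr 2) (SlotData.Models.schedule D I hK e).cals ∧
      s'.reg 38 = (SlotData.Models.schedule D I hK e).cals.length ∧
      s'.reg 39 = (SlotData.Models.schedule D I hK e).totalCost := by
  have hF₀ : Frame _ s ((.assign 38 (const 0) ;; .assign 39 (const 0) : Cmd).run s) :=
    Frame.run rfl s
  have h₀ := h.frame hF₀ rfl rfl
  let mk : Fin I.n → Cal I := fun i => ⟨D.c (D.place i I.n 0 1),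
    if h : (I.bestKind D.top (D.t (D.place i I.n 0 1) - D.c (D.place i I.n 0 1))).2 < I.K
      then ⟨_, h⟩ else ⟨0, hK⟩⟩
  let last : Fin I.n → Prop := IsLast (fun i : Fin I.n => D.c (D.place i I.n 0 1))
      (fun i => D.t (D.place i I.n 0 1))
  -- The calibrations contributed by the first `x` jobs, in the order in which `scheduleOf` lists
  -- them; the output arrays are compared with this prefix.
  let L : ℕ → List (Cal I) := fun x =>
    (((List.finRange I.n).take x).filter fun i => decide (last i)).map mk
  have hLn : L I.n = (SlotData.Models.schedule D I hK e).cals := by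
    have : (List.finRange I.n).take I.n = List.finRange I.n := by
      rw [List.take_of_length_le (by simp)]
    simp only [L, this]
    rfl
  have hLs : ∀ i : Fin I.n, L (i + 1) = if last i then L i ++ [mk i] else L i := by
    intro i
    simp only [L]
    rw [List.take_add_one, List.getElem?_eq_getElem (by simp), List.getElem_finRange]
    by_cases hl : last i <;> simp [hl]
  refine Ends.mono (Ends.seq (B₁ := 10) ((Ends.straight rfl (Ends.forLt I.n (fun x s' =>
      CalsStored (s'.arr 1) (s'.arr 2) (L x) ∧ s'.reg 38 = (L x).length ∧
      s'.reg 39 = (((L x).map fun c => I.cost c.kind).sum : ℕ)) h₀.n rfl rfl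
      (B := I.n * 50 + 10 + 50)
      ?_ ?_ ?_)).mono (by decide))) (by omega)
  · simp [L, CalsStored, run, Expr.eval]
  · intro i hi s₁ hF₁ hi₁ hn₁ ⟨j1, j2, j3⟩
    have h₁ := h₀.frame hF₁ rfl rfl
    have hF₂ : Frame _ s₁ ((.assign 20 (read 17 (reg 10)) ;; .assign 22 (const 1) : Cmd).run s₁) :=
      Frame.run rfl s₁
    have h₂ := h₁.frame hF₂ rfl rfl
    have e17 : ∀ i < I.n, s₁.arr 17 (i : ℕ) = D.place i I.n 0 1 := by
      rw [hF₁.arr 17 rfl]; exact h17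
    obtain ⟨hp2, hp⟩ := hM.place_mem hlt i hi
    refine Ends.mono (Ends.seq (B₁ := 10) ((Ends.straight rfl (Ends.seq (B₂ := 40)
      (lastLoop_ends (σ := fun i => D.place i I.n 0 1) (p := D.place i I.n 0 1) h₂
        (fun j hj => (hM.place_mem hlt j hj).2) hp e17 ?_ ?_ |>.imp
        fun s₃ hF₃ e22 => ?_))).mono (by decide))) (by omega)
    · simp [run, Expr.eval, hi₁, e17 i hi]
    · simp [run, Expr.eval]
    · have h₃ := h₂.frame hF₃ rfl rfl
      refine (Ends.straight rfl ?_).mono (by decide)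
      rw [hLs ⟨i, hi⟩]
      have j1' : CalsStored (s₃.arr 1) (s₃.arr 2) (L i) := by
        rw [hF₃.arr 1 rfl, hF₃.arr 2 rfl, hF₂.arr 1 rfl, hF₂.arr 2 rfl]; exact j1
      have j2' : s₃.reg 38 = (L i).length := by rw [hF₃.reg 38 rfl, hF₂.reg 38 rfl, j2]
      have j3' : s₃.reg 39 = (((L i).map fun c => I.cost c.kind).sum : ℕ) := by
        rw [hF₃.reg 39 rfl, hF₂.reg 39 rfl, j3]
      have e20 : s₃.reg 20 = D.place i I.n 0 1 := by
        rw [hF₃.reg 20 rfl]; simp [run, Expr.eval, hi₁, e17 i hi]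
      have ec := h₃.c _ hp
      have eG := h₃.G _ hp
      have eH := h₃.kind _ hp2 hp
      rcases e22 with ⟨e22, hl⟩ | ⟨e22, j, hj, hj1, hj2⟩
      · have hlast : last ⟨i, hi⟩ := fun j hj => hl j j.2 hj
        obtain ⟨hk, -, hcost⟩ := Instance.bestKind_spec (hM.bestKind_lt_top hlt hlast)
        have hmk : (mk ⟨i, hi⟩).kind = ⟨_, hk⟩ := dif_pos hk
        rw [if_pos hlast]
        rw [hM.G, if_neg (by omega)] at eG
        simp only [calPush, run, Expr.eval, State.setReg_reg, State.setReg_arr, State.setArr_arr,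
          State.setArr_reg, e20, e22, ec, eG, eH, j2', j3', le_refl, ↓reduceIte, Nat.reduceEqDiff]
        refine ⟨j1'.push rfl rfl (by rw [hmk]), by simp, ?_⟩
        rw [List.map_append, List.sum_append]
        simp only [List.map_cons, List.map_nil, List.sum_cons, List.sum_nil, hmk]
        push_cast
        rw [hcost]
        ring
      · have hlast : ¬ last ⟨i, hi⟩ := fun hl => hl ⟨j, hj⟩ hj1 hj2
        rw [if_neg hlast]
        have c1 : ¬ (1 : ℤ) ≤ 0 := by norm_num
        simp only [calPush, run, Expr.eval, State.setReg_reg, State.setReg_arr, e22, c1, ↓reduceIte,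
          Nat.reduceEqDiff]
        exact ⟨j1', j2', j3'⟩
  · intro s₁ hF₁ ⟨j1, j2, j3⟩
    rw [hLn] at j1 j2 j3
    exact ⟨h₀.frame hF₁ rfl rfl, j1, j2, j3⟩

/-- Output the starting times of the jobs. -/
def jobsCmd : Cmd := forLt 10 0 (.write 0 (reg 10) (read 11 (read 17 (read 4 (reg 10)))))

/-- Offset 1 addresses the entry between the sentinels `0` and `1`. The output overwrites input
arrays, which is harmless since only copies are read from here on; register `0` still bounds the
loops and is set at the very end. -/
def answerCmd : Cmd :=
  .assign 22 (read 15 (add (reg 36) (const 1))) ;;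
  .ifLe (reg 3) (reg 22) (.assign 0 (const 0))
    (placeCmd ;; calsCmd ;; jobsCmd ;;
     (.assign 0 (const 1) ;; .assign 1 (reg 39) ;; .assign 2 (reg 38)))

theorem jobsCmd_ends {D : SlotData} {I : Instance} {e : Equiv.Perm (Fin I.n)} {s : State}
    {σ : ℕ → ℕ} (h : Ready D I e s) (hσ : ∀ j < I.n, σ j < D.size)
    (h17 : ∀ i < I.n, s.arr 17 (i : ℕ) = σ i) :
    Ends jobsCmd s (I.n * 20 + 10) fun s' =>
      ∀ j : Fin I.n, s'.arr 0 (j : ℕ) = D.t (σ (e.symm j)) := by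
  refine Ends.forLt I.n (fun x s' => ∀ j : Fin I.n, (j : ℕ) < x →
    s'.arr 0 (j : ℕ) = D.t (σ (e.symm j))) h.n rfl rfl (B := 10) (by simp) ?_
    fun s' _ h j => h j j.2
  intro i hi s₁ hF hi₁ hn₁ hI
  have h₁ := h.frame hF rfl rfl
  have e4 := h₁.pos ⟨i, hi⟩
  have e17 := h17 (e.symm ⟨i, hi⟩) (e.symm ⟨i, hi⟩).2
  rw [← hF.arr 17 rfl] at e17
  have et := h₁.t _ (hσ (e.symm ⟨i, hi⟩) (e.symm ⟨i, hi⟩).2)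
  refine (Ends.straight rfl ?_).mono (by decide)
  intro j hj
  simp only at e4
  simp only [run, Expr.eval, State.setReg_arr, State.setArr_arr, hi₁, e4, e17, et, ↓reduceIte]
  rcases Nat.lt_succ_iff_lt_or_eq.1 hj with h1 | rfl
  · rw [Function.update_of_ne (by exact_mod_cast h1.ne)]; exact hI j h1
  · rw [Function.update_self]

theorem answerCmd_ends {D : SlotData} {ρ : StartRule} {I : Instance} {e : Equiv.Perm (Fin I.n)}
    {s : State} (hM : D.Models ρ I e) (h : Ready D I e s) (hn : 1 ≤ I.n) (hK : 0 < I.K)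
    (hst : D.Stored (s.arr 15) (s.arr 16) ((I.n + 1) * (D.size * D.size)))
    (h36 : s.reg 36 = (I.n : ℤ) * ((D.size : ℤ) * D.size)) :
    Ends answerCmd s (I.n * (I.n * 200 + 200) + 200) fun s' => s'.Answers ρ I := by
  have hsize := hM.size
  have hF₁ : Frame _ s ((Cmd.assign 22 (read 15 (add (reg 36) (const 1)))).run s) := Frame.run rfl s
  have h₁ := h.frame hF₁ rfl rfl
  have e22 : ((Cmd.assign 22 (read 15 (add (reg 36) (const 1)))).run s).reg 22 =
      (D.table I.n 0 1).1 := by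
    have := hst.read (k := I.n) (p := 0) (q := 1) (by omega) (by omega) le_rfl
    simpa [run, Expr.eval, h36] using this
  have e3 := h₁.top
  have h01 : ∀ k < I.n, D.t 0 < D.r k ∧ D.r k ≤ D.t 1 := by
    intro k hk
    rw [hM.r ⟨k, hk⟩]
    exact ⟨hM.first_lt_r _, hM.r_le_last _⟩
  refine Ends.mono (Ends.seq (B₁ := 10) ((Ends.straight rfl (Ends.ifLe (B₁ := 2)
    (B₂ := (I.n * (I.n * 90 + 10 + 30) + 10) + ((I.n * (I.n * 50 + 10 + 50 + 10) + 20) +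
      ((I.n * 20 + 10) + 20))) (fun hc => ?_) fun hc => ?_)).mono (by decide))) ?_
  · simp only [Expr.eval, e22, e3] at hc
    refine (Ends.straight rfl ?_).mono (by decide)
    exact .inr ⟨hM.infeasible hn hc, by simp [run, Expr.eval]⟩
  · simp only [Expr.eval, e22, e3, not_le] at hc
    refine Ends.seq (placeCmd_ends h₁ hsize h01 hst h36 |>.imp fun s₂ hF₂ ⟨h₂, e17⟩ => ?_)
    refine Ends.seq (calsCmd_ends hM h₂ hK hc e17 |>.imp
      fun s₃ hF₃ ⟨h₃, j1, j2, j3⟩ => ?_)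
    refine Ends.seq (jobsCmd_ends (σ := fun i => D.place i I.n 0 1) h₃
      (fun j hj => (hM.place_mem hc j hj).2) (by rw [hF₃.arr 17 rfl]; exact e17) |>.imp
      fun s₄ hF₄ ej => ?_)
    refine (Ends.straight rfl ?_).mono (by decide)
    refine .inl ⟨SlotData.Models.schedule D I hK e, hM.optimal hn hK hc, ?_⟩
    have j1' : CalsStored (s₄.arr 1) (s₄.arr 2) (SlotData.Models.schedule D I hK e).cals := by
      rw [hF₄.arr 1 rfl, hF₄.arr 2 rfl]; exact j1
    refine ⟨?_, ?_, ?_, ?_, ?_, ?_⟩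
    · simp [run, Expr.eval]
    · simp [run, Expr.eval, hF₄.reg 39 rfl, j3]
    · simp [run, Expr.eval, hF₄.reg 38 rfl, j2]
    · intro j
      simp only [run, State.setReg_arr]
      rw [ej]; rfl
    · intro i
      simp only [run, State.setReg_arr]
      exact (j1' i i.2).1
    · intro i
      simp only [run, State.setReg_arr]
      exact (j1' i i.2).2
  · simp only [Expr.steps]
    nlinarith

/-! ## Preparing the data

Further registers: `4` the first release date, `5` and `6` a time before and a time after everything
else, `9` the number of jobs plus one. Arrays `0` to `3` hold the input. -/

theorem arrayOf_natCast {m : ℕ} (v : Fin m → ℤ) (j : Fin m) : arrayOf v (j : ℕ) = v j := by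
  simp [arrayOf]

/-- The memory still holds the input. -/
structure HasInput (I : Instance) (s : State) : Prop where
  n : s.reg 0 = I.n
  K : s.reg 1 = I.K
  act : s.reg 2 = I.act
  release : ∀ j : Fin I.n, s.arr 0 (j : ℕ) = I.release j
  deadline : ∀ j : Fin I.n, s.arr 1 (j : ℕ) = I.deadline j
  len : ∀ k : Fin I.K, s.arr 2 (k : ℕ) = I.len k
  cost : ∀ k : Fin I.K, s.arr 3 (k : ℕ) = I.cost k

theorem Instance.hasInput (I : Instance) : HasInput I I.input :=
  ⟨rfl, rfl, rfl, arrayOf_natCast _, arrayOf_natCast _,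
    arrayOf_natCast fun k => (I.len k : ℤ), arrayOf_natCast fun k => (I.cost k : ℤ)⟩

theorem HasInput.frame {I : Instance} {p : Cmd} {s s' : State} (h : HasInput I s)
    (hF : Frame p s s') (hr : [0, 1, 2].all (fun x => !p.regs.contains x) = true)
    (ha : [0, 1, 2, 3].all (fun x => !p.arrs.contains x) = true) : HasInput I s' := by
  simp only [List.all_cons, List.all_nil, Bool.and_true, Bool.and_eq_true,
    Bool.not_eq_true'] at hr ha
  obtain ⟨r1, r2, r3⟩ := hr
  obtain ⟨a1, a2, a3, a4⟩ := ha
  constructor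
  · rw [hF.reg _ r1]; exact h.n
  · rw [hF.reg _ r2]; exact h.K
  · rw [hF.reg _ r3]; exact h.act
  · rw [hF.arr _ a1]; exact h.release
  · rw [hF.arr _ a2]; exact h.deadline
  · rw [hF.arr _ a3]; exact h.len
  · rw [hF.arr _ a4]; exact h.cost

/-! ### Bounds -/

def boundsStep : Cmd :=
  .assign 20 (read 0 (reg 10)) ;;
  .ifLe (reg 20) (reg 4) (.assign 4 (reg 20)) .skip ;;
  .ifLe (reg 20) (reg 5) (.assign 5 (sub (reg 20) (const 1))) .skip ;;
  .ifLe (reg 6) (reg 20) (.assign 6 (add (reg 20) (const 1))) .skip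

def boundsInit : Cmd :=
  .assign 3 (const 1) ;; .assign 4 (read 0 (const 0)) ;; .assign 5 (const 0) ;;
  .assign 6 (const 0) ;; .assign 9 (add (reg 0) (const 1))

/-- Without multiplication, the number of jobs times the sum of all costs is obtained by adding
every cost once per job; the initial 1 makes the result exceed the bound. -/
def boundsCmd : Cmd :=
  boundsInit ;;
  forLt 10 0 (boundsStep ;; forLt 11 1 (.assign 3 (add (reg 3) (read 3 (reg 11)))))

/-- The result of `boundsCmd`. -/
structure Bounds (I : Instance) (s : State) : Prop where
  top : s.reg 3 = I.costBound + 1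
  first : ∃ j, s.reg 4 = I.release j
  first_le : ∀ j, s.reg 4 ≤ I.release j
  lo : ∀ j, s.reg 5 < I.release j
  hi : ∀ j, I.release j < s.reg 6

theorem boundsStep_run {s : State} {v : ℤ} (hv : s.arr 0 (s.reg 10) = v) :
    (boundsStep.run s).reg 4 = min (s.reg 4) v ∧
      (boundsStep.run s).reg 5 = min (s.reg 5) (v - 1) ∧
      (boundsStep.run s).reg 6 = max (s.reg 6) (v + 1) := by
  by_cases c1 : v ≤ s.reg 4 <;> by_cases c2 : v ≤ s.reg 5 <;> by_cases c3 : s.reg 6 ≤ v <;>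
    simp only [boundsStep, run, Expr.eval, State.setReg_reg, State.setReg_arr, hv, c1, c2, c3,
      ↓reduceIte, Nat.reduceEqDiff] <;> omega

theorem boundsCmd_ends {I : Instance} {s : State} (h : HasInput I s) (hn : 1 ≤ I.n) :
    Ends boundsCmd s (I.n * (I.K * 20 + 10 + 50 + 10) + 40) fun s' =>
      Bounds I s' ∧ s'.reg 9 = (I.n + 1 : ℕ) := by
  have hF₀ : Frame _ s (boundsInit.run s) := Frame.run rfl s
  have h₀ := h.frame hF₀ rfl rfl
  refine Ends.mono (Ends.seq (B₁ := 20) ((Ends.straight rfl (Ends.forLt I.n (fun x s' =>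
    s'.reg 3 = 1 + x * ∑ k, (I.cost k : ℤ) ∧ (∃ j, s'.reg 4 = I.release j) ∧
    (∀ j : Fin I.n, (j : ℕ) < x → s'.reg 4 ≤ I.release j ∧ s'.reg 5 < I.release j ∧
      I.release j < s'.reg 6)) h₀.n rfl rfl (B := I.K * 20 + 10 + 50)
      ?_ ?_ ?_)).mono (by decide))) (by omega)
  · refine ⟨by simp [boundsInit, run, Expr.eval], ⟨⟨0, hn⟩, ?_⟩, by simp⟩
    simpa [boundsInit, run, Expr.eval] using h.release ⟨0, hn⟩
  · rintro i hi s₁ hF₁ hi₁ hn₁ ⟨i3, ⟨j₀, i4⟩, i5⟩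
    have h₁ := h₀.frame hF₁ rfl rfl
    have hF₂ : Frame _ s₁ (boundsStep.run s₁) := Frame.run rfl s₁
    have h₂ := h₁.frame hF₂ rfl rfl
    obtain ⟨e4, e5, e6⟩ := boundsStep_run (s := s₁) (v := I.release ⟨i, hi⟩)
      (by rw [hi₁]; exact h₁.release ⟨i, hi⟩)
    refine Ends.mono (Ends.seq (B₁ := 40) ((Ends.straight rfl (Ends.forLt I.K (fun x s' =>
      s'.reg 3 = 1 + i * ∑ k, (I.cost k : ℤ) +
        ∑ k ∈ Finset.range x, if h : k < I.K then (I.cost ⟨k, h⟩ : ℤ) else 0) h₂.K rfl rfl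
      (B := 10) ?_ ?_ ?_)).mono (by decide))) (by omega)
    · simp only [State.setReg_reg, Nat.reduceEqDiff, ↓reduceIte, hF₂.reg 3 rfl, i3,
        Finset.range_zero, Finset.sum_empty, add_zero]
    · intro k hk s₃ hF₃ hk₃ hK₃ j3
      have e3 := (h₂.frame hF₃ rfl rfl).cost ⟨k, hk⟩
      simp only at e3
      refine (Ends.straight rfl ?_).mono (by decide)
      rw [Finset.sum_range_succ, dif_pos hk]
      simp only [run, Expr.eval, State.setReg_reg, hk₃, e3, j3, Nat.reduceEqDiff, ↓reduceIte]
      ring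
    · intro s₃ hF₃ j3
      rw [Finset.sum_range] at j3
      simp only [Fin.is_lt, dite_true, Fin.eta] at j3
      simp only [State.setReg_reg, Nat.reduceEqDiff, ↓reduceIte]
      rw [hF₃.reg 4 rfl, hF₃.reg 5 rfl, hF₃.reg 6 rfl, e4, e5, e6, j3]
      refine ⟨by push_cast; ring, ?_, ?_⟩
      · rcases le_total (s₁.reg 4) (I.release ⟨i, hi⟩) with h4 | h4
        · exact ⟨j₀, by rw [min_eq_left h4, i4]⟩
        · exact ⟨⟨i, hi⟩, by rw [min_eq_right h4]⟩
      · intro j hj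
        rcases Nat.lt_succ_iff_lt_or_eq.1 hj with h4 | h4
        · have := i5 j h4; omega
        · have : j = ⟨i, hi⟩ := Fin.ext h4
          subst this; omega
  · rintro s₁ hF₁ ⟨i3, i4, i5⟩
    refine ⟨⟨?_, i4, fun j => (i5 j j.2).1, fun j => (i5 j j.2).2.1, fun j => (i5 j j.2).2.2⟩, ?_⟩
    · rw [i3, Instance.costBound]; ring
    · rw [hF₁.reg 9 rfl]
      simp [boundsInit, run, Expr.eval, h.n]

/-! ### Sorting -/

/-- The order in which the jobs are sorted. -/
def Precedes (d : ℕ → ℤ) (i j : ℕ) : Prop := d i < d j ∨ d i = d j ∧ i < j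

open Classical in
/-- The number of jobs among the first `n` that precede job `j`. -/
noncomputable def rank (d : ℕ → ℤ) (n j : ℕ) : ℕ :=
  ((Finset.range n).filter fun i => Precedes d i j).card

theorem rank_succ (d : ℕ → ℤ) (n j : ℕ) [Decidable (Precedes d n j)] :
    rank d (n + 1) j = rank d n j + if Precedes d n j then 1 else 0 := by
  classical
  rw [rank, Finset.range_add_one, Finset.filter_insert]
  split_ifs with h
  · rw [Finset.card_insert_of_notMem (by simp)]; rfl
  · rfl

theorem rank_lt_rank {d : ℕ → ℤ} {n i j : ℕ} (hi : i < n) (h : Precedes d i j) :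
    rank d n i < rank d n j := by
  classical
  unfold rank
  refine Finset.card_lt_card (Finset.ssubset_iff_subset_ne.2 ⟨?_, fun heq => ?_⟩)
  · intro x hx
    rw [Finset.mem_filter] at hx ⊢
    refine ⟨hx.1, ?_⟩
    have := hx.2
    unfold Precedes at *
    omega
  · have hmem : i ∈ (Finset.range n).filter fun x => Precedes d x j :=
      Finset.mem_filter.2 ⟨Finset.mem_range.2 hi, h⟩
    rw [← heq, Finset.mem_filter] at hmem
    have := hmem.2
    unfold Precedes at this
    omega

theorem rank_lt {d : ℕ → ℤ} {n j : ℕ} (hj : j < n) : rank d n j < n := by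
  classical
  unfold rank
  conv_rhs => rw [← Finset.card_range n]
  refine Finset.card_lt_card (Finset.ssubset_iff_subset_ne.2
    ⟨Finset.filter_subset _ _, fun heq => ?_⟩)
  have hmem := Finset.mem_range.2 hj
  rw [← heq, Finset.mem_filter] at hmem
  have := hmem.2
  unfold Precedes at this
  omega

theorem rank_injOn {d : ℕ → ℤ} {n i j : ℕ} (hi : i < n) (hj : j < n)
    (h : rank d n i = rank d n j) : i = j := by
  by_contra hne
  have : Precedes d i j ∨ Precedes d j i := by unfold Precedes; omega
  rcases this with h1 | h1
  · exact (rank_lt_rank hi h1).ne h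
  · exact (rank_lt_rank hj h1).ne' h

/-- The permutation that sorts the jobs. -/
theorem exists_sort (d : ℕ → ℤ) (n : ℕ) : ∃ e : Equiv.Perm (Fin n),
    (∀ j, (e.symm j : ℕ) = rank d n j) ∧ Monotone fun k => d (e k) := by
  let f : Fin n → Fin n := fun j => ⟨rank d n j, rank_lt j.2⟩
  have hf : Function.Injective f := fun i j h =>
    Fin.ext (rank_injOn i.2 j.2 (Fin.mk.inj_iff.1 h))
  let E := Equiv.ofBijective f (Finite.injective_iff_bijective.1 hf)
  refine ⟨E.symm, fun j => rfl, fun a b hab => ?_⟩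
  by_contra hlt
  have h1 := rank_lt_rank (n := n) (E.symm b).2 (.inl (not_le.1 hlt) : Precedes d _ (E.symm a))
  have h2 : ∀ a, rank d n (E.symm a) = a := fun a => congrArg Fin.val (E.apply_symm_apply a)
  rw [h2, h2] at h1
  exact absurd hab (not_le.2 h1)

def rankStep : Cmd :=
  .ifLe (add (read 1 (reg 11)) (const 1)) (read 1 (reg 10)) (.assign 21 (add (reg 21) (const 1)))
    (.ifLe (read 1 (reg 11)) (read 1 (reg 10))
      (.ifLe (add (reg 11) (const 1)) (reg 10) (.assign 21 (add (reg 21) (const 1))) .skip) .skip)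

/-- The rank of a job is its position in sorted order, so release dates and deadlines are written
directly to their places. -/
def sortCmd : Cmd :=
  forLt 10 0 (.assign 21 (const 0) ;; forLt 11 0 rankStep ;;
    (.write 4 (reg 10) (reg 21) ;; .write 5 (reg 21) (read 0 (reg 10)) ;;
     .write 6 (reg 21) (read 1 (reg 10))))

theorem rankLoop_ends {I : Instance} {s : State} {j : ℕ} (h : HasInput I s)
    (h10 : s.reg 10 = j) (h21 : s.reg 21 = 0) :
    Ends (forLt 11 0 rankStep) s (I.n * 50 + 10) fun s' =>
      s'.reg 21 = rank (fun i => s.arr 1 i) I.n j := by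
  classical
  refine Ends.forLt I.n (fun x s' => s'.reg 21 = rank (fun i => s.arr 1 i) x j) h.n rfl rfl
    (B := 40) (by simp [rank, h21]) ?_ fun _ _ h => h
  intro i hi s₁ hF hi₁ hn₁ hI
  have e10 := (hF.reg 10 rfl).trans h10
  have e1 := hF.arr 1 rfl
  rw [rank_succ]
  refine (Ends.straight rfl ?_).mono (by decide)
  by_cases c1 : s.arr 1 i + 1 ≤ s.arr 1 j
  · have hp : Precedes (fun i => s.arr 1 i) i j := .inl c1
    simp only [rankStep, run, Expr.eval, State.setReg_reg, e10, e1, hi₁, hI, c1, hp, ↓reduceIte,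
      Nat.reduceEqDiff, Nat.cast_add, Nat.cast_one]
  · by_cases c2 : s.arr 1 i ≤ s.arr 1 j
    · by_cases c3 : (i : ℤ) + 1 ≤ j
      · have hp : Precedes (fun i => s.arr 1 i) i j :=
          .inr ⟨show s.arr 1 i = s.arr 1 j by omega, by omega⟩
        simp only [rankStep, run, Expr.eval, State.setReg_reg, e10, e1, hi₁, hI, c1, c2, c3, hp,
          ↓reduceIte, Nat.reduceEqDiff, Nat.cast_add, Nat.cast_one]
      · have hp : ¬ Precedes (fun i => s.arr 1 i) i j := by
          simp only [Precedes]; omega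
        simp only [rankStep, run, Expr.eval, State.setReg_reg, e10, e1, hi₁, hI, c1, c2, c3, hp,
          ↓reduceIte, Nat.reduceEqDiff, add_zero]
    · have hp : ¬ Precedes (fun i => s.arr 1 i) i j := by
        simp only [Precedes]; omega
      simp only [rankStep, run, Expr.eval, State.setReg_reg, e10, e1, hi₁, hI, c1, c2, hp,
        ↓reduceIte, Nat.reduceEqDiff, add_zero]

theorem sortCmd_ends {I : Instance} {s : State} (h : HasInput I s) :
    Ends sortCmd s (I.n * (I.n * 50 + 10 + 20 + 10) + 10) fun s' => ∀ j < I.n,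
      s'.arr 4 j = rank (fun i => s.arr 1 i) I.n j ∧
      s'.arr 5 (rank (fun i => s.arr 1 i) I.n j) = s.arr 0 j ∧
      s'.arr 6 (rank (fun i => s.arr 1 i) I.n j) = s.arr 1 j := by
  refine Ends.forLt I.n (fun x s' => ∀ j < x,
      s'.arr 4 j = rank (fun i => s.arr 1 i) I.n j ∧
      s'.arr 5 (rank (fun i => s.arr 1 i) I.n j) = s.arr 0 j ∧
      s'.arr 6 (rank (fun i => s.arr 1 i) I.n j) = s.arr 1 j) h.n rfl rfl
      (B := I.n * 50 + 10 + 20) (by simp) ?_ fun _ _ h => h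
  intro i hi s₁ hF₁ hi₁ hn₁ hI
  have h₁ := h.frame hF₁ rfl rfl
  have hF₂ : Frame _ s₁ ((Cmd.assign 21 (const 0)).run s₁) := Frame.run rfl s₁
  have h₂ := h₁.frame hF₂ rfl rfl
  refine Ends.mono (Ends.seq (B₁ := 2) ((Ends.straight rfl (Ends.seq (B₂ := 15)
    (rankLoop_ends h₂ ((hF₂.reg 10 rfl).trans hi₁) (by simp [run, Expr.eval]) |>.imp
    fun s₃ hF₃ e21 => ?_))).mono (by decide))) (by omega)
  refine (Ends.straight rfl ?_).mono (by decide)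
  have e10 : s₃.reg 10 = i := by rw [hF₃.reg 10 rfl, hF₂.reg 10 rfl, hi₁]
  have a0 : s₃.arr 0 = s.arr 0 := by rw [hF₃.arr 0 rfl, hF₂.arr 0 rfl, hF₁.arr 0 rfl]
  have a1 : s₃.arr 1 = s.arr 1 := by rw [hF₃.arr 1 rfl, hF₂.arr 1 rfl, hF₁.arr 1 rfl]
  have a4 : s₃.arr 4 = s₁.arr 4 := by rw [hF₃.arr 4 rfl, hF₂.arr 4 rfl]
  have a5 : s₃.arr 5 = s₁.arr 5 := by rw [hF₃.arr 5 rfl, hF₂.arr 5 rfl]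
  have a6 : s₃.arr 6 = s₁.arr 6 := by rw [hF₃.arr 6 rfl, hF₂.arr 6 rfl]
  rw [hF₂.arr 1 rfl, hF₁.arr 1 rfl] at e21
  intro j hj
  simp only [run, Expr.eval, State.setReg_arr, State.setArr_arr, State.setArr_reg, e10, e21, a0, a1,
    a4, a5, a6, ↓reduceIte, Nat.reduceEqDiff]
  rcases Nat.lt_succ_iff_lt_or_eq.1 hj with h1 | rfl
  · have hne : ((j : ℕ) : ℤ) ≠ (i : ℕ) := by exact_mod_cast h1.ne
    -- Ties are broken by index, so ranks are distinct and a new write cannot destroy an earlier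
    -- one.
    have hne' : ((rank (fun i => s.arr 1 i) I.n j : ℕ) : ℤ) ≠
        (rank (fun i => s.arr 1 i) I.n i : ℕ) := by
      intro h2
      exact h1.ne (rank_injOn (h1.trans hi) hi (by exact_mod_cast h2))
    rw [Function.update_of_ne hne, Function.update_of_ne hne', Function.update_of_ne hne']
    exact hI j h1
  · simp

/-! ### Lists of time points -/

/-- Append, for every entry `y` of the array `src`, the values `y, y - δ, y - 2 * δ, …` to the array
`dst`, where `δ` is the value of `step` and register `9` holds the number of values. -/
def expand (src len dst out : ℕ) (step : Expr) : Cmd :=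
  .assign out (const 0) ;;
  forLt 10 len (.assign 20 (read src (reg 10)) ;;
    forLt 11 9 (.write dst (reg out) (reg 20) ;; .assign out (add (reg out) (const 1)) ;;
      .assign 20 (sub (reg 20) step)))

theorem mul_add_inj {a b x y N : ℕ} (hx : x < N) (hy : y < N) (h : a * N + x = b * N + y) :
    a = b ∧ x = y := by
  have hN : 0 < N := by omega
  have h1 : (a * N + x) / N = a := by
    rw [Nat.add_comm, Nat.add_mul_div_right _ _ hN, Nat.div_eq_of_lt hx, Nat.zero_add]
  have h2 : (b * N + y) / N = b := by
    rw [Nat.add_comm, Nat.add_mul_div_right _ _ hN, Nat.div_eq_of_lt hy, Nat.zero_add]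
  have h3 : a = b := by rw [← h1, h, h2]
  subst h3
  exact ⟨rfl, by omega⟩

/-- The step expression is evaluated anew each time, so it must have the same value in all memories
that differ only in the loop's own registers. The entry for `(i, a)` lands at `i * N + a`. -/
theorem expand_ends {src len dst out : ℕ} {step : Expr} {s : State} {L N : ℕ} {u : ℕ → ℤ} {δ : ℤ}
    (hout : out ≠ 9 ∧ out ≠ 10 ∧ out ≠ 11 ∧ out ≠ 20 ∧ out ≠ len)
    (hlen : len ≠ 10 ∧ len ≠ 11 ∧ len ≠ 20) (hsrc : src ≠ dst) (hsteps : step.steps = 1)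
    (hL : s.reg len = L) (hN : s.reg 9 = N) (hu : ∀ i < L, s.arr src i = u i)
    (hstep : ∀ s' : State, (∀ x, x ≠ 10 → x ≠ 11 → x ≠ 20 → x ≠ out → s'.reg x = s.reg x) →
      step.eval s' = δ) :
    Ends (expand src len dst out step) s (L * (N * 30 + 30) + 20) fun s' =>
      s'.reg out = (L * N : ℕ) ∧
      ∀ i < L, ∀ a < N, s'.arr dst ((i * N + a : ℕ) : ℤ) = u i - a * δ := by
  obtain ⟨o1, o2, o3, o4, o5⟩ := hout
  obtain ⟨l1, l2, l3⟩ := hlen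
  have hreg : ∀ p : Cmd, p.regs = [10, 20, 11, out, 20, 11, 10] → ∀ s s' : State, Frame p s s' →
      ∀ x, x ≠ 10 → x ≠ 11 → x ≠ 20 → x ≠ out → s'.reg x = s.reg x := by
    intro p hp s s' hF x h1 h2 h3 h4
    refine hF.reg x ?_
    rw [hp]
    simp [h1, h2, h3, h4]
  refine Ends.mono (Ends.seq (B₁ := 2) ((Ends.straight rfl (Ends.forLt L (fun i s' =>
    s'.reg out = (i * N : ℕ) ∧ ∀ i' a, a < N → i' * N + a < i * N →
      s'.arr dst ((i' * N + a : ℕ) : ℤ) = u i' - a * δ)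
    (by simpa [run, o5.symm] using hL) ?_ (by simpa using l1) (B := N * 30 + 20)
    ?_ ?_ ?_)).mono (by simp [Cmd.time, Expr.steps]))) ?_
  · simp [Cmd.forLt, Cmd.regs, o1, o2, o3, o4, o5, l1, l2, l3, o5.symm, o2.symm]
  · simp [run, Expr.eval, o2, o2.symm]
  · rintro i hi s₁ hF₁ hi₁ hl₁ ⟨i1, i2⟩
    have hr₁ : ∀ x, x ≠ 10 → x ≠ 11 → x ≠ 20 → x ≠ out → s₁.reg x = s.reg x := by
      intro x h1 h2 h3 h4
      rw [hF₁.reg x (by simp [Cmd.forLt, Cmd.regs, h1, h2, h3, h4])]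
      simp [run, h4]
    have hs₁ : s₁.arr src = s.arr src := by
      rw [hF₁.arr src (by simp [Cmd.forLt, Cmd.arrs, hsrc])]
      simp [run]
    refine Ends.mono (Ends.seq (B₁ := 3) ((Ends.straight rfl (Ends.forLt N (fun a s' =>
      s'.reg out = (i * N + a : ℕ) ∧ s'.reg 20 = u i - a * δ ∧
      ∀ i' a', a' < N → i' * N + a' < i * N + a →
      s'.arr dst ((i' * N + a' : ℕ) : ℤ) = u i' - a' * δ) ?_ ?_ rfl (B := 15)
      ?_ ?_ ?_)).mono (by simp [Cmd.time, Expr.steps]))) (by omega)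
    · simp [run, hr₁ 9 (by norm_num) (by norm_num) (by norm_num) o1.symm, hN]
    · simp [Cmd.regs, o1.symm, o3.symm]
    · simp only [run, Expr.eval, State.setReg_reg, State.setReg_arr, o3, o4, hi₁, hs₁, hu i hi,
        Nat.reduceEqDiff, ↓reduceIte]
      exact ⟨by simpa using i1, by simp, by simpa using i2⟩
    · rintro a ha s₂ hF₂ ha₂ h9 ⟨j1, j2, j3⟩
      have hδ : ∀ s₃ : State, (∀ x, x ≠ 20 → x ≠ out → s₃.reg x = s₂.reg x) →
          step.eval s₃ = δ := by
        intro s₃ hs₃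
        refine hstep s₃ fun x h1 h2 h3 h4 => ?_
        rw [hs₃ x h3 h4, hF₂.reg x (by simp [Cmd.forLt, Cmd.regs, h2, h3, h4])]
        simp [run, h3, hr₁ x h1 h2 h3 h4]
      refine (Ends.straight (by rfl) ?_).mono (by simp [Cmd.time, Expr.steps, hsteps])
      simp only [run, Expr.eval]
      rw [hδ _ (by intro x h1 h2; simp [h2])]
      simp only [State.setReg_reg, State.setReg_arr, State.setArr_arr, State.setArr_reg, o3, o4,
        o4.symm, j1, j2, Nat.reduceEqDiff, ↓reduceIte]
      refine ⟨by push_cast; ring, by push_cast; ring, ?_⟩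
      intro i' a' ha' hlt
      rcases Nat.lt_succ_iff_lt_or_eq.1 hlt with h1 | h1
      · rw [Function.update_of_ne (by exact_mod_cast h1.ne)]; exact j3 i' a' ha' h1
      · obtain ⟨rfl, rfl⟩ := mul_add_inj ha' ha h1
        rw [Function.update_self]
    · rintro s₂ hF₂ ⟨j1, -, j3⟩
      simp only [State.setReg_reg, State.setReg_arr, o2, ↓reduceIte]
      rw [Nat.succ_mul]
      exact ⟨j1, j3⟩
  · rintro s₁ - ⟨j1, j2⟩
    refine ⟨j1, fun i hi a ha => j2 i a ha ?_⟩
    have : (i + 1) * N ≤ L * N := Nat.mul_le_mul_right _ hi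
    rw [Nat.succ_mul] at this
    omega
  · have : L * (N * 30 + 20 + 10) = L * (N * 30 + 30) := by ring
    omega

/-! ### Candidate slots -/

/-- The first two passes produce `d i - a` and then `d i - a - b * lam`; the last one uses step `-1`
to count upwards from the release dates. -/
def listsCmd : Cmd :=
  expand 1 0 7 30 (const 1) ;; expand 7 30 8 31 (reg 2) ;; expand 0 0 9 32 (const (-1))

/-- Array `8` holds the candidates for the start of a calibration, array `9` those for the start of
a job. -/
structure Lists (I : Instance) (s : State) : Prop where
  calCount : s.reg 31 = (I.n * (I.n + 1) * (I.n + 1) : ℕ)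
  jobCount : s.reg 32 = (I.n * (I.n + 1) : ℕ)
  cal : ∀ i : Fin I.n, ∀ a ≤ I.n, ∀ b ≤ I.n, ∃ x < I.n * (I.n + 1) * (I.n + 1),
    s.arr 8 (x : ℕ) = I.deadline i - (a : ℕ) - (b : ℕ) * (I.act : ℤ)
  job : ∀ i : Fin I.n, ∀ a ≤ I.n, ∃ x < I.n * (I.n + 1),
    s.arr 9 (x : ℕ) = I.release i + (a : ℕ)

theorem mul_add_lt {i a L N : ℕ} (hi : i < L) (ha : a < N) : i * N + a < L * N :=
  calc i * N + a < i * N + N := by omega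
    _ = (i + 1) * N := (Nat.succ_mul _ _).symm
    _ ≤ L * N := Nat.mul_le_mul_right _ hi

theorem listsCmd_ends {I : Instance} {s : State} (h : HasInput I s) (h9 : s.reg 9 = (I.n + 1 : ℕ)) :
    Ends listsCmd s ((I.n * ((I.n + 1) * 30 + 30) + 20) +
      ((I.n * (I.n + 1) * ((I.n + 1) * 30 + 30) + 20) + (I.n * ((I.n + 1) * 30 + 30) + 20)))
      (Lists I) := by
  refine Ends.seq ((expand_ends (u := fun i => s.arr 1 i) (δ := 1) (by decide) (by decide)
    (by decide) rfl h.n h9 (fun _ _ => rfl) fun _ _ => rfl).imp ?_)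
  rintro s₁ hF₁ ⟨a1, a2⟩
  have h₁ := h.frame hF₁ rfl rfl
  refine Ends.seq ((expand_ends (u := fun i => s₁.arr 7 i) (δ := I.act) (by decide) (by decide)
    (by decide) rfl a1 ((hF₁.reg 9 rfl).trans h9) (fun _ _ => rfl) fun s' hs' => ?_).imp ?_)
  · rw [← h₁.act]; exact hs' 2 (by decide) (by decide) (by decide) (by decide)
  rintro s₂ hF₂ ⟨b1, b2⟩
  have h₂ := h₁.frame hF₂ rfl rfl
  refine (expand_ends (u := fun i => s₂.arr 0 i) (δ := -1) (by decide) (by decide)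
    (by decide) rfl h₂.n (((hF₂.reg 9 rfl).trans (hF₁.reg 9 rfl)).trans h9) (fun _ _ => rfl)
    fun _ _ => rfl).imp ?_
  rintro s₃ hF₃ ⟨c1, c2⟩
  refine ⟨(hF₃.reg 31 rfl).trans b1, c1, ?_, ?_⟩
  · intro i a ha b hb
    have h3 := mul_add_lt i.2 (Nat.lt_succ_of_le ha)
    refine ⟨(i * (I.n + 1) + a) * (I.n + 1) + b, mul_add_lt h3 (Nat.lt_succ_of_le hb), ?_⟩
    rw [hF₃.arr 8 rfl, b2 _ h3 b (Nat.lt_succ_of_le hb), a2 i i.2 a (Nat.lt_succ_of_le ha)]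
    simp only [h.deadline i, mul_one]
  · intro i a ha
    refine ⟨i * (I.n + 1) + a, mul_add_lt i.2 (Nat.lt_succ_of_le ha), ?_⟩
    rw [c2 i i.2 a (Nat.lt_succ_of_le ha)]
    simp only [h₂.release i]
    ring

/-- The slots `2, …, m - 1`, where `m` is in register `33`, are admissible and contain the
admissible ones among those described by `R`. -/
def Points (ρ : StartRule) (I : Instance) (B : ℕ) (R : ℤ → ℤ → Prop) (s : State) : Prop :=
  ∃ m : ℕ, s.reg 33 = m ∧ 2 ≤ m ∧ m ≤ B ∧
    (∀ p : ℕ, 2 ≤ p → p < m → ρ.Allows I (s.arr 10 p) ∧ s.arr 10 p + I.act ≤ s.arr 11 p) ∧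
    ∀ c t, R c t → ρ.Allows I c → c + I.act ≤ t →
      ∃ p : ℕ, 2 ≤ p ∧ p < m ∧ s.arr 10 p = c ∧ s.arr 11 p = t

theorem Points.imp {ρ : StartRule} {I : Instance} {B B' : ℕ} {R R' : ℤ → ℤ → Prop} {s s' : State}
    (h : Points ρ I B R s) (hB : B ≤ B') (hR : ∀ c t, R' c t → R c t)
    (h33 : s'.reg 33 = s.reg 33) (h10 : s'.arr 10 = s.arr 10) (h11 : s'.arr 11 = s.arr 11) :
    Points ρ I B' R' s' := by
  obtain ⟨m, h1, h2, h3, h4, h5⟩ := h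
  refine ⟨m, h33.trans h1, h2, h3.trans hB, ?_, ?_⟩
  · rw [h10, h11]; exact h4
  · rw [h10, h11]; exact fun c t h => h5 c t (hR c t h)

/-- Comparing register `20` with itself makes the test vacuous when every start is permitted;
otherwise the earliest release date decides. -/
def StartRule.bound : StartRule → Expr
  | .anyTime => reg 20
  | .fromFirstRelease => reg 4

def pushCmd (ρ : StartRule) : Cmd :=
  .ifLe (add (reg 20) (reg 2)) (reg 21)
    (.ifLe ρ.bound (reg 20)
      (.write 10 (reg 33) (reg 20) ;; .write 11 (reg 33) (reg 21) ;;
        .assign 33 (add (reg 33) (const 1))) .skip) .skip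

theorem StartRule.bound_le {ρ : StartRule} {I : Instance} {s : State}
    (h₁ : ∃ j, s.reg 4 = I.release j) (h₂ : ∀ j, s.reg 4 ≤ I.release j) :
    ρ.bound.eval s ≤ s.reg 20 ↔ ρ.Allows I (s.reg 20) := by
  cases ρ with
  | anyTime => simp [StartRule.bound, Expr.eval, StartRule.Allows]
  | fromFirstRelease =>
    obtain ⟨j, hj⟩ := h₁
    exact ⟨fun h => ⟨j, hj ▸ h⟩, fun ⟨i, hi⟩ => (h₂ i).trans hi⟩

theorem pushCmd_run {ρ : StartRule} {I : Instance} {B : ℕ} {R : ℤ → ℤ → Prop} {s : State}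
    (h : Points ρ I B R s) (hact : s.reg 2 = I.act)
    (h₁ : ∃ j, s.reg 4 = I.release j) (h₂ : ∀ j, s.reg 4 ≤ I.release j) :
    Points ρ I (B + 1) (fun c t => R c t ∨ c = s.reg 20 ∧ t = s.reg 21) ((pushCmd ρ).run s) := by
  have hb := StartRule.bound_le (ρ := ρ) h₁ h₂
  obtain ⟨m, e1, e2, e3, e4, e5⟩ := h
  by_cases c1 : s.reg 20 + I.act ≤ s.reg 21
  · by_cases c2 : ρ.bound.eval s ≤ s.reg 20
    · simp only [pushCmd, run, Expr.eval, c1, c2, hact, ↓reduceIte]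
      refine ⟨m + 1, by simp [e1], by omega, by omega, ?_, ?_⟩
      · intro p hp hpm
        simp only [State.setReg_arr, State.setArr_arr, State.setArr_reg, ↓reduceIte,
          Nat.reduceEqDiff, e1]
        rcases Nat.lt_succ_iff_lt_or_eq.1 hpm with h3 | rfl
        · rw [Function.update_of_ne (by exact_mod_cast h3.ne),
            Function.update_of_ne (by exact_mod_cast h3.ne)]
          exact e4 p hp h3
        · simp only [Function.update_self]
          exact ⟨hb.1 c2, c1⟩
      · intro c t hR ha ht
        simp only [State.setReg_arr, State.setArr_arr, State.setArr_reg, ↓reduceIte,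
          Nat.reduceEqDiff, e1]
        rcases hR with hR | ⟨rfl, rfl⟩
        · obtain ⟨p, h3, h4, h5, h6⟩ := e5 c t hR ha ht
          refine ⟨p, h3, by omega, ?_, ?_⟩
          · rwa [Function.update_of_ne (by exact_mod_cast h4.ne)]
          · rwa [Function.update_of_ne (by exact_mod_cast h4.ne)]
        · exact ⟨m, e2, by omega, by simp, by simp⟩
    · simp only [pushCmd, run, Expr.eval, c1, c2, hact, ↓reduceIte]
      refine ⟨m, e1, e2, by omega, e4, ?_⟩
      rintro c t (hR | ⟨rfl, rfl⟩) ha ht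
      · exact e5 c t hR ha ht
      · exact absurd (hb.2 ha) c2
  · simp only [pushCmd, run, Expr.eval, c1, hact, ↓reduceIte]
    refine ⟨m, e1, e2, by omega, e4, ?_⟩
    rintro c t (hR | ⟨rfl, rfl⟩) ha ht
    · exact e5 c t hR ha ht
    · exact absurd ht c1

/-- One index serves both families of job times: as an address in array `9` and as the offset after
the activation. The offsets run further than necessary, which only adds admissible slots. -/
def pointsStep (ρ : StartRule) : Cmd :=
  (.assign 21 (read 9 (reg 11)) ;; pushCmd ρ) ;;
    (.assign 21 (add (add (reg 20) (reg 2)) (reg 11)) ;; pushCmd ρ)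

def pointsCmd (ρ : StartRule) : Cmd :=
  .assign 33 (const 2) ;;
  forLt 10 31 (.assign 20 (read 8 (reg 10)) ;; forLt 11 32 (pointsStep ρ))

theorem pushCmd_frame (ρ : StartRule) (s : State) : Frame (pushCmd ρ) s ((pushCmd ρ).run s) :=
  Frame.run (by cases ρ <;> rfl) s

theorem pointsCmd_ends {ρ : StartRule} {I : Instance} {s : State} {M N : ℕ} (h : HasInput I s)
    (h₁ : ∃ j, s.reg 4 = I.release j) (h₂ : ∀ j, s.reg 4 ≤ I.release j)
    (hM : s.reg 31 = M) (hN : s.reg 32 = N) :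
    Ends (pointsCmd ρ) s (M * (N * 110 + 20 + 10) + 20) (Points ρ I (2 + M * (2 * N)) fun c t =>
      ∃ x < M, c = s.arr 8 (x : ℕ) ∧ ∃ z < N, t = s.arr 9 (z : ℕ) ∨ t = c + I.act + (z : ℕ)) := by
  have hF₀ : Frame _ s ((Cmd.assign 33 (const 2)).run s) := Frame.run rfl s
  refine Ends.mono (Ends.seq (B₁ := 2) ((Ends.straight rfl (Ends.forLt M (fun x =>
    Points ρ I (2 + x * (2 * N)) fun c t => ∃ y < x, c = s.arr 8 (y : ℕ) ∧
      ∃ z < N, t = s.arr 9 (z : ℕ) ∨ t = c + I.act + (z : ℕ)) ((hF₀.reg 31 rfl).trans hM)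
    rfl rfl (B := N * 110 + 20) ?_ ?_ fun _ _ h => h)).mono (by decide))) (by omega)
  · exact ⟨2, by simp [run, Expr.eval], le_rfl, by omega, fun p _ _ => by omega,
      fun c t ⟨_, h, _⟩ => by omega⟩
  intro x hx s₁ hF₁ hx₁ hM₁ hI
  have hF₂ : Frame _ s₁ ((Cmd.assign 20 (read 8 (reg 10))).run s₁) := Frame.run rfl s₁
  have k8 : s₁.arr 8 = s.arr 8 := (hF₁.arr 8 rfl).trans (hF₀.arr 8 rfl)
  refine Ends.mono (Ends.seq (B₁ := 3) ((Ends.straight rfl (Ends.forLt N (fun w =>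
    Points ρ I (2 + x * (2 * N) + 2 * w) fun c t => (∃ y < x, c = s.arr 8 (y : ℕ) ∧
      ∃ z < N, t = s.arr 9 (z : ℕ) ∨ t = c + I.act + (z : ℕ)) ∨ (c = s.arr 8 (x : ℕ) ∧
      ∃ z < w, t = s.arr 9 (z : ℕ) ∨ t = c + I.act + (z : ℕ)))
    (((hF₂.reg 32 rfl).trans ((hF₁.reg 32 rfl).trans (hF₀.reg 32 rfl))).trans hN) rfl rfl
    (B := 100) ?_ ?_ ?_)).mono (by decide))) (by omega)
  · refine hI.imp (by omega) ?_ rfl rfl rfl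
    rintro c t (h | ⟨_, z, h, _⟩)
    · exact h
    · omega
  · intro w hw s₂ hF₃ hw₂ hN₂ hJ
    have hact : s₂.reg 2 = I.act := by
      rw [hF₃.reg 2 rfl, hF₂.reg 2 rfl, hF₁.reg 2 rfl, hF₀.reg 2 rfl, h.act]
    have k4 : s₂.reg 4 = s.reg 4 := by
      rw [hF₃.reg 4 rfl, hF₂.reg 4 rfl, hF₁.reg 4 rfl, hF₀.reg 4 rfl]
    have k9 : s₂.arr 9 = s.arr 9 := by
      rw [hF₃.arr 9 rfl, hF₂.arr 9 rfl, hF₁.arr 9 rfl, hF₀.arr 9 rfl]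
    have k20 : s₂.reg 20 = s.arr 8 (x : ℕ) := by
      rw [hF₃.reg 20 rfl]; simp [run, Expr.eval, hx₁, k8]
    rw [← k4] at h₁ h₂
    refine (Ends.straight (by cases ρ <;> rfl) ?_).mono (B₁ := (pointsStep ρ).time)
      (by cases ρ <;> decide)
    have p1 := pushCmd_run (s := (Cmd.assign 21 (read 9 (reg 11))).run s₂)
      (hJ.imp le_rfl (fun _ _ h => h) rfl rfl rfl) hact h₁ h₂
    have f1 := pushCmd_frame ρ ((Cmd.assign 21 (read 9 (reg 11))).run s₂)
    set s₃ := (pushCmd ρ).run ((Cmd.assign 21 (read 9 (reg 11))).run s₂) with hs₃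
    have e2 : s₃.reg 2 = I.act := (f1.reg 2 rfl).trans hact
    have e4 : s₃.reg 4 = s₂.reg 4 := f1.reg 4 rfl
    have e20 : s₃.reg 20 = s.arr 8 (x : ℕ) := (f1.reg 20 rfl).trans k20
    have e11 : s₃.reg 11 = (w : ℕ) := (f1.reg 11 rfl).trans hw₂
    rw [← e4] at h₁ h₂
    have p2 := pushCmd_run (s := (Cmd.assign 21 (add (add (reg 20) (reg 2)) (reg 11))).run s₃)
      (p1.imp le_rfl (fun _ _ h => h) rfl rfl rfl) e2 h₁ h₂
    refine p2.imp (by omega) ?_ rfl rfl rfl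
    simp only [run, Expr.eval, State.setReg_reg, State.setReg_arr, Nat.reduceEqDiff, ↓reduceIte,
      e2, e20, e11, k20, k9, hw₂]
    rintro c t (h3 | ⟨rfl, z, hz, h3⟩)
    · exact .inl (.inl (.inl h3))
    · rcases Nat.lt_succ_iff_lt_or_eq.1 hz with h4 | rfl
      · exact .inl (.inl (.inr ⟨rfl, z, h4, h3⟩))
      · rcases h3 with h3 | h3
        · exact .inl (.inr ⟨rfl, h3⟩)
        · exact .inr ⟨rfl, h3⟩
  · intro s₂ hF₃ hJ
    have hB : (x + 1) * (2 * N) = x * (2 * N) + 2 * N := Nat.succ_mul _ _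
    refine hJ.imp (by omega) ?_ rfl rfl rfl
    rintro c t ⟨y, hy, h3⟩
    rcases Nat.lt_succ_iff_lt_or_eq.1 hy with h4 | rfl
    · exact .inl ⟨y, h4, h3⟩
    · exact .inr h3

/-! ### Costs of the slots -/

def kindStep : Cmd :=
  .ifLe (add (sub (reg 21) (reg 20)) (const 1)) (add (reg 2) (read 2 (reg 11)))
    (.ifLe (add (read 3 (reg 11)) (const 1)) (reg 22)
      (.assign 22 (read 3 (reg 11)) ;; .assign 23 (reg 11)) .skip) .skip

def slotStart : Cmd :=
  .assign 20 (read 10 (reg 10)) ;; .assign 21 (read 11 (reg 10)) ;;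
  .ifLe (reg 20) (reg 5) (.assign 5 (sub (reg 20) (const 1))) .skip ;;
  .ifLe (reg 6) (reg 21) (.assign 6 (add (reg 21) (const 1))) .skip ;;
  .assign 22 (reg 3) ;; .assign 23 (const 0)

def slotEnd : Cmd :=
  .write 12 (reg 10) (reg 22) ;; .write 13 (reg 10) (reg 23) ;; .write 14 (reg 10) (reg 34) ;;
  .assign 34 (add (reg 34) (reg 33))

/-- The loop includes the slots `0` and `1`, not yet set; what it stores there in array `12` is
overwritten later. It also widens the bounds in registers `5` and `6` past all slots, and register
`34` accumulates multiples of the number of slots, ending at its square. -/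
def costsCmd : Cmd :=
  .assign 34 (const 0) ;; forLt 10 33 (slotStart ;; forLt 11 1 kindStep ;; slotEnd)

theorem kindLoop_ends {I : Instance} {s : State} {c t top : ℤ} (h : HasInput I s)
    (h20 : s.reg 20 = c) (h21 : s.reg 21 = t) (h22 : s.reg 22 = top) (h23 : s.reg 23 = 0) :
    Ends (forLt 11 1 kindStep) s (I.K * 40 + 10) fun s' =>
      s'.reg 22 = (I.bestKind top (t - c)).1 ∧ s'.reg 23 = (I.bestKind top (t - c)).2 := by
  refine Ends.forLt I.K (fun m s' =>
    s'.reg 22 = (scan (fun k => ∀ h : k < I.K, t - c + 1 ≤ I.act + I.len ⟨k, h⟩)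
      (fun k => if h : k < I.K then (I.cost ⟨k, h⟩ : ℤ) else 0) top m).1 ∧
    s'.reg 23 = (scan (fun k => ∀ h : k < I.K, t - c + 1 ≤ I.act + I.len ⟨k, h⟩)
      (fun k => if h : k < I.K then (I.cost ⟨k, h⟩ : ℤ) else 0) top m).2) h.K rfl rfl (B := 30)
    (by simp [scan, h22, h23]) ?_ fun _ _ h => h
  rintro k hk s₁ hF hk₁ hK₁ ⟨i1, i2⟩
  have e20 := (hF.reg 20 rfl).trans h20
  have e21 := (hF.reg 21 rfl).trans h21
  have e2 := (h.frame hF rfl rfl).act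
  have a2 := (h.frame hF rfl rfl).len ⟨k, hk⟩
  have a3 := (h.frame hF rfl rfl).cost ⟨k, hk⟩
  simp only at a2 a3
  refine (Ends.straight rfl ?_).mono (by decide)
  simp only [scan, hk, forall_true_left, dite_true, ← i1]
  by_cases c1 : t - c + 1 ≤ I.act + I.len ⟨k, hk⟩
  · by_cases c2 : (I.cost ⟨k, hk⟩ : ℤ) < s₁.reg 22
    · have c2' : (I.cost ⟨k, hk⟩ : ℤ) + 1 ≤ s₁.reg 22 := c2
      simp only [kindStep, run, Expr.eval, State.setReg_reg, State.setReg_arr, e20, e21, e2, a2, a3,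
        hk₁, c1, c2, c2', ↓reduceIte, Nat.reduceEqDiff, and_self]
    · have c2' : ¬ (I.cost ⟨k, hk⟩ : ℤ) + 1 ≤ s₁.reg 22 := c2
      simp only [kindStep, run, Expr.eval, State.setReg_reg, State.setReg_arr, e20, e21, e2, a2, a3,
        hk₁, c1, c2, c2', ↓reduceIte, Nat.reduceEqDiff, and_false]
      exact ⟨i1, i2⟩
  · simp only [kindStep, run, Expr.eval, State.setReg_reg, State.setReg_arr, e20, e21, e2, a2, a3,
      hk₁, c1, ↓reduceIte, Nat.reduceEqDiff, false_and]
    exact ⟨i1, i2⟩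

theorem slotStart_run {s : State} {c t : ℤ} (hc : s.arr 10 (s.reg 10) = c)
    (ht : s.arr 11 (s.reg 10) = t) :
    (slotStart.run s).reg 20 = c ∧ (slotStart.run s).reg 21 = t ∧
      (slotStart.run s).reg 22 = s.reg 3 ∧ (slotStart.run s).reg 23 = 0 ∧
      (slotStart.run s).reg 5 = min (s.reg 5) (c - 1) ∧
      (slotStart.run s).reg 6 = max (s.reg 6) (t + 1) := by
  by_cases c1 : c ≤ s.reg 5 <;> by_cases c2 : s.reg 6 ≤ t <;>
    simp only [slotStart, run, Expr.eval, State.setReg_reg, State.setReg_arr, hc, ht, c1, c2,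
      ↓reduceIte, Nat.reduceEqDiff, true_and] <;> omega

theorem costsCmd_ends {I : Instance} {s : State} {m : ℕ} {top : ℤ} (h : HasInput I s)
    (h3 : s.reg 3 = top) (hm : s.reg 33 = m) :
    Ends costsCmd s (m * (I.K * 40 + 10 + 60 + 10) + 20) fun s' =>
      s'.reg 34 = m * m ∧ s'.reg 5 ≤ s.reg 5 ∧ s.reg 6 ≤ s'.reg 6 ∧ ∀ p < m,
        s'.reg 5 < s.arr 10 p ∧ s.arr 11 p < s'.reg 6 ∧
        s'.arr 12 p = (I.bestKind top (s.arr 11 p - s.arr 10 p)).1 ∧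
        s'.arr 13 p = (I.bestKind top (s.arr 11 p - s.arr 10 p)).2 ∧ s'.arr 14 p = (p : ℤ) * m := by
  have hF₀ : Frame _ s ((Cmd.assign 34 (const 0)).run s) := Frame.run rfl s
  refine Ends.mono (Ends.seq (B₁ := 2) ((Ends.straight rfl (Ends.forLt m (fun x s' =>
    s'.reg 34 = x * m ∧ s'.reg 5 ≤ s.reg 5 ∧ s.reg 6 ≤ s'.reg 6 ∧ ∀ p : ℕ, p < x →
        s'.reg 5 < s.arr 10 p ∧ s.arr 11 p < s'.reg 6 ∧
        s'.arr 12 p = (I.bestKind top (s.arr 11 p - s.arr 10 p)).1 ∧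
        s'.arr 13 p = (I.bestKind top (s.arr 11 p - s.arr 10 p)).2 ∧ s'.arr 14 p = (p : ℤ) * m)
    ((hF₀.reg 33 rfl).trans hm) rfl rfl (B := I.K * 40 + 10 + 60) ?_ ?_
    fun _ _ h => h)).mono (by decide))) (by omega)
  · simp [run, Expr.eval]
  rintro x hx s₁ hF₁ hx₁ hm₁ ⟨i1, i2, i3, i4⟩
  have h₁ := (h.frame hF₀ rfl rfl).frame hF₁ rfl rfl
  have hF₂ : Frame _ s₁ (slotStart.run s₁) := Frame.run rfl s₁
  have k10 : s₁.arr 10 = s.arr 10 := (hF₁.arr 10 rfl).trans (hF₀.arr 10 rfl)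
  have k11 : s₁.arr 11 = s.arr 11 := (hF₁.arr 11 rfl).trans (hF₀.arr 11 rfl)
  have k3 : s₁.reg 3 = top := ((hF₁.reg 3 rfl).trans (hF₀.reg 3 rfl)).trans h3
  obtain ⟨e20, e21, e22, e23, e5, e6⟩ := slotStart_run (s := s₁) (c := s.arr 10 x)
    (t := s.arr 11 x) (by rw [hx₁, k10]) (by rw [hx₁, k11])
  refine Ends.mono (Ends.seq (B₁ := 40) ((Ends.straight rfl (Ends.seq (B₂ := 20)
    ((kindLoop_ends (h₁.frame hF₂ rfl rfl) e20 e21 (e22.trans k3) e23).imp ?_))).mono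
    (by decide))) (by omega)
  rintro s₂ hF₃ ⟨j22, j23⟩
  refine (Ends.straight rfl ?_).mono (by decide)
  have e10 : s₂.reg 10 = (x : ℕ) := by rw [hF₃.reg 10 rfl, hF₂.reg 10 rfl, hx₁]
  have e34 : s₂.reg 34 = x * m := by rw [hF₃.reg 34 rfl, hF₂.reg 34 rfl, i1]
  have e33 : s₂.reg 33 = m := by rw [hF₃.reg 33 rfl, hF₂.reg 33 rfl, hm₁]
  rw [← hF₃.reg 5 rfl] at e5
  rw [← hF₃.reg 6 rfl] at e6
  have a12 : s₂.arr 12 = s₁.arr 12 := by rw [hF₃.arr 12 rfl, hF₂.arr 12 rfl]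
  have a13 : s₂.arr 13 = s₁.arr 13 := by rw [hF₃.arr 13 rfl, hF₂.arr 13 rfl]
  have a14 : s₂.arr 14 = s₁.arr 14 := by rw [hF₃.arr 14 rfl, hF₂.arr 14 rfl]
  simp only [slotEnd, run, Expr.eval, State.setReg_reg, State.setReg_arr, State.setArr_arr,
    State.setArr_reg, e10, e34, e33, j22, j23, a12, a13, a14, ↓reduceIte, Nat.reduceEqDiff]
  refine ⟨by push_cast; ring, by omega, by omega, ?_⟩
  intro p hp
  rcases Nat.lt_succ_iff_lt_or_eq.1 hp with h4 | rfl
  · have hne : ((p : ℕ) : ℤ) ≠ (x : ℕ) := by exact_mod_cast h4.ne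
    simp only [Function.update_of_ne hne]
    obtain ⟨j1, j2, j3⟩ := i4 p h4
    exact ⟨by omega, by omega, j3⟩
  · simp only [Function.update_self, and_self, and_true]
    exact ⟨by omega, by omega⟩

/-! ### Sentinels and the complete preparation -/

def sentinelCmd : Cmd :=
  (.write 10 (const 0) (reg 5) ;; .write 11 (const 0) (reg 5) ;; .write 12 (const 0) (const 0)) ;;
  (.write 10 (const 1) (reg 6) ;; .write 11 (const 1) (reg 6) ;; .write 12 (const 1) (const 0))

theorem sentinelCmd_run (s : State) :
    ((sentinelCmd.run s).arr 10 0 = s.reg 5 ∧ (sentinelCmd.run s).arr 11 0 = s.reg 5 ∧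
      (sentinelCmd.run s).arr 12 0 = 0) ∧
    ((sentinelCmd.run s).arr 10 1 = s.reg 6 ∧ (sentinelCmd.run s).arr 11 1 = s.reg 6 ∧
      (sentinelCmd.run s).arr 12 1 = 0) ∧ ∀ p : ℕ, 2 ≤ p →
    (sentinelCmd.run s).arr 10 p = s.arr 10 p ∧ (sentinelCmd.run s).arr 11 p = s.arr 11 p ∧
      (sentinelCmd.run s).arr 12 p = s.arr 12 p := by
  refine ⟨?_, ?_, fun p hp => ?_⟩
  · simp [sentinelCmd, run, Expr.eval]
  · simp [sentinelCmd, run, Expr.eval]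
  · have h0 : (p : ℤ) ≠ 0 := by omega
    have h1 : (p : ℤ) ≠ 1 := by omega
    simp [sentinelCmd, run, Expr.eval, Function.update_of_ne h0, Function.update_of_ne h1]

def prepareCmd (ρ : StartRule) : Cmd :=
  boundsCmd ;; sortCmd ;; listsCmd ;; pointsCmd ρ ;; costsCmd ;; sentinelCmd

theorem pow_le_bound {n K : ℕ} (hn : 1 ≤ n) (hK : 1 ≤ K) {a b : ℕ} (ha : a ≤ 16 := by norm_num)
    (hb : b ≤ 2 := by norm_num) : n ^ a * K ^ b ≤ n ^ 16 * K ^ 2 :=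
  Nat.mul_le_mul (Nat.pow_le_pow_right hn ha) (Nat.pow_le_pow_right hK hb)

/-- With `n + 1 ≤ 2 * n` the product is at most `16 * n ^ 5`, and the two sentinels add at most `2 *
n ^ 5`. -/
theorem slotCount_le {n : ℕ} (hn : 1 ≤ n) :
    2 + n * (n + 1) * (n + 1) * (2 * (n * (n + 1))) ≤ 18 * n ^ 5 := by
  have h1 : n + 1 ≤ 2 * n := by omega
  calc 2 + n * (n + 1) * (n + 1) * (2 * (n * (n + 1)))
      ≤ 2 * n ^ 5 + n * (2 * n) * (2 * n) * (2 * (n * (2 * n))) := by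
        have : 1 ≤ n ^ 5 := Nat.one_le_pow _ _ hn
        gcongr
        omega
    _ = 18 * n ^ 5 := by ring

theorem prepareCmd_ends {ρ : StartRule} {I : Instance} {s : State} (h : HasInput I s)
    (hn : 1 ≤ I.n) (hK : 1 ≤ I.K) :
    Ends (prepareCmd ρ) s (10000 * (I.n ^ 16 * I.K ^ 2)) fun s' =>
      ∃ D e, D.size ≤ 18 * I.n ^ 5 ∧ SlotData.Models D ρ I e ∧ Ready D I e s' := by
  refine Ends.mono (Ends.seq (B₁ := I.n * (I.K * 20 + 10 + 50 + 10) + 40)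
    (B₂ := I.n * (I.n * 50 + 10 + 20 + 10) + 10 + ((I.n * ((I.n + 1) * 30 + 30) + 20) +
      ((I.n * (I.n + 1) * ((I.n + 1) * 30 + 30) + 20) + (I.n * ((I.n + 1) * 30 + 30) + 20)) +
      (I.n * (I.n + 1) * (I.n + 1) * (I.n * (I.n + 1) * 110 + 20 + 10) + 20 +
      (18 * I.n ^ 5 * (I.K * 40 + 10 + 60 + 10) + 20 + 20))))
    ((boundsCmd_ends h hn).imp ?_)) ?_
  · rintro s₁ hF₁ ⟨hB, h9⟩
    have h₁ := h.frame hF₁ rfl rfl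
    refine Ends.seq ((sortCmd_ends h₁).imp ?_)
    intro s₂ hF₂ hS
    have h₂ := h₁.frame hF₂ rfl rfl
    refine Ends.seq ((listsCmd_ends h₂ ((hF₂.reg 9 rfl).trans h9)).imp ?_)
    intro s₃ hF₃ hL
    have h₃ := h₂.frame hF₃ rfl rfl
    have e4 : s₃.reg 4 = s₁.reg 4 := (hF₃.reg 4 rfl).trans (hF₂.reg 4 rfl)
    refine Ends.seq ((pointsCmd_ends h₃ (e4 ▸ hB.first) (e4 ▸ hB.first_le) hL.calCount
      hL.jobCount).imp ?_)
    rintro s₄ hF₄ ⟨m, h33, hm2, hmB, hval, hcomp⟩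
    have hF₄' : ∀ x ∈ [3, 5, 6], s₄.reg x = s₁.reg x := by
      intro x hx
      simp only [List.mem_cons, List.not_mem_nil, or_false] at hx
      have hx' : (pointsCmd ρ).regs.contains x = false := by
        rcases hx with rfl | rfl | rfl <;> rfl
      rw [hF₄.reg x hx']
      rcases hx with rfl | rfl | rfl
      · rw [hF₃.reg 3 rfl, hF₂.reg 3 rfl]
      · rw [hF₃.reg 5 rfl, hF₂.reg 5 rfl]
      · rw [hF₃.reg 6 rfl, hF₂.reg 6 rfl]
    have h₄ := h₃.frame hF₄ rfl rfl
    have hm18 : m ≤ 18 * I.n ^ 5 := hmB.trans (slotCount_le hn)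
    refine Ends.seq (((costsCmd_ends h₄ rfl h33).mono
      (Nat.add_le_add_right (Nat.mul_le_mul_right _ hm18) _)).imp ?_)
    rintro s₅ hF₅ ⟨h34, h5, h6, hp⟩
    have h₅ := h₄.frame hF₅ rfl rfl
    refine (Ends.straight rfl ?_).mono (B₂ := 20) (by decide)
    have hF₆ : Frame _ s₅ (sentinelCmd.run s₅) := Frame.run rfl s₅
    obtain ⟨⟨a0, b0, c0⟩, ⟨a1, b1, c1⟩, hsent⟩ := sentinelCmd_run s₅
    rw [hF₄' 5 (by simp)] at h5
    rw [hF₄' 6 (by simp)] at h6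
    rw [hF₄' 3 (by simp), hB.top] at hp
    set s₆ := sentinelCmd.run s₅ with hs₆
    obtain ⟨e, he, hmono⟩ := exists_sort (fun i => s₁.arr 1 i) I.n
    have h3 : s₆.reg 3 = I.costBound + 1 := by
      rw [hF₆.reg 3 rfl, hF₅.reg 3 rfl, hF₄' 3 (by simp), hB.top]
    have hslot : ∀ p : ℕ, 2 ≤ p → s₆.arr 10 p = s₄.arr 10 p ∧ s₆.arr 11 p = s₄.arr 11 p := by
      intro p hp2
      obtain ⟨q1, q2, -⟩ := hsent p hp2
      rw [q1, q2, hF₅.arr 10 rfl, hF₅.arr 11 rfl]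
      exact ⟨rfl, rfl⟩
    have hsort : ∀ j : Fin I.n, s₆.arr 4 (j : ℕ) = (e.symm j : ℕ) ∧
        s₆.arr 5 ((e.symm j : ℕ) : ℤ) = I.release j ∧
        s₆.arr 6 ((e.symm j : ℕ) : ℤ) = I.deadline j := by
      intro j
      obtain ⟨q1, q2, q3⟩ := hS j j.2
      have hframe : ∀ a ∈ [4, 5, 6], s₆.arr a = s₂.arr a := by
        intro a ha
        simp only [List.mem_cons, List.not_mem_nil, or_false] at ha
        rcases ha with rfl | rfl | rfl <;>
          rw [hF₆.arr _ rfl, hF₅.arr _ rfl, hF₄.arr _ rfl, hF₃.arr _ rfl]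
      rw [hframe 4 (by simp), hframe 5 (by simp), hframe 6 (by simp), he j, q1, q2, q3,
        h₁.release j, h₁.deadline j]
      exact ⟨rfl, rfl, rfl⟩
    have hr : ∀ k : Fin I.n, s₆.arr 5 (k : ℕ) = I.release (e k) := by
      intro k
      have := (hsort (e k)).2.1
      rwa [Equiv.symm_apply_apply] at this
    have hd : ∀ k : Fin I.n, s₆.arr 6 (k : ℕ) = I.deadline (e k) := by
      intro k
      have := (hsort (e k)).2.2
      rwa [Equiv.symm_apply_apply] at this
    -- The slot data are read off the final memory, apart from `G` and `top`, which are given by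
    -- their formulas so that `Models` holds by definition there; `Ready` then checks that the
    -- memory contains them.
    refine ⟨⟨m, fun p => s₆.arr 10 p, fun p => s₆.arr 11 p, fun p => if p < 2 then 0 else
      (I.bestKind (I.costBound + 1) (s₆.arr 11 p - s₆.arr 10 p)).1, I.costBound + 1,
      fun k => s₆.arr 5 k, fun k => s₆.arr 6 k⟩, e, hm18, ?_, ?_⟩
    · refine ⟨by simp, fun p => rfl, hr, hd, ?_, hm2, a0.trans b0.symm, a1.trans b1.symm,
        ?_, ?_, ?_, ?_, ?_, ?_, ?_⟩
      · intro a b hab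
        have := hmono hab
        simp only [h₁.deadline] at this
        exact this
      · intro p hp2 hpm
        simp only [(hslot p hp2).1, Nat.cast_zero, b0]
        have := (hp p hpm).1
        exact this
      · intro p hp2 hpm
        simp only [(hslot p hp2).2, Nat.cast_one, b1]
        have := (hp p hpm).2.1
        exact this
      · intro k
        simp only [Nat.cast_zero, b0]
        have := hB.lo k
        omega
      · intro k
        simp only [Nat.cast_one, b1]
        have := hB.hi k
        omega
      · intro p hp2 hpm
        simp only [(hslot p hp2).1, (hslot p hp2).2]
        exact (hval p hp2 hpm).2
      · intro p hp2 hpm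
        simp only [(hslot p hp2).1]
        exact (hval p hp2 hpm).1
      · rintro c t ha ht ⟨i, a, han, b, hbn, hc⟩ htt
        obtain ⟨x, hx, hxc⟩ := hL.cal i a han b hbn
        have hz : ∃ z < I.n * (I.n + 1), t = s₃.arr 9 (z : ℕ) ∨ t = c + I.act + (z : ℕ) := by
          rcases htt with ⟨i', a', ha', rfl⟩ | ⟨a', ha', rfl⟩
          · obtain ⟨z, hz, hzt⟩ := hL.job i' a' ha'
            exact ⟨z, hz, .inl hzt.symm⟩
          · refine ⟨a', ?_, .inr rfl⟩
            -- An offset `a' ≤ n` is a legal value of the common index because there is at least one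
            -- job.
            calc a' < I.n + 1 := Nat.lt_succ_of_le ha'
              _ ≤ I.n * (I.n + 1) := Nat.le_mul_of_pos_left _ hn
        obtain ⟨p, hp2, hpm, q1, q2⟩ := hcomp c t ⟨x, hx, hc.trans hxc.symm, hz⟩ ha ht
        exact ⟨p, hp2, hpm, (hslot p hp2).1.trans q1, (hslot p hp2).2.trans q2⟩
    · refine ⟨?_, h3, ?_, ?_, fun j => (hsort j).1, fun k _ => rfl, fun k _ => rfl,
        fun p _ => rfl, fun p _ => rfl, ?_, ?_, ?_⟩
      · exact (h₅.frame hF₆ rfl rfl).n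
      · rw [hF₆.reg 33 rfl, hF₅.reg 33 rfl, h33]
      · rw [hF₆.reg 34 rfl, h34]
      · intro p hpm
        simp only
        split_ifs with hp2
        · interval_cases p
          · simpa using c0
          · simpa using c1
        · rw [(hsent p (not_lt.1 hp2)).2.2, (hp p hpm).2.2.1, (hslot p (not_lt.1 hp2)).1,
            (hslot p (not_lt.1 hp2)).2]
      · intro p hp2 hpm
        simp only
        rw [hF₆.arr 13 rfl, (hp p hpm).2.2.2.1, (hslot p hp2).1, (hslot p hp2).2]
      · intro p hpm
        rw [hF₆.arr 14 rfl, (hp p hpm).2.2.2.2]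
  · have h00 := pow_le_bound hn hK (a := 0) (b := 0)
    have h10 := pow_le_bound hn hK (a := 1) (b := 0)
    have h11 := pow_le_bound hn hK (a := 1) (b := 1)
    have h20 := pow_le_bound hn hK (a := 2) (b := 0)
    have h30 := pow_le_bound hn hK (a := 3) (b := 0)
    have h40 := pow_le_bound hn hK (a := 4) (b := 0)
    have h50 := pow_le_bound hn hK (a := 5) (b := 0)
    have h51 := pow_le_bound hn hK (a := 5) (b := 1)
    -- Every monomial in the step count is bounded by the same quantity, so with that quantity
    -- abstract the claim is linear.
    generalize I.n ^ 16 * I.K ^ 2 = X at *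
    ring_nf at *
    linarith

end Calibration

theorem mainTheorem5 (ρ : Calibration.StartRule) :
    ∃ (P : Calibration.Cmd) (C : ℕ), ∀ I : Calibration.Instance, 1 ≤ I.n → 1 ≤ I.K →
      ∃ (T : ℕ) (s : Calibration.State),
        Calibration.Exec P I.input T s ∧ T ≤ C * (I.n ^ 16 * I.K ^ 2) ∧ s.Answers ρ I := by
  open Calibration in
  -- The constant is generous: the leading term is `18 ^ 3 * 70 * n ^ 16`, from scanning at most `18
  -- * n ^ 5` slots for each of at most `n * (18 * n ^ 5) ^ 2` entries, and the lower-order terms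
  -- fit in the rest.
  refine ⟨prepareCmd ρ ;; leafCmd ;; tableCmd ;; answerCmd, 2000000, fun I hn hK => ?_⟩
  refine Ends.mono (Ends.seq (B₁ := 10000 * (I.n ^ 16 * I.K ^ 2))
    (B₂ := 18 * I.n ^ 5 * (18 * I.n ^ 5 * 100 + 100) + 100 +
      (I.n * (18 * I.n ^ 5 * (18 * I.n ^ 5 * (18 * I.n ^ 5 * 70 + 110) + 10 + 10) + 30 + 10) + 12 +
      (I.n * (I.n * 200 + 200) + 200)))
    ((prepareCmd_ends I.hasInput hn hK).imp ?_)) ?_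
  · rintro s₁ - ⟨D, e, hD, hM, hR⟩
    refine Ends.seq (((leafCmd_ends hR).mono (by gcongr)).imp ?_)
    rintro s₂ - ⟨hR₂, h35, hst₂⟩
    refine Ends.seq (((tableCmd_ends hR₂ h35 hst₂).mono (by gcongr)).imp ?_)
    rintro s₃ - ⟨hR₃, h36, hst₃⟩
    exact answerCmd_ends hM hR₃ hn hK hst₃ h36
  · have h00 := pow_le_bound hn hK (a := 0) (b := 0)
    have h10 := pow_le_bound hn hK (a := 1) (b := 0)
    have h20 := pow_le_bound hn hK (a := 2) (b := 0)
    have h50 := pow_le_bound hn hK (a := 5) (b := 0)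
    have h60 := pow_le_bound hn hK (a := 6) (b := 0)
    have h100 := pow_le_bound hn hK (a := 10) (b := 0)
    have h110 := pow_le_bound hn hK (a := 11) (b := 0)
    have h160 := pow_le_bound hn hK (a := 16) (b := 0)
    generalize I.n ^ 16 * I.K ^ 2 = X at *
    ring_nf at *
    linarith
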